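/- Let $n\ge 1$ and write points of $\mathbb{R}^n$ as $x=(x',x_n)\in\mathbb{R}^{n-1}\times\mathbb{R}$. For $R,h>0$ let $C_{R,h}=\{|x'|<R,\ |x_n|<h\}$; by a cylinder we mean any translate of some $C_{R,h}$. For $w:\mathbb{R}^n\to[-1,1]$ put $F^{\pm}(w)=\partial\{w=\pm1\}$. A (classical, global) \emph{supersolution} is a continuous function $w:\mathbb{R}^n\to[-1,1]$ such that $w\in C^2(\overline{\{|w|<1\}})$ (that is, $w$ is $C^2$ in $\{|w|<1\}$, and $\nabla w$, $D^2w$ extend continuously to the closure), $\Delta w\le 0$ in $\{|w|<1\}$, the sets $F^+(w)$ and $F^-(w)$ are (possibly empty) embedded $C^2$ hypersurfaces, $0<|\nabla w|\le 1$ on $F^-(w)$ and $|\nabla w|\ge 1$ on $F^+(w)$. A \emph{subsolution} is defined in the same way with $\Delta w\ge0$ in $\{|w|<1\}$, $|\nabla w|\ge1$ on $F^-(w)$ and $|\nabla w|\le1$ on $F^+(w)$. On $F^\pm(w)$ the gradient is the one extended from $\{|w|<1\}$. Let $V$ be a subsolution and $W$ a supersolution, both monotonically increasing (in the weak sense) in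 $x_n$, with $V\le W$, and suppose that $(V,W)$ is \emph{globally nicely intertwined}: for every $R>0$ there is $h_0(R)$ such that for all $h\ge h_0(R)$ $$F^+(W)\cap C_{R,h}\subset\{|V|<1\},\qquad F^-(V)\cap C_{R,h}\subset\{|W|<1\}.$$ For a cylinder $\Omega$ let $S(\Omega)=\{v\in H^1(\Omega): V\le v\le W \text{ a.e.}\}$ and $I(v,\Omega)=\int_\Omega |\nabla v|^2+\chi_{\{|v|<1\}}$. (1) For all $R,h>0$ there is a minimizer of $I(\cdot,C_{R,h})$ over $S(C_{R,h})$ which is monotonically increasing in $x_n$. (2) Let $0<R_k\nearrow\infty$, $0<h_k\nearrow\infty$, $\Omega_k=C_{R_k,h_k}$, and for each $k$ let $u_k$ be any minimizer of $I(\cdot,\Omega_k)$ over $S(\Omega_k)$ that is monotonically increasing in $x_n$. Then each $u_k$ has a representative that is continuous in $\Omega_k$, and a subsequence of these representatives converges locally uniformly in $\mathbb{R}^n$. Moreover, every locally uniform limit $u:\mathbb{R}^n\to\mathbb{R}$ of a subsequence is locally Lipschitz continuous, is monotonically increasing in $x_n$, satisfies $V\le u\le W$, is harmonic in $\{|u|<1\}$,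 and for every cylinder $\Omega\subset\mathbb{R}^n$ one has $u\in S(\Omega)$ and $$I(u,\Omega)\le I(v,\Omega)\quad\text{for all } v\in S(\Omega)\text{ with } v-u\in H^1_0(\Omega).$$ -/

import Mathlib

open MeasureTheory Filter Topology
open scoped ContDiff Laplacian

namespace FreeBoundary

/-- Euclidean space `ℝⁿ⁺¹ = ℝⁿ × ℝ`. A point `x` has horizontal part `x' ∈ ℝⁿ` and last
coordinate `x (Fin.last n)`. -/
abbrev E (n : ℕ) : Type := EuclideanSpace ℝ (Fin (n + 1))

/-- The horizontal part `x'` of `x = (x', xₙ)`. -/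
def horiz {n : ℕ} (x : E n) : EuclideanSpace ℝ (Fin n) :=
  WithLp.toLp 2 (fun i : Fin n => x i.castSucc)

/-- The unit vector in the direction of the last coordinate. -/
noncomputable def eLast (n : ℕ) : E n := EuclideanSpace.single (Fin.last n) (1 : ℝ)

/-- The open vertical cylinder with centre `c`, radius `R` and half height `h`. -/
def cylinderAt {n : ℕ} (c : E n) (R h : ℝ) : Set (E n) :=
  {x | ‖horiz x - horiz c‖ < R ∧ |x (Fin.last n) - c (Fin.last n)| < h}

/-- The cylinder `C_{R,h} = {(x', xₙ) : |x'| < R, |xₙ| < h}`. -/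
def cylinder (n : ℕ) (R h : ℝ) : Set (E n) :=
  {x | ‖horiz x‖ < R ∧ |x (Fin.last n)| < h}

/-- `f` is monotonically increasing in the last variable on `s`. -/
def MonotoneLastOn {n : ℕ} (f : E n → ℝ) (s : Set (E n)) : Prop :=
  ∀ x ∈ s, ∀ t : ℝ, 0 ≤ t → x + t • eLast n ∈ s → f x ≤ f (x + t • eLast n)

/-! ### The free boundary problem -/

/-- The interphase `{|w| < 1}`. -/
def interphase {n : ℕ} (w : E n → ℝ) : Set (E n) := {x | |w x| < 1}

/-- `F⁺(w) = ∂{w = 1}`. -/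
def freeBdryPos {n : ℕ} (w : E n → ℝ) : Set (E n) := frontier {x | w x = 1}

/-- `F⁻(w) = ∂{w = -1}`. -/
def freeBdryNeg {n : ℕ} (w : E n → ℝ) : Set (E n) := frontier {x | w x = -1}

/-- `w ∈ C²(closure U)` for an open set `U`: `w` is twice continuously differentiable in `U`, and
`w`, its gradient and its Hessian extend continuously to `closure U`. Here `G` is the extended
gradient, and the extension of `w` itself is again `w`. -/
structure IsC2OnClosure {n : ℕ} (w : E n → ℝ) (U : Set (E n)) (G : E n → E n) : Prop where
  continuousOn : ContinuousOn w (closure U)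
  contDiffOn : ContDiffOn ℝ 2 w U
  gradient_eq : ∀ x ∈ U, G x = gradient w x
  gradient_cont : ContinuousOn G (closure U)
  hessian : ∃ H : E n → (E n →L[ℝ] E n),
    (∀ x ∈ U, H x = fderiv ℝ (gradient w) x) ∧ ContinuousOn H (closure U)

/-- An embedded `C²` hypersurface (possibly empty or disconnected): locally the zero set of a
`C²` function with non-vanishing differential. -/
def IsC2Hypersurface {n : ℕ} (S : Set (E n)) : Prop :=
  ∀ x ∈ S, ∃ U : Set (E n), IsOpen U ∧ x ∈ U ∧ ∃ g : E n → ℝ,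
    ContDiffOn ℝ 2 g U ∧ (∀ y ∈ U, fderiv ℝ g y ≠ 0) ∧ S ∩ U = {y | y ∈ U ∧ g y = 0}

/-- A global classical supersolution: a continuous `w : ℝⁿ⁺¹ → [-1, 1]` which is `C²` up to the
boundary of its interphase, superharmonic in the interphase, with `C²` free boundaries, and with
`0 < |∇w| ≤ 1` on `F⁻(w)` and `|∇w| ≥ 1` on `F⁺(w)`, the gradient on the free boundary being the
limit from the interphase. -/
def IsSupersolution {n : ℕ} (w : E n → ℝ) : Prop :=
  Continuous w ∧ (∀ x, |w x| ≤ 1) ∧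
  IsC2Hypersurface (freeBdryPos w) ∧ IsC2Hypersurface (freeBdryNeg w) ∧
  (∀ x ∈ interphase w, (Δ w) x ≤ 0) ∧
  ∃ G : E n → E n, IsC2OnClosure w (interphase w) G ∧
    (∀ x ∈ freeBdryNeg w, 0 < ‖G x‖ ∧ ‖G x‖ ≤ 1) ∧
    (∀ x ∈ freeBdryPos w, 1 ≤ ‖G x‖)

/-- A global classical subsolution: the same with `Δw ≥ 0` in the interphase, `|∇w| ≥ 1` on
`F⁻(w)` and `|∇w| ≤ 1` on `F⁺(w)`. -/
def IsSubsolution {n : ℕ} (w : E n → ℝ) : Prop :=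
  Continuous w ∧ (∀ x, |w x| ≤ 1) ∧
  IsC2Hypersurface (freeBdryPos w) ∧ IsC2Hypersurface (freeBdryNeg w) ∧
  (∀ x ∈ interphase w, 0 ≤ (Δ w) x) ∧
  ∃ G : E n → E n, IsC2OnClosure w (interphase w) G ∧
    (∀ x ∈ freeBdryNeg w, 1 ≤ ‖G x‖) ∧
    (∀ x ∈ freeBdryPos w, ‖G x‖ ≤ 1)

/-- `(V, W)` is nicely intertwined in `Ω`. -/
def NicelyIntertwinedIn {n : ℕ} (V W : E n → ℝ) (Ω : Set (E n)) : Prop :=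
  freeBdryPos W ∩ Ω ⊆ interphase V ∩ Ω ∧ freeBdryNeg V ∩ Ω ⊆ interphase W ∩ Ω

/-- `(V, W)` is nicely intertwined globally. -/
def NicelyIntertwinedGlobally {n : ℕ} (V W : E n → ℝ) : Prop :=
  ∀ R : ℝ, 0 < R → ∃ h₀ : ℝ, ∀ h : ℝ, h₀ ≤ h → NicelyIntertwinedIn V W (cylinder n R h)

/-! ### Sobolev functions and the energy -/

/-- Test functions: smooth with compact support contained in `Ω`. -/
def IsTestFunction {n : ℕ} (Ω : Set (E n)) (φ : E n → ℝ) : Prop :=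
  ContDiff ℝ ∞ φ ∧ HasCompactSupport φ ∧ tsupport φ ⊆ Ω

/-- `g ∈ L²(Ω)` is a weak gradient of `v` in `Ω`: `∫ v ∇φ = - ∫ φ g` for all test functions. -/
def IsWeakGradient {n : ℕ} (Ω : Set (E n)) (v : E n → ℝ) (g : E n → E n) : Prop :=
  MemLp g 2 (volume.restrict Ω) ∧
  ∀ φ : E n → ℝ, IsTestFunction Ω φ →
    ∫ x in Ω, v x • gradient φ x = - ∫ x in Ω, φ x • g x

/-- `v ∈ H¹(Ω)`. -/
def MemH1 {n : ℕ} (Ω : Set (E n)) (v : E n → ℝ) : Prop :=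
  MemLp v 2 (volume.restrict Ω) ∧ ∃ g : E n → E n, IsWeakGradient Ω v g

open Classical in
/-- The weak gradient of `v ∈ H¹(Ω)`, which is unique almost everywhere in `Ω`. -/
noncomputable def weakGradient {n : ℕ} (Ω : Set (E n)) (v : E n → ℝ) : E n → E n :=
  if hv : MemH1 Ω v then hv.2.choose else 0

/-- `v ∈ H¹₀(Ω)`: `v ∈ H¹(Ω)` is a limit of test functions in the `H¹(Ω)` norm. -/
def MemH10 {n : ℕ} (Ω : Set (E n)) (v : E n → ℝ) : Prop :=
  MemH1 Ω v ∧ ∃ φ : ℕ → E n → ℝ, (∀ k, IsTestFunction Ω (φ k)) ∧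
    Tendsto (fun k => eLpNorm (fun x => φ k x - v x) 2 (volume.restrict Ω)) atTop (𝓝 0) ∧
    Tendsto (fun k => eLpNorm (fun x => gradient (φ k) x - weakGradient Ω v x) 2
      (volume.restrict Ω)) atTop (𝓝 0)

/-- The energy `I(v, Ω) = ∫_Ω |∇v|² + χ_{|v| < 1}` of `v ∈ H¹(Ω)`, for bounded `Ω`. -/
noncomputable def energy {n : ℕ} (Ω : Set (E n)) (v : E n → ℝ) : ℝ :=
  ∫ x in Ω, (‖weakGradient Ω v x‖ ^ 2 + (interphase v).indicator (fun _ => (1 : ℝ)) x)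

/-- `v ∈ S(Ω) = {v ∈ H¹(Ω) : V ≤ v ≤ W a.e. in Ω}`. -/
def Admissible {n : ℕ} (V W : E n → ℝ) (Ω : Set (E n)) (v : E n → ℝ) : Prop :=
  MemH1 Ω v ∧ ∀ᵐ x ∂(volume.restrict Ω), V x ≤ v x ∧ v x ≤ W x

/-- `u` attains the minimum of `I(·, Ω)` over `S(Ω)` (no boundary condition is imposed). -/
def IsLocalMinimizer {n : ℕ} (V W : E n → ℝ) (Ω : Set (E n)) (u : E n → ℝ) : Prop :=
  Admissible V W Ω u ∧ ∀ v : E n → ℝ, Admissible V W Ω v → energy Ω u ≤ energy Ω v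

/-- In every vertical cylinder `Ω`, `u` minimizes `I(·, Ω)` among all `v ∈ S(Ω)` with
`v - u ∈ H¹₀(Ω)`. -/
def IsGlobalMinimizer {n : ℕ} (V W : E n → ℝ) (u : E n → ℝ) : Prop :=
  ∀ (c : E n) (R h : ℝ), 0 < R → 0 < h →
    Admissible V W (cylinderAt c R h) u ∧
    ∀ v : E n → ℝ, Admissible V W (cylinderAt c R h) v →
      MemH10 (cylinderAt c R h) (fun x => v x - u x) →
      energy (cylinderAt c R h) u ≤ energy (cylinderAt c R h) v

end FreeBoundary

/-!
# Minimizers of a two-phase free boundary problem between a sub- and a supersolution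

Minimizers in a cylinder exist by lower semicontinuity of the energy `∫ |∇v|² + χ_{|v| < 1}`
(`W12.exists_of_tendsto_of_energy_le`) together with its lattice property
`I(max v w) + I(min v w) = I(v) + I(w)`: upper limits of minimizing sequences are minimizers, and
there is a largest minimizer (`Obstacles.exists_largest`).

The largest minimizer is increasing in the last variable. For this, double the cylinder across its
top and its bottom, so that the vertical direction becomes a circle and functions become even.
Reflecting at a height `s` and rearranging the two values at reflected points, the larger one on
top, turns two copies of a function `u` into two new functions, the polarizations `polar h s u` and
`dual (polar h s (dual u))`, with the same total energy (`energy_polar_add`). Both lie between the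
obstacles because these are increasing. If `u` is the largest minimizer, then both polarizations
are minimizers, hence at most `u`, and this says that `u` is increasing
(`Obstacles.exists_monotone_isLocalMinimizer`). Polarizations are Sobolev functions since minimizers
are locally Lipschitz.

The interior regularity of minimizers rests on one comparison: the Dirichlet pairing of a minimizer
with a test function `φ` is at most of the order of `|K|^{1/2}` times the `L²` norm of `∇φ`, where
`K` contains the support of `φ` (`PerturbMin.sq_integral_inner_le`). Applied to the radial function
whose Laplacian is minus the scale derivative of the mollifier, it shows that mollifications
converge uniformly, so minimizers have continuous representatives. In the interphase `{|u| < 1}`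
they are harmonic, even where they touch the obstacles: these are subharmonic and superharmonic
there in the weak sense (`weakSubharm_of_laplacian_nonneg`), so that pushing `u` through an obstacle
and truncating again does not cost energy (`PerturbMin.integral_inner_nonpos`). Hence `u` has the
mean value property, and Harnack's inequality holds. A comparison with a radial barrier shows that
`1 - u` is at most of the order of the distance to `{u = 1}` (`PerturbMin.exists_one_sub_le`), and
therefore the slope of `u` is bounded in the interphase, with constants that depend only on the
dimension, on the Lipschitz constant of the obstacles and on the distance to the boundary
(`PerturbMin.exists_lipschitzOnWith`).

This estimate is uniform along an exhausting sequence of cylinders, and the Arzelà–Ascoli theorem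
gives locally uniform limits. A limit is compared with a competitor that agrees with it outside of a
convex set by gluing the competitor to the approximating minimizers in a thin layer; since all
functions are uniformly Lipschitz there, the cost is proportional to the volume of the layer
(`MinSeq.setIntegral_dens_le`).
-/

namespace FreeBoundary
open Metric

/-! ### The radial mollifier -/

/-- The unnormalised profile `exp (-1 / (1 - |z|²))` of the mollifier. -/
noncomputable def rawKer (n : ℕ) (z : E n) : ℝ := expNegInvGlue (1 - ‖z‖ ^ 2)

lemma rawKer_contDiff (n : ℕ) : ContDiff ℝ ∞ (rawKer n) :=
  (expNegInvGlue.contDiff (n := ⊤)).comp (contDiff_const.sub (contDiff_norm_sq ℝ))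

lemma rawKer_nonneg {n : ℕ} (z : E n) : 0 ≤ rawKer n z := expNegInvGlue.nonneg _

lemma support_rawKer (n : ℕ) : Function.support (rawKer n) = ball 0 1 := by
  ext z
  simp only [Function.mem_support, rawKer, ne_eq, expNegInvGlue.zero_iff_nonpos, mem_ball_zero_iff,
    not_le, sub_pos]
  exact sq_lt_one_iff₀ (norm_nonneg z)

lemma rawKer_hasCompactSupport (n : ℕ) : HasCompactSupport (rawKer n) := by
  rw [HasCompactSupport, tsupport, support_rawKer]
  exact (isCompact_closedBall (0 : E n) 1).of_isClosed_subset isClosed_closure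
    closure_ball_subset_closedBall

lemma rawKer_integrable (n : ℕ) : Integrable (rawKer n) :=
  (rawKer_contDiff n).continuous.integrable_of_hasCompactSupport (rawKer_hasCompactSupport n)

lemma rawKer_integral_pos (n : ℕ) : 0 < ∫ z, rawKer n z := by
  rw [integral_pos_iff_support_of_nonneg rawKer_nonneg (rawKer_integrable n), support_rawKer]
  exact measure_ball_pos _ _ one_pos

/-- The constant normalising `rawKer`. -/
noncomputable def kap (n : ℕ) : ℝ := (∫ z, rawKer n z)⁻¹

lemma kap_pos (n : ℕ) : 0 < kap n := inv_pos.2 (rawKer_integral_pos n)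

/-- The mollifier at scale `s`: smooth, radial, of integral one, positive exactly in the ball of
radius `s`. -/
noncomputable def ker {n : ℕ} (s : ℝ) (z : E n) : ℝ :=
  kap n * (s ^ (n + 1))⁻¹ * expNegInvGlue (1 - ‖z‖ ^ 2 / s ^ 2)

lemma ker_eq_rawKer {n : ℕ} {s : ℝ} (hs : 0 < s) (z : E n) :
    ker s z = kap n * (s ^ (n + 1))⁻¹ * rawKer n (s⁻¹ • z) := by
  simp only [ker, rawKer, norm_smul, norm_inv, Real.norm_eq_abs, abs_of_pos hs, mul_pow, inv_pow]
  rw [div_eq_inv_mul]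

lemma ker_contDiff (n : ℕ) (s : ℝ) : ContDiff ℝ ∞ (ker (n := n) s) :=
  contDiff_const.mul ((expNegInvGlue.contDiff (n := ⊤)).comp
    (contDiff_const.sub ((contDiff_norm_sq ℝ).div_const _)))

lemma ker_nonneg {n : ℕ} {s : ℝ} (hs : 0 < s) (z : E n) : 0 ≤ ker s z :=
  mul_nonneg (mul_nonneg (kap_pos n).le (by positivity)) (expNegInvGlue.nonneg _)

lemma ker_eq_zero {n : ℕ} {s : ℝ} (hs : 0 < s) {z : E n} (hz : s ≤ ‖z‖) : ker s z = 0 := by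
  have : 1 ≤ ‖z‖ ^ 2 / s ^ 2 := by
    rw [one_le_div (by positivity)]; gcongr
  simp [ker, expNegInvGlue.zero_of_nonpos (show 1 - ‖z‖ ^ 2 / s ^ 2 ≤ 0 by linarith)]

lemma support_ker_subset {n : ℕ} {s : ℝ} (hs : 0 < s) :
    Function.support (ker (n := n) s) ⊆ ball 0 s := by
  intro z hz
  by_contra h
  exact hz (ker_eq_zero hs (by simpa using h))

lemma tsupport_ker_subset {n : ℕ} {s : ℝ} (hs : 0 < s) :
    tsupport (ker (n := n) s) ⊆ closedBall 0 s :=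
  closure_minimal ((support_ker_subset hs).trans ball_subset_closedBall) isClosed_closedBall

lemma ker_hasCompactSupport {n : ℕ} {s : ℝ} (hs : 0 < s) :
    HasCompactSupport (ker (n := n) s) :=
  (isCompact_closedBall (0 : E n) s).of_isClosed_subset (isClosed_tsupport _)
    (tsupport_ker_subset hs)

lemma ker_integrable {n : ℕ} {s : ℝ} (hs : 0 < s) : Integrable (ker (n := n) s) :=
  (ker_contDiff n s).continuous.integrable_of_hasCompactSupport (ker_hasCompactSupport hs)

lemma integral_ker {n : ℕ} {s : ℝ} (hs : 0 < s) : ∫ z : E n, ker s z = 1 := by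
  simp_rw [ker_eq_rawKer hs, integral_const_mul]
  rw [Measure.integral_comp_inv_smul_of_nonneg _ _ hs.le]
  have h1 := (rawKer_integral_pos n).ne'
  have h2 : s ^ (n + 1) ≠ 0 := by positivity
  simp only [finrank_euclideanSpace, Fintype.card_fin, smul_eq_mul, kap]
  field_simp

lemma ker_le {n : ℕ} {s : ℝ} (hs : 0 < s) (z : E n) :
    ker s z ≤ kap n * (s ^ (n + 1))⁻¹ * expNegInvGlue 1 := by
  refine mul_le_mul_of_nonneg_left (expNegInvGlue.monotone ?_)
    (mul_nonneg (kap_pos n).le (by positivity))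
  have : 0 ≤ ‖z‖ ^ 2 / s ^ 2 := by positivity
  linarith

lemma le_ker {n : ℕ} {s θ : ℝ} (hs : 0 < s) {z : E n} (hz : ‖z‖ ≤ θ * s) :
    kap n * (s ^ (n + 1))⁻¹ * expNegInvGlue (1 - θ ^ 2) ≤ ker s z := by
  refine mul_le_mul_of_nonneg_left (expNegInvGlue.monotone ?_)
    (mul_nonneg (kap_pos n).le (by positivity))
  have : ‖z‖ ^ 2 / s ^ 2 ≤ θ ^ 2 := by
    rw [div_le_iff₀ (by positivity), ← mul_pow]
    gcongr
  linarith

/-- The kernels at scale `s` are Lipschitz with constant proportional to `s ^ (-(n + 2))`. -/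
lemma exists_ker_lipschitz (n : ℕ) : ∃ K : ℝ, 0 < K ∧ ∀ s : ℝ, 0 < s → ∀ a b : E n,
    |ker s a - ker s b| ≤ K * (s ^ (n + 1))⁻¹ * s⁻¹ * ‖a - b‖ := by
  obtain ⟨C, hC⟩ := (rawKer_contDiff n).lipschitzWith_of_hasCompactSupport
    (rawKer_hasCompactSupport n) (by simp)
  refine ⟨kap n * C + 1, by have := kap_pos n; positivity, fun s hs a b => ?_⟩
  rw [ker_eq_rawKer hs, ker_eq_rawKer hs, ← mul_sub, abs_mul]
  have h1 := hC.dist_le_mul (s⁻¹ • a) (s⁻¹ • b)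
  rw [Real.dist_eq, dist_eq_norm, ← smul_sub, norm_smul, norm_inv, Real.norm_eq_abs,
    abs_of_pos hs] at h1
  have hk := kap_pos n
  rw [abs_of_nonneg (by positivity)]
  calc kap n * (s ^ (n + 1))⁻¹ * |rawKer n (s⁻¹ • a) - rawKer n (s⁻¹ • b)|
      ≤ kap n * (s ^ (n + 1))⁻¹ * (C * (s⁻¹ * ‖a - b‖)) := by gcongr
    _ = (kap n * C) * (s ^ (n + 1))⁻¹ * s⁻¹ * ‖a - b‖ := by ring
    _ ≤ (kap n * C + 1) * (s ^ (n + 1))⁻¹ * s⁻¹ * ‖a - b‖ := by gcongr; linarith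

section mollification
variable {F : Type*} [NormedAddCommGroup F] [NormedSpace ℝ F]

/-- The mollification `∫ k_s(x - y) g(y) dy`. -/
noncomputable def mol {n : ℕ} (s : ℝ) (g : E n → F) (x : E n) : F :=
  ∫ y, ker s (x - y) • g y

lemma mol_eq_convolution {n : ℕ} (s : ℝ) (g : E n → F) :
    mol s g = convolution (ker s) g (ContinuousLinearMap.lsmul ℝ ℝ) volume := by
  ext x; rw [convolution_lsmul_swap]; rfl

lemma integral_ker_sub {n : ℕ} {s : ℝ} (hs : 0 < s) (x : E n) : ∫ y : E n, ker s (x - y) = 1 := by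
  rw [integral_sub_left_eq_self (fun y => ker s y) volume x, integral_ker hs]

lemma mol_contDiff {n : ℕ} {s : ℝ} (hs : 0 < s) {g : E n → F} (hg : LocallyIntegrable g) :
    ContDiff ℝ ∞ (mol s g) := by
  rw [mol_eq_convolution]
  exact HasCompactSupport.contDiff_convolution_left (n := ⊤) _ (ker_hasCompactSupport hs)
    (ker_contDiff n s) hg

/-- Lebesgue points are points of convergence of the mollifications. -/
lemma ae_tendsto_mol {n : ℕ} [CompleteSpace F] {g : E n → F} (hg : LocallyIntegrable g) :
    ∀ᵐ x, Tendsto (fun s => mol s g x) (𝓝[>] 0) (𝓝 (g x)) := by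
  filter_upwards [(Besicovitch.vitaliFamily (volume : Measure (E n))).ae_tendsto_average_norm_sub
    hg] with x h₀
  have := h₀.comp (Besicovitch.tendsto_filterAt volume x)
  have hev : ∀ᶠ s : ℝ in 𝓝[>] 0, 0 < s := self_mem_nhdsWithin
  refine tendsto_integral_smul_of_tendsto_average_norm_sub
    (kap n * expNegInvGlue 1 * volume.real (ball (0 : E n) 1)) this ?_ ?_ ?_ ?_
  · filter_upwards with i using hg.integrableOn_isCompact (isCompact_closedBall _ _)
  · refine tendsto_const_nhds.congr' ?_
    filter_upwards [hev] with s hs using (integral_ker_sub hs x).symm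
  · filter_upwards [hev] with s hs y hy
    have := support_ker_subset hs (show x - y ∈ Function.support (ker s) from hy)
    rw [mem_closedBall, dist_comm, dist_eq_norm]
    exact (mem_ball_zero_iff.1 this).le
  · filter_upwards [hev] with s hs y
    rw [abs_of_nonneg (ker_nonneg hs _), Measure.addHaar_real_closedBall _ _ hs.le,
      finrank_euclideanSpace, Fintype.card_fin]
    refine (ker_le hs _).trans_eq ?_
    have h1 : 0 < volume.real (ball (0 : E n) 1) :=
      ENNReal.toReal_pos (measure_ball_pos _ _ one_pos).ne' measure_ball_lt_top.ne
    field_simp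

lemma norm_mol_le {n : ℕ} {s : ℝ} (hs : 0 < s) (g : E n → F) (x : E n) :
    ‖mol s g x‖ ≤ mol s (fun y => ‖g y‖) x := by
  refine (norm_integral_le_integral_norm _).trans_eq ?_
  simp [mol, norm_smul, abs_of_nonneg (ker_nonneg hs _)]

lemma mol_integrable {n : ℕ} {s : ℝ} (hs : 0 < s) {g : E n → F} (hg : Integrable g) :
    Integrable (mol s g) := by
  rw [mol_eq_convolution]
  exact (ker_integrable hs).integrable_convolution _ hg

lemma integral_mol {n : ℕ} {s : ℝ} (hs : 0 < s) [CompleteSpace F] {g : E n → F}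
    (hg : Integrable g) : ∫ x, mol s g x = ∫ x, g x := by
  rw [mol_eq_convolution, integral_convolution _ (ker_integrable hs) hg, integral_ker hs]
  simp

end mollification

section L1
variable {F : Type*} [NormedAddCommGroup F] [NormedSpace ℝ F]

/-- Mollifications converge in `L¹`: they converge almost everywhere and `∫ k_s * |g| = ∫ |g|`,
so Fatou's lemma for `k_s * |g| + |g| - |k_s * g - g| ≥ 0` applies. -/
lemma tendsto_integral_norm_mol_sub {n : ℕ} [CompleteSpace F] {g : E n → F} (hg : Integrable g)
    {s : ℕ → ℝ} (hs : ∀ k, 0 < s k) (hs0 : Tendsto s atTop (𝓝 0)) :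
    Tendsto (fun k => ∫ x, ‖mol (s k) g x - g x‖) atTop (𝓝 0) := by
  have hsw : Tendsto s atTop (𝓝[>] 0) :=
    tendsto_nhdsWithin_iff.2 ⟨hs0, Eventually.of_forall hs⟩
  set f : ℕ → E n → ℝ := fun k x =>
    mol (s k) (fun y => ‖g y‖) x + ‖g x‖ - ‖mol (s k) g x - g x‖ with hf
  have hint1 : ∀ k, Integrable (mol (s k) (fun y => ‖g y‖)) := fun k =>
    mol_integrable (hs k) hg.norm
  have hint2 : ∀ k, Integrable (fun x => ‖mol (s k) g x - g x‖) := fun k =>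
    ((mol_integrable (hs k) hg).sub hg).norm
  have hfi : ∀ k, Integrable (f k) := fun k => ((hint1 k).add hg.norm).sub (hint2 k)
  have hf0 : ∀ k x, 0 ≤ f k x := fun k x => by
    have h1 := norm_mol_le (hs k) g x
    have h2 := norm_sub_le (mol (s k) g x) (g x)
    simp only [hf]; linarith
  have hfint : ∀ k, ∫ x, f k x = 2 * (∫ x, ‖g x‖) - ∫ x, ‖mol (s k) g x - g x‖ := fun k => by
    have e : ∫ x, f k x = (∫ x, (mol (s k) (fun y => ‖g y‖) x + ‖g x‖))
        - ∫ x, ‖mol (s k) g x - g x‖ := integral_sub ((hint1 k).add hg.norm) (hint2 k)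
    rw [e, integral_add (hint1 k) hg.norm, integral_mol (hs k) hg.norm]; ring
  have hlim : ∀ᵐ x, liminf (fun k => ENNReal.ofReal (f k x)) atTop = ENNReal.ofReal (2 * ‖g x‖) := by
    filter_upwards [ae_tendsto_mol hg.locallyIntegrable, ae_tendsto_mol hg.norm.locallyIntegrable]
      with x h1 h2
    refine Tendsto.liminf_eq (ENNReal.tendsto_ofReal ?_)
    have h3 := ((h2.comp hsw).add_const ‖g x‖).sub (((h1.comp hsw).sub_const (g x)).norm)
    simpa [two_mul] using h3
  have hfatou := lintegral_liminf_le' (μ := volume) (u := atTop)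
    (f := fun k x => ENNReal.ofReal (f k x)) (fun k => (hfi k).aestronglyMeasurable.aemeasurable.ennreal_ofReal)
  rw [lintegral_congr_ae hlim] at hfatou
  rw [← ofReal_integral_eq_lintegral_ofReal (hg.norm.const_mul 2)
    (Eventually.of_forall fun x => by positivity)] at hfatou
  simp_rw [fun k => (ofReal_integral_eq_lintegral_ofReal (hfi k)
    (Eventually.of_forall (hf0 k))).symm, hfint, integral_const_mul] at hfatou
  have hnn : ∀ k, 0 ≤ ∫ x, ‖mol (s k) g x - g x‖ := fun k => integral_nonneg fun x => norm_nonneg _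
  rw [Metric.tendsto_atTop]
  intro ε hε
  by_cases hA : 2 * ∫ x, ‖g x‖ = 0
  · refine ⟨0, fun k _ => ?_⟩
    have : 0 ≤ ∫ x, f k x := integral_nonneg (hf0 k)
    rw [hfint, hA] at this
    rw [Real.dist_eq, sub_zero, abs_of_nonneg (hnn k)]; linarith
  have hA' : 0 < 2 * ∫ x, ‖g x‖ :=
    lt_of_le_of_ne (by have : 0 ≤ ∫ x, ‖g x‖ := integral_nonneg fun x => norm_nonneg _
                       positivity) (Ne.symm hA)
  have hlt : ENNReal.ofReal (2 * (∫ x, ‖g x‖) - ε) < ENNReal.ofReal (2 * ∫ x, ‖g x‖) :=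
    (ENNReal.ofReal_lt_ofReal_iff hA').2 (by linarith)
  have hev := eventually_lt_of_lt_liminf (hlt.trans_le hfatou)
  obtain ⟨N, hN⟩ := eventually_atTop.1 hev
  refine ⟨N, fun k hk => ?_⟩
  have := (ENNReal.ofReal_lt_ofReal_iff').1 (hN k hk)
  rw [Real.dist_eq, sub_zero, abs_of_nonneg (hnn k)]; linarith [this.1]

end L1

/-! ### Test functions and gradients -/

variable {n : ℕ} {Ω Ω' : Set (E n)}

lemma gradient_def (f : E n → ℝ) (x : E n) :
    gradient f x = (InnerProductSpace.toDual ℝ (E n)).symm (fderiv ℝ f x) := rfl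

lemma norm_gradient (f : E n → ℝ) (x : E n) : ‖gradient f x‖ = ‖fderiv ℝ f x‖ := by
  rw [gradient_def, LinearIsometryEquiv.norm_map]

lemma gradient_mul {f g : E n → ℝ} {x : E n} (hf : DifferentiableAt ℝ f x)
    (hg : DifferentiableAt ℝ g x) :
    gradient (fun y => f y * g y) x = f x • gradient g x + g x • gradient f x := by
  rw [gradient_def, fderiv_fun_mul hf hg]; simp [gradient_def]

lemma gradient_eq_zero_of_notMem_tsupport {f : E n → ℝ} {x : E n} (hx : x ∉ tsupport f) :
    gradient f x = 0 := by
  rw [gradient_def, fderiv_of_notMem_tsupport (𝕜 := ℝ) hx, map_zero]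

lemma ContDiff.continuous_gradient {f : E n → ℝ} (hf : ContDiff ℝ ∞ f) :
    Continuous (gradient f) :=
  (LinearIsometryEquiv.continuous _).comp (hf.continuous_fderiv (by simp))

lemma HasCompactSupport.gradient {f : E n → ℝ} (hf : HasCompactSupport f) :
    HasCompactSupport (gradient f) :=
  hf.mono' fun _ hx => by
    by_contra h
    exact hx (gradient_eq_zero_of_notMem_tsupport h)

lemma IsTestFunction.mono (h : Ω' ⊆ Ω) {φ : E n → ℝ} (hφ : IsTestFunction Ω' φ) :
    IsTestFunction Ω φ := ⟨hφ.1, hφ.2.1, hφ.2.2.trans h⟩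

lemma IsTestFunction.mul_left {φ ζ : E n → ℝ} (hφ : IsTestFunction Ω φ) (hζ : ContDiff ℝ ∞ ζ) :
    IsTestFunction Ω (fun x => ζ x * φ x) :=
  ⟨hζ.mul hφ.1, hφ.2.1.mul_left, (tsupport_mul_subset_right).trans hφ.2.2⟩

lemma IsTestFunction.mul_of_tsupport {φ ζ : E n → ℝ} (hφ : ContDiff ℝ ∞ φ)
    (hζ : IsTestFunction Ω ζ) : IsTestFunction Ω (fun x => ζ x * φ x) :=
  ⟨hζ.1.mul hφ, hζ.2.1.mul_right, (tsupport_mul_subset_left).trans hζ.2.2⟩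

/-- Smooth cutoff functions. -/
lemma exists_cutoff {K U : Set (E n)} (hK : IsCompact K) (hU : IsOpen U) (hKU : K ⊆ U) :
    ∃ ζ : E n → ℝ, IsTestFunction U ζ ∧ (∀ x, ζ x ∈ Set.Icc (0 : ℝ) 1) ∧
      ∀ᶠ x in 𝓝ˢ K, ζ x = 1 := by
  obtain ⟨L, hL, hKL, hLU⟩ := exists_compact_between hK hU hKU
  obtain ⟨f, h1, h2, h3⟩ := exists_contMDiffMap_one_nhds_of_subset_interior
    (modelWithCornersSelf ℝ (E n)) (n := ⊤) hK.isClosed hKL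
  have hs : tsupport f ⊆ L := closure_minimal (fun x hx => by_contra fun h => hx (h2 x h)) hL.isClosed
  exact ⟨f, ⟨f.contMDiff.contDiff, hL.of_isClosed_subset (isClosed_tsupport _) hs,
    hs.trans hLU⟩, h3, h1⟩

lemma gradient_eq_zero_of_eventually_const {f : E n → ℝ} {c : ℝ} {x : E n}
    (h : ∀ᶠ y in 𝓝 x, f y = c) : gradient f x = 0 := by
  rw [Filter.EventuallyEq.gradient_eq (f := fun _ => c) h, gradient_fun_const]

/-! ### Sobolev functions -/

/-- `v ∈ H¹(Ω)` with weak gradient `g`. -/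
structure W12 (Ω : Set (E n)) (v : E n → ℝ) (g : E n → E n) : Prop where
  memLp : MemLp v 2 (volume.restrict Ω)
  weak : IsWeakGradient Ω v g

lemma W12.memLp_grad {v : E n → ℝ} {g : E n → E n} (h : W12 Ω v g) :
    MemLp g 2 (volume.restrict Ω) := h.weak.1

lemma W12.memH1 {v : E n → ℝ} {g : E n → E n} (h : W12 Ω v g) : MemH1 Ω v := ⟨h.1, g, h.2⟩

lemma MemH1.w12 {v : E n → ℝ} (h : MemH1 Ω v) : W12 Ω v (weakGradient Ω v) := by
  refine ⟨h.1, ?_⟩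
  rw [weakGradient, dif_pos h]
  exact h.2.choose_spec

section integrability
variable {F : Type*} [NormedAddCommGroup F] [NormedSpace ℝ F]

lemma MemLp.integrable_smul_two {α : Type*} [MeasurableSpace α] {μ : Measure α} {f : α → F}
    {φ : α → ℝ} (hφ : MemLp φ 2 μ) (hf : MemLp f 2 μ) : Integrable (fun x => φ x • f x) μ := by
  have := MemLp.smul (r := 1) hf hφ
  exact memLp_one_iff_integrable.1 this

lemma MemLp.integrable_inner_two {α : Type*} [MeasurableSpace α] {μ : Measure α} {f g : α → E n}
    (hf : MemLp f 2 μ) (hg : MemLp g 2 μ) : Integrable (fun x => inner ℝ (f x) (g x)) μ :=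
  MemLp.integrable_mul (p := 2) (q := 2) hf.norm hg.norm |>.mono'
    (hf.1.inner hg.1) (Eventually.of_forall fun _ => norm_inner_le_norm _ _)

lemma IsTestFunction.memLp {φ : E n → ℝ} (hφ : IsTestFunction Ω' φ) :
    MemLp φ 2 (volume.restrict Ω) :=
  hφ.1.continuous.memLp_of_hasCompactSupport hφ.2.1

lemma IsTestFunction.memLp_gradient {φ : E n → ℝ} (hφ : IsTestFunction Ω' φ) :
    MemLp (gradient φ) 2 (volume.restrict Ω) :=
  (ContDiff.continuous_gradient hφ.1).memLp_of_hasCompactSupport (HasCompactSupport.gradient hφ.2.1)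
end integrability

lemma W12.integrable_smul_gradient {v : E n → ℝ} {g : E n → E n} (h : W12 Ω v g) {φ : E n → ℝ}
    (hφ : IsTestFunction Ω' φ) : Integrable (fun x => v x • gradient φ x) (volume.restrict Ω) :=
  MemLp.integrable_smul_two h.1 hφ.memLp_gradient

lemma W12.integrable_smul_grad {v : E n → ℝ} {g : E n → E n} (h : W12 Ω v g) {φ : E n → ℝ}
    (hφ : IsTestFunction Ω' φ) : Integrable (fun x => φ x • g x) (volume.restrict Ω) :=
  MemLp.integrable_smul_two hφ.memLp h.memLp_grad

lemma W12.add {v w : E n → ℝ} {g k : E n → E n} (hv : W12 Ω v g) (hw : W12 Ω w k) :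
    W12 Ω (fun x => v x + w x) (fun x => g x + k x) := by
  refine ⟨hv.1.add hw.1, hv.memLp_grad.add hw.memLp_grad, fun φ hφ => ?_⟩
  simp_rw [add_smul, smul_add]
  rw [integral_add (hv.integrable_smul_gradient hφ) (hw.integrable_smul_gradient hφ),
    integral_add (hv.integrable_smul_grad hφ) (hw.integrable_smul_grad hφ), hv.2.2 φ hφ,
    hw.2.2 φ hφ, neg_add]

lemma W12.const_mul {v : E n → ℝ} {g : E n → E n} (hv : W12 Ω v g) (c : ℝ) :
    W12 Ω (fun x => c * v x) (fun x => c • g x) := by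
  refine ⟨hv.1.const_mul c, hv.memLp_grad.const_smul c, fun φ hφ => ?_⟩
  simp_rw [mul_smul, smul_comm _ c, integral_smul]
  rw [hv.2.2 φ hφ, smul_neg]

lemma W12.neg {v : E n → ℝ} {g : E n → E n} (hv : W12 Ω v g) :
    W12 Ω (fun x => - v x) (fun x => - g x) := by
  simpa using hv.const_mul (-1)

lemma W12.sub {v w : E n → ℝ} {g k : E n → E n} (hv : W12 Ω v g) (hw : W12 Ω w k) :
    W12 Ω (fun x => v x - w x) (fun x => g x - k x) := by
  simpa [sub_eq_add_neg] using hv.add hw.neg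

lemma W12.congr {v w : E n → ℝ} {g k : E n → E n} (hv : W12 Ω v g)
    (h1 : v =ᵐ[volume.restrict Ω] w) (h2 : g =ᵐ[volume.restrict Ω] k) : W12 Ω w k := by
  refine ⟨hv.1.ae_eq h1, hv.memLp_grad.ae_eq h2, fun φ hφ => ?_⟩
  rw [← integral_congr_ae (h1.mono fun x hx => by simp only [hx] :
      (fun x => v x • gradient φ x) =ᵐ[volume.restrict Ω] fun x => w x • gradient φ x), hv.2.2 φ hφ,
    integral_congr_ae (h2.mono fun x hx => by simp only [hx] :
      (fun x => φ x • g x) =ᵐ[volume.restrict Ω] fun x => φ x • k x)]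

lemma setIntegral_smul_gradient_of_tsupport {F : Type*} [NormedAddCommGroup F] [NormedSpace ℝ F]
    {f : E n → F} {φ : E n → ℝ} (hφ : IsTestFunction Ω' φ) (hf : ∀ x ∉ tsupport φ, f x = 0)
    (h : Ω' ⊆ Ω) (hΩ : MeasurableSet Ω) : ∫ x in Ω, f x = ∫ x in Ω', f x :=
  setIntegral_eq_of_subset_of_forall_sdiff_eq_zero hΩ h fun x hx =>
    hf x fun h' => hx.2 (hφ.2.2 h')

lemma W12.mono {v : E n → ℝ} {g : E n → E n} (hv : W12 Ω v g) (h : Ω' ⊆ Ω)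
    (hΩ : MeasurableSet Ω) : W12 Ω' v g := by
  refine ⟨hv.1.mono_measure (Measure.restrict_mono_set _ h),
    hv.memLp_grad.mono_measure (Measure.restrict_mono_set _ h), fun φ hφ => ?_⟩
  rw [← setIntegral_smul_gradient_of_tsupport hφ (fun x hx => by
      rw [gradient_eq_zero_of_notMem_tsupport hx, smul_zero]) h hΩ,
    ← setIntegral_smul_gradient_of_tsupport hφ (fun x hx => by
      rw [image_eq_zero_of_notMem_tsupport hx, zero_smul]) h hΩ]
  exact hv.2.2 φ (hφ.mono h)

/-- Weak gradients are unique almost everywhere. -/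
lemma W12.unique (hΩ : IsOpen Ω) {v : E n → ℝ} {g k : E n → E n} (hg : W12 Ω v g)
    (hk : W12 Ω v k) : g =ᵐ[volume.restrict Ω] k := by
  have hd := hg.memLp_grad.sub hk.memLp_grad
  have hL : LocallyIntegrableOn (fun x => g x - k x) Ω :=
    locallyIntegrableOn_of_locallyIntegrable_restrict (hd.locallyIntegrable (by norm_num))
  have := hΩ.ae_eq_zero_of_integral_contDiff_smul_eq_zero hL fun φ h1 h2 h3 => by
    have ht : IsTestFunction Ω φ := ⟨h1, h2, h3⟩
    rw [← setIntegral_eq_integral_of_forall_compl_eq_zero (s := Ω) fun x hx => by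
      rw [image_eq_zero_of_notMem_tsupport (fun h' => hx (h3 h')), zero_smul]]
    simp_rw [smul_sub]
    rw [integral_sub (hg.integrable_smul_grad ht) (hk.integrable_smul_grad ht), sub_eq_zero,
      ← neg_inj, ← hg.2.2 φ ht, hk.2.2 φ ht]
  rw [EventuallyEq, ae_restrict_iff' hΩ.measurableSet]
  filter_upwards [this] with x hx h using sub_eq_zero.1 (hx h)

lemma W12.weakGradient_ae (hΩ : IsOpen Ω) {v : E n → ℝ} {g : E n → E n} (hg : W12 Ω v g) :
    weakGradient Ω v =ᵐ[volume.restrict Ω] g := hg.memH1.w12.unique hΩ hg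

lemma W12.zero : W12 Ω (fun _ => 0) (fun _ => 0) :=
  ⟨MemLp.zero', MemLp.zero', fun φ _ => by simp⟩

lemma W12.grad_ae_eq_zero {v : E n → ℝ} {g : E n → E n} (hv : W12 Ω v g) (hΩ : IsOpen Ω)
    {U : Set (E n)} (hU : IsOpen U) (h0 : ∀ᵐ x ∂(volume.restrict Ω), x ∈ U → v x = 0) :
    ∀ᵐ x ∂(volume.restrict Ω), x ∈ U → g x = 0 := by
  have h1 : W12 (Ω ∩ U) v g := hv.mono Set.inter_subset_left hΩ.measurableSet
  have h2 : v =ᵐ[volume.restrict (Ω ∩ U)] fun _ => 0 := by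
    rw [EventuallyEq, ae_restrict_iff' (hΩ.inter hU).measurableSet]
    rw [ae_restrict_iff' hΩ.measurableSet] at h0
    filter_upwards [h0] with x hx h using hx h.1 h.2
  have h3 := h1.unique (hΩ.inter hU) (W12.zero.congr h2.symm (EventuallyEq.refl _ _))
  rw [EventuallyEq, ae_restrict_iff' (hΩ.inter hU).measurableSet] at h3
  rw [ae_restrict_iff' hΩ.measurableSet]
  filter_upwards [h3] with x hx h h' using hx ⟨h, h'⟩

/-! ### Cutoffs, extension by zero and mollification -/

lemma fderiv_eq_inner_gradient (f : E n → ℝ) (x e : E n) :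
    fderiv ℝ f x e = inner ℝ (gradient f x) e := by
  rw [gradient_def, InnerProductSpace.toDual_symm_apply]

/-- Integration by parts against a test function for continuously differentiable functions. -/
lemma integral_smul_gradient_eq_neg {f φ : E n → ℝ} (hf : ContDiff ℝ 1 f)
    (hφ : IsTestFunction Ω φ) :
    ∫ x, f x • gradient φ x = - ∫ x, φ x • gradient f x := by
  have cf : Continuous (gradient f) :=
    (LinearIsometryEquiv.continuous _).comp (hf.continuous_fderiv (by simp))
  have cφ := ContDiff.continuous_gradient hφ.1
  have i1 : Integrable (fun x => f x • gradient φ x) :=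
    (hf.continuous.smul cφ).integrable_of_hasCompactSupport
      (HasCompactSupport.gradient hφ.2.1).smul_left
  have i2 : Integrable (fun x => φ x • gradient f x) :=
    (hφ.1.continuous.smul cf).integrable_of_hasCompactSupport hφ.2.1.smul_right
  refine ext_inner_left ℝ fun e => ?_
  have j1 : ∀ x, inner ℝ e (f x • gradient φ x) = f x * fderiv ℝ φ x e := fun x => by
    rw [inner_smul_right, fderiv_eq_inner_gradient, real_inner_comm]
  have j2 : ∀ x, inner ℝ e (φ x • gradient f x) = fderiv ℝ f x e * φ x := fun x => by
    rw [inner_smul_right, fderiv_eq_inner_gradient, real_inner_comm, mul_comm]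
  rw [inner_neg_right, ← integral_inner i1, ← integral_inner i2]
  simp_rw [j1, j2]
  refine integral_mul_fderiv_eq_neg_fderiv_mul_of_integrable ?_ ?_ ?_
    (fun x _ => hf.differentiable (by simp) x) (fun x _ => hφ.1.differentiable (by simp) x)
  · exact (i2.const_inner e).congr (Eventually.of_forall j2)
  · exact (i1.const_inner e).congr (Eventually.of_forall j1)
  · exact (hf.continuous.mul hφ.1.continuous).integrable_of_hasCompactSupport hφ.2.1.mul_left

lemma W12.of_contDiff {f : E n → ℝ} (hf : ContDiff ℝ 1 f) (hfc : HasCompactSupport f) :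
    W12 Set.univ f (gradient f) := by
  have hg : Continuous (gradient f) :=
    (InnerProductSpace.toDual ℝ (E n)).symm.continuous.comp (hf.continuous_fderiv (by norm_num))
  refine ⟨?_, ?_, fun φ hφ => ?_⟩
  · exact (hf.continuous.memLp_of_hasCompactSupport hfc).restrict _
  · exact (hg.memLp_of_hasCompactSupport (HasCompactSupport.gradient hfc)).restrict _
  · simpa using integral_smul_gradient_eq_neg hf hφ

lemma IsTestFunction.w12 {φ : E n → ℝ} (hφ : IsTestFunction Ω' φ) : W12 Ω φ (gradient φ) :=
  (W12.of_contDiff (hφ.1.of_le (by exact_mod_cast le_top)) hφ.2.1).mono (Set.subset_univ _)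
    MeasurableSet.univ

/-- The product of a Sobolev function in `Ω` with a test function is a Sobolev function on the whole
space. -/
lemma W12.mul_test {v : E n → ℝ} {g : E n → E n} (hv : W12 Ω v g) (hΩ : MeasurableSet Ω)
    {ζ : E n → ℝ} (hζ : IsTestFunction Ω ζ) :
    W12 Set.univ (fun x => ζ x * v x) (fun x => ζ x • g x + v x • gradient ζ x) := by
  obtain ⟨C, hC⟩ := hζ.2.1.exists_bound_of_continuous hζ.1.continuous
  obtain ⟨C', hC'⟩ := (HasCompactSupport.gradient hζ.2.1).exists_bound_of_continuous
    (ContDiff.continuous_gradient hζ.1)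
  have z1 : ∀ x ∉ Ω, ζ x = 0 := fun x hx =>
    image_eq_zero_of_notMem_tsupport fun h => hx (hζ.2.2 h)
  have z2 : ∀ x ∉ Ω, gradient ζ x = 0 := fun x hx =>
    gradient_eq_zero_of_notMem_tsupport fun h => hx (hζ.2.2 h)
  have cg := ContDiff.continuous_gradient hζ.1
  have m1 : MemLp (fun x => ζ x * v x) 2 (volume.restrict Ω) :=
    hv.1.of_le_mul (c := C) (hζ.1.continuous.aestronglyMeasurable.mul hv.1.1)
      (Eventually.of_forall fun x => by rw [norm_mul]; gcongr; exact hC x)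
  have m2 : MemLp (fun x => ζ x • g x + v x • gradient ζ x) 2 (volume.restrict Ω) := by
    refine MemLp.add ?_ ?_
    · exact hv.memLp_grad.of_le_mul (c := C)
        (hζ.1.continuous.aestronglyMeasurable.smul hv.memLp_grad.1)
        (Eventually.of_forall fun x => by rw [norm_smul]; gcongr; exact hC x)
    · exact hv.1.of_le_mul (c := C') (hv.1.1.smul cg.aestronglyMeasurable)
        (Eventually.of_forall fun x => by rw [norm_smul, mul_comm]; gcongr; exact hC' x)
  refine ⟨?_, ?_, fun φ hφ => ?_⟩
  · rw [Measure.restrict_univ]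
    rw [← memLp_indicator_iff_restrict hΩ] at m1
    have e : (fun x => ζ x * v x) = Ω.indicator (fun x => ζ x * v x) := by
      ext x; by_cases h : x ∈ Ω <;> simp [h, z1]
    rwa [e]
  · rw [Measure.restrict_univ]
    rw [← memLp_indicator_iff_restrict hΩ] at m2
    have e : (fun x => ζ x • g x + v x • gradient ζ x) =
        Ω.indicator (fun x => ζ x • g x + v x • gradient ζ x) := by
      ext1 x; by_cases h : x ∈ Ω <;> simp [h, z1, z2]
    rwa [e]
  · simp only [Measure.restrict_univ]
    have ht : IsTestFunction Ω (fun x => ζ x * φ x) := IsTestFunction.mul_of_tsupport hφ.1 hζ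
    have h1 := hv.2.2 _ ht
    have hgm : ∀ x, gradient (fun x => ζ x * φ x) x = ζ x • gradient φ x + φ x • gradient ζ x :=
      fun x => gradient_mul (hζ.1.differentiable (by simp) x) (hφ.1.differentiable (by simp) x)
    rw [← setIntegral_eq_integral_of_forall_compl_eq_zero (μ := volume) (s := Ω)
        (fun x hx => by simp [z1 x hx]),
      ← setIntegral_eq_integral_of_forall_compl_eq_zero (μ := volume) (s := Ω)
        (fun x hx => by simp [z1 x hx, z2 x hx])]
    have i2 : Integrable (fun x => v x • φ x • gradient ζ x) (volume.restrict Ω) := by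
      refine MemLp.integrable_smul_two hv.1 ?_
      exact (hφ.1.continuous.smul cg).memLp_of_hasCompactSupport
        (HasCompactSupport.gradient hζ.2.1).smul_left
    have i1 := hv.integrable_smul_gradient ht
    have i3 := hv.integrable_smul_grad ht
    have e1 : ∫ x in Ω, (ζ x * v x) • gradient φ x =
        (∫ x in Ω, v x • gradient (fun x => ζ x * φ x) x) - ∫ x in Ω, v x • φ x • gradient ζ x := by
      rw [← integral_sub i1 i2]
      congr 1; ext1 x
      rw [hgm, smul_add, add_sub_cancel_right, smul_smul, mul_comm]
    have e2 : ∫ x in Ω, φ x • (ζ x • g x + v x • gradient ζ x) =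
        (∫ x in Ω, (ζ x * φ x) • g x) + ∫ x in Ω, v x • φ x • gradient ζ x := by
      rw [← integral_add i3 i2]
      congr 1; ext1 x
      rw [smul_add, smul_smul, mul_comm (φ x), smul_comm (v x)]
    rw [e1, e2, h1]; abel

/-- Extension by zero of a Sobolev function vanishing outside a compact subset. -/
lemma W12.extend_zero {v : E n → ℝ} {g : E n → E n} (hv : W12 Ω v g) (hΩ : IsOpen Ω)
    {K : Set (E n)} (hK : IsCompact K) (hKΩ : K ⊆ Ω)
    (h0 : ∀ᵐ x ∂(volume.restrict Ω), x ∉ K → v x = 0) :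
    W12 Set.univ (K.indicator v) (K.indicator g) := by
  obtain ⟨ζ, hζ, -, hζ1⟩ := exists_cutoff hK hΩ hKΩ
  have hζx : ∀ x ∈ K, ∀ᶠ y in 𝓝 x, ζ y = 1 := fun x hx => eventually_nhdsSet_iff_forall.1 hζ1 x hx
  have hg0 := hv.grad_ae_eq_zero hΩ hK.isClosed.isOpen_compl h0
  have hm := hv.mul_test hΩ.measurableSet hζ
  rw [ae_restrict_iff' hΩ.measurableSet] at h0 hg0
  refine hm.congr ?_ ?_
  · rw [Measure.restrict_univ]
    filter_upwards [h0] with x hx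
    by_cases hxK : x ∈ K
    · simp [hxK, (hζx x hxK).self_of_nhds]
    · by_cases hxΩ : x ∈ Ω
      · simp [hxK, hx hxΩ hxK]
      · simp [hxK, image_eq_zero_of_notMem_tsupport fun h => hxΩ (hζ.2.2 h)]
  · rw [Measure.restrict_univ]
    filter_upwards [h0, hg0] with x hx hx'
    by_cases hxK : x ∈ K
    · simp [hxK, (hζx x hxK).self_of_nhds, gradient_eq_zero_of_eventually_const (hζx x hxK)]
    · by_cases hxΩ : x ∈ Ω
      · simp [hxK, hx hxΩ hxK, hx' hxΩ hxK]
      · have h1 : x ∉ tsupport ζ := fun h => hxΩ (hζ.2.2 h)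
        simp [hxK, image_eq_zero_of_notMem_tsupport h1, gradient_eq_zero_of_notMem_tsupport h1]

/-- Mollification commutes with the weak gradient on the whole space. -/
lemma W12.gradient_mol {v : E n → ℝ} {g : E n → E n} (hv : W12 Set.univ v g) {s : ℝ} (hs : 0 < s)
    (x : E n) : gradient (mol s v) x = mol s g x := by
  have hv1 : LocallyIntegrable v := by
    have := hv.1.locallyIntegrable (by norm_num); rwa [Measure.restrict_univ] at this
  have hd := (ker_hasCompactSupport hs).hasFDerivAt_convolution_left
    (ContinuousLinearMap.lsmul ℝ ℝ) ((ker_contDiff n s).of_le (by simp)) hv1 x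
  rw [← mol_eq_convolution] at hd
  have hψ : IsTestFunction Set.univ (fun y : E n => ker s (x - y)) :=
    ⟨(ker_contDiff n s).comp (contDiff_const.sub contDiff_id),
      (ker_hasCompactSupport hs).comp_homeomorph (Homeomorph.subLeft x), Set.subset_univ _⟩
  have hw := hv.2.2 _ hψ
  simp only [Measure.restrict_univ] at hw
  have hgr : ∀ y, gradient (fun y : E n => ker s (x - y)) y = - gradient (ker s) (x - y) := by
    intro y
    rw [gradient_def, gradient_def, ← map_neg]
    congr 1
    have h1 : HasFDerivAt (fun y : E n => x - y) (-ContinuousLinearMap.id ℝ (E n)) y :=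
      (hasFDerivAt_id y).const_sub x
    have h2 := ((ker_contDiff n s).differentiable (by simp) (x - y)).hasFDerivAt.comp y h1
    rw [show (fun y : E n => ker s (x - y)) = ker s ∘ fun y => x - y from rfl, h2.fderiv]
    ext e; simp
  rw [gradient_def, hd.fderiv, convolution_eq_swap]
  rw [← neg_eq_iff_eq_neg] at hw
  rw [mol, ← hw, ← integral_neg]
  rw [← LinearIsometryEquiv.coe_toContinuousLinearEquiv (InnerProductSpace.toDual ℝ (E n)).symm]
  rw [← ContinuousLinearEquiv.integral_comp_comm]
  congr 1; ext1 y
  rw [hgr, smul_neg, neg_neg, gradient_def, ← map_smul]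
  refine congrArg (InnerProductSpace.toDual ℝ (E n)).symm (ContinuousLinearMap.ext fun e => ?_)
  simp [ContinuousLinearMap.precompL_apply, mul_comm]

/-! ### The chain rule -/

lemma gradient_comp {F : ℝ → ℝ} (hF : ContDiff ℝ 1 F) {w : E n → ℝ} {x : E n}
    (hw : DifferentiableAt ℝ w x) :
    gradient (fun y => F (w y)) x = deriv F (w x) • gradient w x := by
  have h := ((hF.differentiable (by simp) (w x)).hasDerivAt).comp_hasFDerivAt x hw.hasFDerivAt
  rw [gradient_def, show (fun y => F (w y)) = F ∘ w from rfl, h.fderiv, map_smul, gradient_def]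

lemma abs_sub_le_of_deriv_bound {F : ℝ → ℝ} (hF : ContDiff ℝ 1 F) {M : ℝ}
    (hM : ∀ t, |deriv F t| ≤ M) (a b : ℝ) : |F a - F b| ≤ M * |a - b| :=
  Convex.norm_image_sub_le_of_norm_deriv_le (s := Set.univ)
    (fun t _ => hF.differentiable (by simp) t) (fun t _ => hM t) convex_univ trivial trivial

lemma integrable_bdd_smul {F : Type*} [NormedAddCommGroup F] [NormedSpace ℝ F] {g : E n → F}
    {μ : Measure (E n)} (hg : Integrable g μ) {φ : E n → ℝ} {C : ℝ} (hφ : AEStronglyMeasurable φ μ)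
    (hC : ∀ x, |φ x| ≤ C) : Integrable (fun x => φ x • g x) μ :=
  (hg.norm.const_mul C).mono' (hφ.smul hg.1) (Eventually.of_forall fun x => by
    rw [norm_smul]; gcongr; exact hC x)

/-- The chain rule for integrable Sobolev functions on the whole space, by mollification. -/
lemma W12.chain_univ {v : E n → ℝ} {g : E n → E n} (hv : W12 Set.univ v g) (hvi : Integrable v)
    (hgi : Integrable g) {F : ℝ → ℝ} (hF : ContDiff ℝ 1 F) {M : ℝ} (hM : ∀ t, |deriv F t| ≤ M)
    {φ : E n → ℝ} (hφ : IsTestFunction Set.univ φ) :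
    ∫ x, F (v x) • gradient φ x = - ∫ x, φ x • (deriv F (v x) • g x) := by
  set s : ℕ → ℝ := fun k => 1 / ((k : ℝ) + 1) with hsdef
  have hs : ∀ k, 0 < s k := fun k => Nat.one_div_pos_of_nat
  have hs0 : Tendsto s atTop (𝓝 0) := tendsto_one_div_add_atTop_nhds_zero_nat
  have hsw : Tendsto s atTop (𝓝[>] 0) := tendsto_nhdsWithin_iff.2 ⟨hs0, Eventually.of_forall hs⟩
  have hM0 : 0 ≤ M := (abs_nonneg _).trans (hM 0)
  obtain ⟨C, hC⟩ := hφ.2.1.exists_bound_of_continuous hφ.1.continuous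
  obtain ⟨C', hC'⟩ := (HasCompactSupport.gradient hφ.2.1).exists_bound_of_continuous
    (ContDiff.continuous_gradient hφ.1)
  have hC0 : 0 ≤ C := (norm_nonneg _).trans (hC 0)
  have hC0' : 0 ≤ C' := (norm_nonneg _).trans (hC' 0)
  have hcd : Continuous (deriv F) := hF.continuous_deriv le_rfl
  have hmc : ∀ k, ContDiff ℝ ∞ (mol (s k) v) := fun k => mol_contDiff (hs k) hvi.locallyIntegrable
  have hid : ∀ k, ∫ x, F (mol (s k) v x) • gradient φ x =
      - ∫ x, φ x • (deriv F (mol (s k) v x) • mol (s k) g x) := fun k => by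
    refine (integral_smul_gradient_eq_neg (hF.comp ((hmc k).of_le (by simp))) hφ).trans ?_
    congr 2; ext1 x
    have := gradient_comp hF ((hmc k).differentiable (by simp) x)
    rw [hv.gradient_mol (hs k)] at this
    rw [← this]; rfl
  have hL1 : Tendsto (fun k => ∫ x, F (mol (s k) v x) • gradient φ x) atTop
      (𝓝 (∫ x, F (v x) • gradient φ x)) := by
    have hcφ := ContDiff.continuous_gradient hφ.1
    have ia : ∀ k, Integrable (fun x => F (mol (s k) v x) • gradient φ x) := fun k =>
      ((hF.continuous.comp (hmc k).continuous).smul hcφ).integrable_of_hasCompactSupport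
        (HasCompactSupport.gradient hφ.2.1).smul_left
    have idf : ∀ k, Integrable (fun x => (F (mol (s k) v x) - F (v x)) • gradient φ x) := fun k => by
      refine (((mol_integrable (hs k) hvi).sub hvi).norm.const_mul (M * C')).mono' ?_ ?_
      · exact (((hF.continuous.comp (hmc k).continuous).aestronglyMeasurable).sub
          (hF.continuous.comp_aestronglyMeasurable hvi.1)).smul hcφ.aestronglyMeasurable
      · refine Eventually.of_forall fun x => ?_
        rw [norm_smul]
        calc _ ≤ (M * |mol (s k) v x - v x|) * C' :=
              mul_le_mul (abs_sub_le_of_deriv_bound hF hM _ _) (hC' x) (norm_nonneg _)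
                (by positivity)
          _ = _ := by rw [← Real.norm_eq_abs]; simp only [Pi.sub_apply]; ring
    have ib : Integrable (fun x => F (v x) • gradient φ x) := by
      refine ((ia 0).sub (idf 0)).congr (Eventually.of_forall fun x => ?_)
      simp [sub_smul]
    rw [tendsto_iff_norm_sub_tendsto_zero]
    have hb := (tendsto_integral_norm_mol_sub hvi hs hs0).const_mul (M * C')
    rw [mul_zero] at hb
    refine squeeze_zero (fun _ => norm_nonneg _) (fun k => ?_) hb
    rw [← integral_sub (ia k) ib, ← integral_const_mul]
    refine norm_integral_le_of_norm_le
      (((mol_integrable (hs k) hvi).sub hvi).norm.const_mul (M * C')) (Eventually.of_forall fun x => ?_)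
    rw [← sub_smul, norm_smul]
    calc _ ≤ (M * |mol (s k) v x - v x|) * C' :=
          mul_le_mul (abs_sub_le_of_deriv_bound hF hM _ _) (hC' x) (norm_nonneg _)
            (by positivity)
      _ = _ := by rw [← Real.norm_eq_abs]; ring
  have hL2 : Tendsto (fun k => ∫ x, φ x • (deriv F (mol (s k) v x) • mol (s k) g x)) atTop
      (𝓝 (∫ x, φ x • (deriv F (v x) • g x))) := by
    have mφ := hφ.1.continuous.aestronglyMeasurable (μ := (volume : Measure (E n)))
    have md : ∀ k, AEStronglyMeasurable (fun x => deriv F (mol (s k) v x)) volume := fun k =>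
      (hcd.comp (hmc k).continuous).aestronglyMeasurable
    have T1 : Tendsto (fun k => ∫ x, φ x • (deriv F (mol (s k) v x) • (mol (s k) g x - g x))) atTop
        (𝓝 0) := by
      rw [tendsto_zero_iff_norm_tendsto_zero]
      have hb := (tendsto_integral_norm_mol_sub hgi hs hs0).const_mul (C * M)
      rw [mul_zero] at hb
      refine squeeze_zero (fun _ => norm_nonneg _) (fun k => ?_) hb
      rw [← integral_const_mul]
      refine norm_integral_le_of_norm_le
        (((mol_integrable (hs k) hgi).sub hgi).norm.const_mul (C * M)) (Eventually.of_forall fun x => ?_)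
      rw [norm_smul, norm_smul, mul_assoc]
      exact mul_le_mul (hC x) (mul_le_mul_of_nonneg_right (hM _) (norm_nonneg _))
        (by positivity) hC0
    have T2 : Tendsto (fun k => ∫ x, φ x • (deriv F (mol (s k) v x) • g x)) atTop
        (𝓝 (∫ x, φ x • (deriv F (v x) • g x))) := by
      refine tendsto_integral_of_dominated_convergence (fun x => C * (M * ‖g x‖))
        (fun k => mφ.smul ((md k).smul hgi.1)) ((hgi.norm.const_mul M).const_mul C)
        (fun k => Eventually.of_forall fun x => ?_) ?_
      · rw [norm_smul, norm_smul]
        exact mul_le_mul (hC x) (mul_le_mul_of_nonneg_right (hM _) (norm_nonneg _))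
          (by positivity) hC0
      · filter_upwards [ae_tendsto_mol hvi.locallyIntegrable] with x hx
        exact (((hcd.tendsto _).comp (hx.comp hsw)).smul_const _).const_smul _
    have := T1.add T2
    rw [zero_add] at this
    refine this.congr fun k => ?_
    rw [← integral_add]
    · congr 1; ext1 x; rw [← smul_add, ← smul_add, sub_add_cancel]
    · exact integrable_bdd_smul (integrable_bdd_smul ((mol_integrable (hs k) hgi).sub hgi) (md k)
        (fun x => hM _)) mφ hC
    · exact integrable_bdd_smul (integrable_bdd_smul hgi (md k) (fun x => hM _)) mφ hC
  exact tendsto_nhds_unique hL1 ((hL2.neg).congr fun k => (hid k).symm)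

/-- The chain rule for Sobolev functions. -/
lemma W12.comp {v : E n → ℝ} {g : E n → E n} (hv : W12 Ω v g) (hΩ : IsOpen Ω) {F : ℝ → ℝ}
    (hF : ContDiff ℝ 1 F) (hF0 : F 0 = 0) {M : ℝ} (hM : ∀ t, |deriv F t| ≤ M) :
    W12 Ω (fun x => F (v x)) (fun x => deriv F (v x) • g x) := by
  have hcd : Continuous (deriv F) := hF.continuous_deriv le_rfl
  refine ⟨?_, ?_, fun φ hφ => ?_⟩
  · refine hv.1.of_le_mul (c := M) (hF.continuous.comp_aestronglyMeasurable hv.1.1)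
      (Eventually.of_forall fun x => ?_)
    simpa [hF0] using abs_sub_le_of_deriv_bound hF hM (v x) 0
  · refine hv.memLp_grad.of_le_mul (c := M)
      ((hcd.comp_aestronglyMeasurable hv.1.1).smul hv.memLp_grad.1) (Eventually.of_forall fun x => ?_)
    rw [norm_smul]; gcongr; exact hM _
  · obtain ⟨ζ, hζ, -, hζ1⟩ := exists_cutoff hφ.2.1 hΩ hφ.2.2
    have hζx : ∀ x ∈ tsupport φ, ∀ᶠ y in 𝓝 x, ζ y = 1 :=
      fun x hx => eventually_nhdsSet_iff_forall.1 hζ1 x hx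
    have hm := hv.mul_test hΩ.measurableSet hζ
    have hsupp : ∀ x ∉ tsupport ζ, ζ x * v x = 0 := fun x hx => by
      rw [image_eq_zero_of_notMem_tsupport hx, zero_mul]
    have hsupp' : ∀ x ∉ tsupport ζ, ζ x • g x + v x • gradient ζ x = 0 := fun x hx => by
      rw [image_eq_zero_of_notMem_tsupport hx, zero_smul, gradient_eq_zero_of_notMem_tsupport hx,
        smul_zero, add_zero]
    have hfin : volume (tsupport ζ) ≠ ⊤ := hζ.2.1.isCompact.measure_lt_top.ne
    have hi1 : Integrable (fun x => ζ x * v x) := by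
      have h1 := hm.1; rw [Measure.restrict_univ] at h1
      exact memLp_one_iff_integrable.1
        (h1.mono_exponent_of_measure_support_ne_top hsupp hfin (by norm_num))
    have hi2 : Integrable (fun x => ζ x • g x + v x • gradient ζ x) := by
      have h1 := hm.memLp_grad; rw [Measure.restrict_univ] at h1
      exact memLp_one_iff_integrable.1
        (h1.mono_exponent_of_measure_support_ne_top hsupp' hfin (by norm_num))
    have key := hm.chain_univ hi1 hi2 hF hM (hφ.mono (Set.subset_univ _))
    have o1 : ∀ x, F (ζ x * v x) • gradient φ x = F (v x) • gradient φ x := fun x => by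
      by_cases hx : x ∈ tsupport φ
      · rw [(hζx x hx).self_of_nhds, one_mul]
      · rw [gradient_eq_zero_of_notMem_tsupport hx, smul_zero, smul_zero]
    have o2 : ∀ x, φ x • (deriv F (ζ x * v x) • (ζ x • g x + v x • gradient ζ x)) =
        φ x • deriv F (v x) • g x := fun x => by
      by_cases hx : x ∈ tsupport φ
      · rw [(hζx x hx).self_of_nhds, one_mul, gradient_eq_zero_of_eventually_const (hζx x hx),
          smul_zero, add_zero, one_smul]
      · rw [image_eq_zero_of_notMem_tsupport hx, zero_smul, zero_smul]
    simp_rw [o1, o2] at key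
    rw [setIntegral_eq_integral_of_forall_compl_eq_zero fun x hx => by
        rw [gradient_eq_zero_of_notMem_tsupport (fun h => hx (hφ.2.2 h)), smul_zero], key,
      setIntegral_eq_integral_of_forall_compl_eq_zero fun x hx => by
        rw [image_eq_zero_of_notMem_tsupport (fun h => hx (hφ.2.2 h)), zero_smul]]

/-- Sobolev functions are closed under dominated almost everywhere convergence of functions and
gradients. -/
lemma W12.of_tendsto {v : ℕ → E n → ℝ} {g : ℕ → E n → E n} {w : E n → ℝ} {k : E n → E n}
    {a b : E n → ℝ} (hv : ∀ j, W12 Ω (v j) (g j)) (ha : MemLp a 2 (volume.restrict Ω))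
    (hb : MemLp b 2 (volume.restrict Ω))
    (hva : ∀ j, ∀ᵐ x ∂(volume.restrict Ω), |v j x| ≤ a x)
    (hgb : ∀ j, ∀ᵐ x ∂(volume.restrict Ω), ‖g j x‖ ≤ b x)
    (hw : ∀ᵐ x ∂(volume.restrict Ω), Tendsto (fun j => v j x) atTop (𝓝 (w x)))
    (hk : ∀ᵐ x ∂(volume.restrict Ω), Tendsto (fun j => g j x) atTop (𝓝 (k x))) : W12 Ω w k := by
  have mw := aestronglyMeasurable_of_tendsto_ae atTop (fun j => (hv j).1.1) hw
  have mk := aestronglyMeasurable_of_tendsto_ae atTop (fun j => (hv j).memLp_grad.1) hk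
  have hw' : MemLp w 2 (volume.restrict Ω) := by
    refine ha.of_le mw ?_
    filter_upwards [hw, ae_all_iff.2 hva] with x h1 h2
    exact (le_of_tendsto h1.abs (Eventually.of_forall h2)).trans (le_abs_self _)
  have hk' : MemLp k 2 (volume.restrict Ω) := by
    refine hb.of_le mk ?_
    filter_upwards [hk, ae_all_iff.2 hgb] with x h1 h2
    exact (le_of_tendsto h1.norm (Eventually.of_forall h2)).trans (le_abs_self _)
  refine ⟨hw', hk', fun φ hφ => ?_⟩
  have T1 : Tendsto (fun j => ∫ x in Ω, v j x • gradient φ x) atTop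
      (𝓝 (∫ x in Ω, w x • gradient φ x)) := by
    refine tendsto_integral_of_dominated_convergence (fun x => a x * ‖gradient φ x‖)
      (fun j => ((hv j).integrable_smul_gradient hφ).1) ?_ (fun j => ?_) ?_
    · exact MemLp.integrable_mul ha hφ.memLp_gradient.norm
    · filter_upwards [hva j] with x hx
      rw [norm_smul]; gcongr; exact hx
    · filter_upwards [hw] with x hx using hx.smul_const _
  have T2 : Tendsto (fun j => ∫ x in Ω, φ x • g j x) atTop (𝓝 (∫ x in Ω, φ x • k x)) := by
    refine tendsto_integral_of_dominated_convergence (fun x => ‖φ x‖ * b x)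
      (fun j => ((hv j).integrable_smul_grad hφ).1) ?_ (fun j => ?_) ?_
    · exact MemLp.integrable_mul (hφ.memLp).norm hb
    · filter_upwards [hgb j] with x hx
      rw [norm_smul]; gcongr
    · filter_upwards [hk] with x hx using hx.const_smul _
  exact tendsto_nhds_unique T1 (T2.neg.congr fun j => ((hv j).2.2 φ hφ).symm)

/-! ### Truncations, maxima and minima -/

/-- The weak gradient vanishes almost everywhere on the zero set: apply the chain rule to
`δ arctan (v / δ)` and let `δ → 0`. -/
lemma W12.grad_eq_zero_of_eq_zero {v : E n → ℝ} {g : E n → E n} (hv : W12 Ω v g) (hΩ : IsOpen Ω) :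
    ∀ᵐ x ∂(volume.restrict Ω), v x = 0 → g x = 0 := by
  set δ : ℕ → ℝ := fun k => 1 / ((k : ℝ) + 1) with hδ
  have hδp : ∀ k, 0 < δ k := fun k => Nat.one_div_pos_of_nat
  have hδ0 : Tendsto δ atTop (𝓝 0) := tendsto_one_div_add_atTop_nhds_zero_nat
  have hder : ∀ k t, HasDerivAt (fun t => δ k * Real.arctan (t / δ k)) (1 / (1 + (t / δ k) ^ 2)) t := by
    intro k t
    have := ((Real.hasDerivAt_arctan (t / δ k)).comp t ((hasDerivAt_id t).div_const (δ k))).const_mul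
      (δ k)
    refine this.congr_deriv ?_
    have h1 := (hδp k).ne'
    field_simp
  have hcd : ∀ k, ContDiff ℝ 1 (fun t => δ k * Real.arctan (t / δ k)) := fun k =>
    contDiff_const.mul (Real.contDiff_arctan.comp (contDiff_id.div_const _))
  have hM : ∀ k t, |deriv (fun t => δ k * Real.arctan (t / δ k)) t| ≤ 1 := fun k t => by
    rw [(hder k t).deriv, abs_of_nonneg (by positivity), div_le_one (by positivity)]
    nlinarith [sq_nonneg (t / δ k)]
  have hW := fun k => hv.comp hΩ (hcd k) (by simp) (hM k)
  have key : W12 Ω (fun _ => 0) (fun x => ({x | v x = 0} : Set (E n)).indicator g x) := by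
    refine W12.of_tendsto hW hv.1.norm hv.memLp_grad.norm (fun j => ae_of_all _ fun x => ?_)
      (fun j => ae_of_all _ fun x => ?_) (ae_of_all _ fun x => ?_) (ae_of_all _ fun x => ?_)
    · simpa using abs_sub_le_of_deriv_bound (hcd j) (hM j) (v x) 0
    · rw [norm_smul]
      exact mul_le_of_le_one_left (norm_nonneg _) (hM j _)
    · refine squeeze_zero_norm (fun j => ?_) (by simpa using hδ0.mul_const (Real.pi / 2))
      rw [norm_mul, Real.norm_eq_abs, Real.norm_eq_abs, abs_of_pos (hδp j)]
      have := hδp j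
      gcongr
      exact abs_le.2 ⟨(Real.neg_pi_div_two_lt_arctan _).le, (Real.arctan_lt_pi_div_two _).le⟩
    · simp_rw [fun j => (hder j (v x)).deriv]
      by_cases hx : v x = 0
      · simp [hx]
      · rw [Set.indicator_of_notMem (by simpa using hx), ← zero_smul ℝ (g x)]
        refine Tendsto.smul_const ?_ _
        refine tendsto_const_nhds.div_atTop (tendsto_atTop_add_const_left _ _ ?_)
        have h2 : Tendsto (fun j : ℕ => (v x) ^ 2 * ((j : ℝ) + 1) ^ 2) atTop atTop := by
          refine Tendsto.const_mul_atTop (by positivity) ?_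
          exact (tendsto_pow_atTop two_ne_zero).comp
            (tendsto_atTop_add_const_right _ _ tendsto_natCast_atTop_atTop)
        refine h2.congr fun j => ?_
        simp only [hδ]; field_simp
  have := key.unique hΩ W12.zero
  filter_upwards [this] with x hx h0
  rwa [Set.indicator_of_mem (by simpa using h0)] at hx

/-- The weak gradient of the positive part. -/
lemma W12.posPart {v : E n → ℝ} {g : E n → E n} (hv : W12 Ω v g) (hΩ : IsOpen Ω) :
    W12 Ω (fun x => max (v x) 0) ({x | 0 < v x}.indicator g) := by
  set δ : ℕ → ℝ := fun k => 1 / ((k : ℝ) + 1) with hδ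
  have hδp : ∀ k, 0 < δ k := fun k => Nat.one_div_pos_of_nat
  have hδ0 : Tendsto δ atTop (𝓝 0) := tendsto_one_div_add_atTop_nhds_zero_nat
  set F : ℕ → ℝ → ℝ := fun k t => (Real.sqrt (t ^ 2 + δ k ^ 2) - δ k + t) / 2 with hF
  have hpos : ∀ k t, 0 < t ^ 2 + δ k ^ 2 := fun k t => by have := hδp k; positivity
  have hder : ∀ k t, HasDerivAt (F k) ((t / Real.sqrt (t ^ 2 + δ k ^ 2) + 1) / 2) t := by
    intro k t
    have h1 : HasDerivAt (fun t : ℝ => t ^ 2 + δ k ^ 2) (2 * t) t := by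
      simpa using (hasDerivAt_pow 2 t).add_const (δ k ^ 2)
    have h2 := (((h1.sqrt (hpos k t).ne').sub_const (δ k)).add (hasDerivAt_id t)).div_const 2
    refine h2.congr_deriv ?_
    rw [mul_div_mul_left _ _ two_ne_zero]
  have hcd : ∀ k, ContDiff ℝ 1 (F k) := fun k =>
    ((((contDiff_id.pow 2).add contDiff_const).sqrt (fun t => (hpos k t).ne')).sub
      contDiff_const |>.add contDiff_id).div_const 2
  have hM : ∀ k t, |deriv (F k) t| ≤ 1 := fun k t => by
    rw [(hder k t).deriv]
    have h1 : |t / Real.sqrt (t ^ 2 + δ k ^ 2)| ≤ 1 := by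
      rw [abs_div, abs_of_nonneg (Real.sqrt_nonneg _), div_le_one (Real.sqrt_pos.2 (hpos k t))]
      exact Real.abs_le_sqrt (by nlinarith [sq_nonneg (δ k)])
    rw [abs_le] at h1 ⊢
    constructor <;> linarith [h1.1, h1.2]
  have hF0 : ∀ k, F k 0 = 0 := fun k => by
    simp [hF, Real.sqrt_sq (hδp k).le]
  have hW := fun k => hv.comp hΩ (hcd k) (hF0 k) (hM k)
  have h0 := hv.grad_eq_zero_of_eq_zero hΩ
  have sq : ∀ t : ℝ, Tendsto (fun j => Real.sqrt (t ^ 2 + δ j ^ 2)) atTop (𝓝 |t|) := fun t => by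
    have := ((hδ0.pow 2).const_add (t ^ 2)).sqrt
    simpa [Real.sqrt_sq_eq_abs] using this
  refine W12.of_tendsto hW hv.1.norm hv.memLp_grad.norm (fun j => ae_of_all _ fun x => ?_)
      (fun j => ae_of_all _ fun x => ?_) (ae_of_all _ fun x => ?_) ?_
  · simpa [hF0] using abs_sub_le_of_deriv_bound (hcd j) (hM j) (v x) 0
  · rw [norm_smul]
    exact mul_le_of_le_one_left (norm_nonneg _) (hM j _)
  · have := (((sq (v x)).sub hδ0).add_const (v x)).div_const 2
    convert this using 2
    rcases le_total 0 (v x) with h | h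
    · rw [max_eq_left h, abs_of_nonneg h]; ring
    · rw [max_eq_right h, abs_of_nonpos h]; ring
  · filter_upwards [h0] with x hx
    simp_rw [fun j => (hder j (v x)).deriv]
    by_cases hv0 : v x = 0
    · simp [hx hv0, Set.indicator]
    have hlim : Tendsto (fun j => ((v x / Real.sqrt (v x ^ 2 + δ j ^ 2) + 1) / 2) • g x) atTop
        (𝓝 (((v x / |v x| + 1) / 2) • g x)) :=
      (((tendsto_const_nhds.div (sq (v x)) (abs_ne_zero.2 hv0)).add_const 1).div_const 2).smul_const _
    have he : ({x | 0 < v x} : Set (E n)).indicator g x = ((v x / |v x| + 1) / 2) • g x := by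
      rcases lt_or_gt_of_ne hv0 with h | h
      · rw [Set.indicator_of_notMem (by simp [h.le]), abs_of_neg h, div_neg, div_self hv0]; simp
      · rw [Set.indicator_of_mem (by simpa using h), abs_of_pos h, div_self hv0]; norm_num
    rw [he]; exact hlim

/-- The weak gradient of a maximum. -/
lemma W12.max {v w : E n → ℝ} {g k : E n → E n} (hv : W12 Ω v g) (hw : W12 Ω w k)
    (hΩ : IsOpen Ω) :
    W12 Ω (fun x => max (v x) (w x)) (fun x => open Classical in if w x < v x then g x else k x) := by
  classical
  refine (((hv.sub hw).posPart hΩ).add hw).congr (ae_of_all _ fun x => ?_) (ae_of_all _ fun x => ?_)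
  · simp only []
    rcases le_total (v x) (w x) with h | h
    · rw [max_eq_right h, max_eq_right (by linarith)]; ring
    · rw [max_eq_left h, max_eq_left (by linarith)]; ring
  · by_cases h : w x < v x
    · simp [Set.indicator, h]
    · simp [Set.indicator, h]

/-- The weak gradient of a minimum. -/
lemma W12.min {v w : E n → ℝ} {g k : E n → E n} (hv : W12 Ω v g) (hw : W12 Ω w k)
    (hΩ : IsOpen Ω) :
    W12 Ω (fun x => min (v x) (w x)) (fun x => open Classical in if w x < v x then k x else g x) := by
  classical
  refine ((hv.add hw).sub (hv.max hw hΩ)).congr (ae_of_all _ fun x => ?_) (ae_of_all _ fun x => ?_)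
  · simp only []
    linarith [min_add_max (v x) (w x)]
  · by_cases h : w x < v x
    · simp [h]
    · simp [h]

/-- On the set where two Sobolev functions agree, so do their weak gradients. -/
lemma W12.grad_eq_of_eq {v w : E n → ℝ} {g k : E n → E n} (hv : W12 Ω v g) (hw : W12 Ω w k)
    (hΩ : IsOpen Ω) : ∀ᵐ x ∂(volume.restrict Ω), v x = w x → g x = k x := by
  filter_upwards [(hv.sub hw).grad_eq_zero_of_eq_zero hΩ] with x hx h
  exact sub_eq_zero.1 (hx (sub_eq_zero.2 h))

/-! ### Lipschitz functions -/

lemma measurable_gradient (f : E n → ℝ) : Measurable (gradient f) :=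
  (LinearIsometryEquiv.continuous _).measurable.comp (measurable_fderiv ℝ f)

lemma norm_gradient_le_of_lipschitzOn {C : NNReal} {f : E n → ℝ} (hf : LipschitzOnWith C f Ω)
    (hΩ : IsOpen Ω) {x : E n} (hx : x ∈ Ω) : ‖gradient f x‖ ≤ C := by
  rw [norm_gradient]
  exact norm_fderiv_le_of_lipschitzOn ℝ (hΩ.mem_nhds hx) hf

/-- Lipschitz functions on bounded open sets are Sobolev functions, and their weak gradient is the
almost everywhere defined classical one. -/
lemma W12.of_lipschitzOn {C : NNReal} {f : E n → ℝ} (hf : LipschitzOnWith C f Ω) (hΩ : IsOpen Ω)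
    (hb : Bornology.IsBounded Ω) : W12 Ω f (gradient f) := by
  obtain ⟨F, hF, hFf⟩ := hf.extend_real
  have hfin : volume Ω < ⊤ := hb.measure_lt_top
  have : IsFiniteMeasure (volume.restrict Ω) := ⟨by simpa using hfin⟩
  have hgr : ∀ x ∈ Ω, gradient F x = gradient f x := fun x hx =>
    Filter.EventuallyEq.gradient_eq (by
      filter_upwards [hΩ.mem_nhds hx] with y hy using (hFf hy).symm)
  have hW : W12 Ω F (gradient F) := by
    refine ⟨?_, ?_, fun φ hφ => ?_⟩
    · obtain ⟨B, hB⟩ := hb.isCompact_closure.exists_bound_of_continuousOn hF.continuous.continuousOn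
      refine MemLp.of_bound hF.continuous.aestronglyMeasurable B ?_
      filter_upwards [ae_restrict_mem hΩ.measurableSet] with x hx using hB x (subset_closure hx)
    · refine MemLp.of_bound (measurable_gradient F).aestronglyMeasurable C (ae_of_all _ fun x => ?_)
      rw [norm_gradient]
      exact norm_fderiv_le_of_lipschitz ℝ hF
    · obtain ⟨D, hD⟩ := hφ.1.lipschitzWith_of_hasCompactSupport hφ.2.1 (by simp)
      rw [setIntegral_eq_integral_of_forall_compl_eq_zero fun x hx => by
          rw [gradient_eq_zero_of_notMem_tsupport (fun h => hx (hφ.2.2 h)), smul_zero],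
        setIntegral_eq_integral_of_forall_compl_eq_zero fun x hx => by
          rw [image_eq_zero_of_notMem_tsupport (fun h => hx (hφ.2.2 h)), zero_smul]]
      have i1 : Integrable (fun x => F x • gradient φ x) :=
        (hF.continuous.smul (ContDiff.continuous_gradient hφ.1)).integrable_of_hasCompactSupport
          (HasCompactSupport.gradient hφ.2.1).smul_left
      have i2 : Integrable (fun x => φ x • gradient F x) := by
        have hi := hφ.1.continuous.integrable_of_hasCompactSupport hφ.2.1 (μ := volume)
        refine (hi.norm.mul_const (C : ℝ)).mono'
          (hi.1.smul (measurable_gradient F).aestronglyMeasurable) (ae_of_all _ fun x => ?_)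
        rw [norm_smul, norm_gradient]
        gcongr
        exact norm_fderiv_le_of_lipschitz ℝ hF
      refine ext_inner_left ℝ fun e => ?_
      rw [inner_neg_right, ← integral_inner i1, ← integral_inner i2]
      have key := LipschitzWith.integral_lineDeriv_mul_eq (μ := volume) hF hD hφ.2.1 e
      have j1 : ∫ x, lineDeriv ℝ F x e * φ x = ∫ x, inner ℝ e (φ x • gradient F x) := by
        refine integral_congr_ae ?_
        filter_upwards [hF.ae_differentiableAt (μ := volume)] with x hx
        rw [hx.lineDeriv_eq_fderiv, inner_smul_right, fderiv_eq_inner_gradient, real_inner_comm,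
          mul_comm]
      have j2 : ∫ x, lineDeriv ℝ φ x (-e) * F x = - ∫ x, inner ℝ e (F x • gradient φ x) := by
        rw [← integral_neg]
        congr 1; ext1 x
        rw [(hφ.1.differentiable (by simp) x).lineDeriv_eq_fderiv, inner_smul_right, map_neg,
          fderiv_eq_inner_gradient, real_inner_comm]
        ring
      rw [← j1, key, j2, neg_neg]
  refine hW.congr ?_ ?_
  · filter_upwards [ae_restrict_mem hΩ.measurableSet] with x hx using (hFf hx).symm
  · filter_upwards [ae_restrict_mem hΩ.measurableSet] with x hx using hgr x hx

/-! ### The energy -/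

/-- The energy density `|g|² + χ_{|v| < 1}`. -/
noncomputable def dens (v : E n → ℝ) (g : E n → E n) (x : E n) : ℝ :=
  ‖g x‖ ^ 2 + (interphase v).indicator (fun _ => (1 : ℝ)) x

lemma indicator_interphase_nonneg (v : E n → ℝ) (x : E n) :
    0 ≤ (interphase v).indicator (fun _ => (1 : ℝ)) x :=
  Set.indicator_nonneg (fun _ _ => zero_le_one) x

lemma indicator_interphase_le_one (v : E n → ℝ) (x : E n) :
    (interphase v).indicator (fun _ => (1 : ℝ)) x ≤ 1 :=
  Set.indicator_le_self' (fun _ _ => zero_le_one) x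

lemma dens_nonneg (v : E n → ℝ) (g : E n → E n) (x : E n) : 0 ≤ dens v g x :=
  add_nonneg (sq_nonneg _) (indicator_interphase_nonneg v x)

lemma indicator_interphase_eq (v : E n → ℝ) (x : E n) :
    (interphase v).indicator (fun _ => (1 : ℝ)) x =
      ({t : ℝ | |t| < 1}.indicator (fun _ => (1 : ℝ))) (v x) := by
  by_cases h : |v x| < 1 <;> simp [Set.indicator, interphase, h]

lemma indicator_interphase_congr {v w : E n → ℝ} {x : E n} (h : v x = w x) :
    (interphase v).indicator (fun _ => (1 : ℝ)) x = (interphase w).indicator (fun _ => (1 : ℝ)) x := by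
  rw [indicator_interphase_eq, indicator_interphase_eq, h]

lemma aestronglyMeasurable_indicator_interphase {v : E n → ℝ} {μ : Measure (E n)}
    (hv : AEStronglyMeasurable v μ) :
    AEStronglyMeasurable ((interphase v).indicator (fun _ => (1 : ℝ))) μ := by
  have hm : Measurable ({t : ℝ | |t| < 1}.indicator (fun _ => (1 : ℝ))) :=
    measurable_const.indicator (isOpen_lt continuous_abs continuous_const).measurableSet
  have h2 := hm.comp_aemeasurable hv.aemeasurable
  rw [show (interphase v).indicator (fun _ => (1 : ℝ)) =
    ({t : ℝ | |t| < 1}.indicator (fun _ => (1 : ℝ))) ∘ v from funext (indicator_interphase_eq v)]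
  exact h2.aestronglyMeasurable

lemma integrable_indicator_interphase {v : E n → ℝ} {μ : Measure (E n)} [IsFiniteMeasure μ]
    (hv : AEStronglyMeasurable v μ) :
    Integrable ((interphase v).indicator (fun _ => (1 : ℝ))) μ :=
  Integrable.of_bound (aestronglyMeasurable_indicator_interphase hv) 1 (ae_of_all _ fun x => by
    rw [Real.norm_eq_abs, abs_of_nonneg (indicator_interphase_nonneg v x)]
    exact indicator_interphase_le_one v x)

lemma MemLp.integrable_norm_sq' {μ : Measure (E n)} {g : E n → E n} (hg : MemLp g 2 μ) :
    Integrable (fun x => ‖g x‖ ^ 2) μ := by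
  have := hg.integrable_norm_pow (p := 2) (by norm_num)
  simpa using this

lemma integrable_dens {v : E n → ℝ} {g : E n → E n} {μ : Measure (E n)} [IsFiniteMeasure μ]
    (hv : AEStronglyMeasurable v μ) (hg : MemLp g 2 μ) : Integrable (dens v g) μ :=
  (MemLp.integrable_norm_sq' hg).add (integrable_indicator_interphase hv)

lemma dens_congr {v w : E n → ℝ} {g k : E n → E n} {x : E n} (h : v x = w x) (h' : g x = k x) :
    dens v g x = dens w k x := by
  rw [dens, dens, indicator_interphase_congr h, h']

lemma dens_congr_ae {v w : E n → ℝ} {g k : E n → E n} {μ : Measure (E n)} (h : v =ᵐ[μ] w)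
    (h' : g =ᵐ[μ] k) : dens v g =ᵐ[μ] dens w k := by
  filter_upwards [h, h'] with x h1 h2 using dens_congr h1 h2

lemma W12.energy_eq {v : E n → ℝ} {g : E n → E n} (hv : W12 Ω v g) (hΩ : IsOpen Ω) :
    energy Ω v = ∫ x in Ω, dens v g x := by
  refine integral_congr_ae ?_
  filter_upwards [hv.weakGradient_ae hΩ] with x hx
  rw [hx]; rfl

lemma energy_congr {v w : E n → ℝ} (hΩ : IsOpen Ω) (hv : MemH1 Ω v)
    (h : v =ᵐ[volume.restrict Ω] w) : energy Ω v = energy Ω w := by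
  rw [hv.w12.energy_eq hΩ, (hv.w12.congr h (EventuallyEq.refl _ _)).energy_eq hΩ]
  exact integral_congr_ae (dens_congr_ae h (EventuallyEq.refl _ _))

/-- The energy densities of the maximum and the minimum add up to those of the two functions. -/
lemma energy_max_add_energy_min (hΩ : IsOpen Ω) (hfin : volume Ω < ⊤) {v w : E n → ℝ}
    (hv : MemH1 Ω v) (hw : MemH1 Ω w) :
    energy Ω (fun x => max (v x) (w x)) + energy Ω (fun x => min (v x) (w x)) =
      energy Ω v + energy Ω w := by
  classical
  have : IsFiniteMeasure (volume.restrict Ω) := ⟨by simpa using hfin⟩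
  have h1 := hv.w12.max hw.w12 hΩ
  have h2 := hv.w12.min hw.w12 hΩ
  rw [h1.energy_eq hΩ, h2.energy_eq hΩ, hv.w12.energy_eq hΩ, hw.w12.energy_eq hΩ,
    ← integral_add (integrable_dens h1.1.1 h1.memLp_grad) (integrable_dens h2.1.1 h2.memLp_grad),
    ← integral_add (integrable_dens hv.1.1 hv.w12.memLp_grad)
      (integrable_dens hw.1.1 hw.w12.memLp_grad)]
  congr 1; ext1 x
  by_cases h : w x < v x
  · exact congrArg₂ _ (dens_congr (max_eq_left h.le) (if_pos h))
      (dens_congr (min_eq_right h.le) (if_pos h))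
  · rw [add_comm]
    exact congrArg₂ _ (dens_congr (min_eq_left (not_lt.1 h)) (if_neg h))
      (dens_congr (max_eq_right (not_lt.1 h)) (if_neg h))

/-- Bounded sequences in a Hilbert space converge weakly along ultrafilters. -/
lemma exists_weak_limit {H : Type*} [NormedAddCommGroup H] [InnerProductSpace ℝ H]
    [CompleteSpace H] (U : Ultrafilter ℕ) {x : ℕ → H} {A : ℝ} (hx : ∀ j, ‖x j‖ ≤ A) :
    ∃ y : H, ∀ z : H, Tendsto (fun j => inner ℝ z (x j)) U (𝓝 (inner ℝ z y)) := by
  have hc := WeakDual.isCompact_closedBall (𝕜 := ℝ) (0 : StrongDual ℝ H) A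
  set w : ℕ → WeakDual ℝ H := fun j =>
    StrongDual.toWeakDual (InnerProductSpace.toDual ℝ H (x j)) with hw
  obtain ⟨l, -, hl⟩ := hc.ultrafilter_le_nhds' (U.map w) (by
    refine Ultrafilter.mem_map.2 (Filter.univ_mem' fun j => ?_)
    simp only [Set.mem_preimage, mem_closedBall_zero_iff, hw]
    exact (LinearIsometryEquiv.norm_map (InnerProductSpace.toDual ℝ H) (x j)).le.trans (hx j))
  refine ⟨(InnerProductSpace.toDual ℝ H).symm (WeakDual.toStrongDual l), fun z => ?_⟩
  have h1 : Tendsto w U (𝓝 l) := hl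
  have h2 := ((WeakDual.eval_continuous z).tendsto l).comp h1
  rw [real_inner_comm, InnerProductSpace.toDual_symm_apply]
  refine h2.congr fun j => ?_
  rw [real_inner_comm]; rfl

/-! ### Lower semicontinuity of the energy -/

/-- The set `{|t| < 1}` is open, so its indicator is lower semicontinuous and Fatou's lemma applies. -/
lemma integral_indicator_interphase_le_of_tendsto {μ : Measure (E n)} [IsFiniteMeasure μ]
    {v : ℕ → E n → ℝ} {w : E n → ℝ} (hv : ∀ j, AEStronglyMeasurable (v j) μ)
    (hw : ∀ᵐ x ∂μ, Tendsto (fun j => v j x) atTop (𝓝 (w x))) {F : Filter ℕ} [F.NeBot]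
    (hF : F ≤ atTop) {m : ℝ}
    (hm : Tendsto (fun j => ∫ x, (interphase (v j)).indicator (fun _ => (1 : ℝ)) x ∂μ) F (𝓝 m)) :
    ∫ x, (interphase w).indicator (fun _ => (1 : ℝ)) x ∂μ ≤ m := by
  have mw := aestronglyMeasurable_of_tendsto_ae atTop hv hw
  have hfatou := lintegral_liminf_le' (μ := μ) (u := atTop)
    (f := fun j x => ENNReal.ofReal ((interphase (v j)).indicator (fun _ => (1 : ℝ)) x))
    (fun j => (aestronglyMeasurable_indicator_interphase (hv j)).aemeasurable.ennreal_ofReal)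
  have h1 : ∫⁻ x, ENNReal.ofReal ((interphase w).indicator (fun _ => (1 : ℝ)) x) ∂μ ≤
      ∫⁻ x, liminf (fun j => ENNReal.ofReal ((interphase (v j)).indicator (fun _ => (1 : ℝ)) x))
        atTop ∂μ := by
    refine lintegral_mono_ae ?_
    filter_upwards [hw] with x hx
    by_cases h : |w x| < 1
    · refine le_liminf_of_le (by isBoundedDefault) ?_
      filter_upwards [hx.abs.eventually (gt_mem_nhds h)] with j hj
      rw [Set.indicator_of_mem (show x ∈ interphase w from h),
        Set.indicator_of_mem (show x ∈ interphase (v j) from hj)]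
    · rw [Set.indicator_of_notMem (show x ∉ interphase w from h)]; simp
  have h2 := h1.trans (hfatou.trans (liminf_le_liminf_of_le hF))
  simp_rw [fun j => (ofReal_integral_eq_lintegral_ofReal (integrable_indicator_interphase (hv j))
    (ae_of_all _ (indicator_interphase_nonneg (v j)))).symm,
    (ofReal_integral_eq_lintegral_ofReal (integrable_indicator_interphase mw)
    (ae_of_all _ (indicator_interphase_nonneg w))).symm] at h2
  rw [(ENNReal.tendsto_ofReal hm).liminf_eq] at h2
  exact (ENNReal.ofReal_le_ofReal_iff (ge_of_tendsto hm (Eventually.of_forall fun j =>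
    integral_nonneg (indicator_interphase_nonneg (v j))))).1 h2

/-- The energy is lower semicontinuous under bounded almost everywhere convergence: along an
ultrafilter the gradients converge weakly, and Fatou's lemma applies to the other term. -/
lemma W12.exists_of_tendsto_of_energy_le (hfin : volume Ω < ⊤)
    {v : ℕ → E n → ℝ} {g : ℕ → E n → E n} {w : E n → ℝ} (hv : ∀ j, W12 Ω (v j) (g j)) {B : ℝ}
    (hvB : ∀ j, ∀ᵐ x ∂(volume.restrict Ω), |v j x| ≤ B)
    (hw : ∀ᵐ x ∂(volume.restrict Ω), Tendsto (fun j => v j x) atTop (𝓝 (w x)))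
    {c : ℕ → ℝ} {c₀ : ℝ} (hc : ∀ j, ∫ x in Ω, dens (v j) (g j) x ≤ c j)
    (hc₀ : Tendsto c atTop (𝓝 c₀)) :
    ∃ k, W12 Ω w k ∧ ∫ x in Ω, dens w k x ≤ c₀ := by
  have : IsFiniteMeasure (volume.restrict Ω) := ⟨by simpa using hfin⟩
  set μ := volume.restrict Ω with hμ
  have mw := aestronglyMeasurable_of_tendsto_ae atTop (fun j => (hv j).1.1) hw
  set U := hyperfilter ℕ with hU
  have hUle : (U : Filter ℕ) ≤ atTop := Nat.hyperfilter_le_atTop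
  obtain ⟨A, hA⟩ := hc₀.bddAbove_range
  have hcA : ∀ j, c j ≤ A := fun j => hA ⟨j, rfl⟩
  set G : ℕ → Lp (E n) 2 μ := fun j => (hv j).memLp_grad.toLp (g j) with hG
  set D : ℕ → ℝ := fun j => ∫ x, ‖g j x‖ ^ 2 ∂μ with hD
  set N : ℕ → ℝ := fun j => ∫ x, (interphase (v j)).indicator (fun _ => (1 : ℝ)) x ∂μ with hN
  have hD0 : ∀ j, 0 ≤ D j := fun j => integral_nonneg fun x => sq_nonneg _
  have hN0 : ∀ j, 0 ≤ N j := fun j => integral_nonneg (indicator_interphase_nonneg _)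
  have hDN : ∀ j, D j + N j ≤ c j := fun j => by
    refine le_trans (le_of_eq ?_) (hc j)
    rw [← integral_add (MemLp.integrable_norm_sq' (hv j).memLp_grad)
      (integrable_indicator_interphase (hv j).1.1)]
    rfl
  have hGn : ∀ {f : E n → E n} (hf : MemLp f 2 μ), ‖hf.toLp f‖ ^ 2 = ∫ x, ‖f x‖ ^ 2 ∂μ := by
    intro f hf
    rw [← real_inner_self_eq_norm_sq, L2.inner_def]
    refine integral_congr_ae ?_
    filter_upwards [hf.coeFn_toLp] with x hx
    rw [hx, real_inner_self_eq_norm_sq]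
  have hlim : ∀ {f : ℕ → ℝ}, (∀ j, 0 ≤ f j) → (∀ j, f j ≤ A) → ∃ l, Tendsto f U (𝓝 l) := by
    intro f h0 h1
    obtain ⟨l, -, hl⟩ := (isCompact_Icc (a := (0 : ℝ)) (b := A)).ultrafilter_le_nhds' (U.map f)
      (Ultrafilter.mem_map.2 (Filter.univ_mem' fun j => ⟨h0 j, h1 j⟩))
    exact ⟨l, hl⟩
  obtain ⟨d, hd⟩ := hlim hD0 fun j => by linarith [hDN j, hcA j, hN0 j]
  obtain ⟨m, hm⟩ := hlim hN0 fun j => by linarith [hDN j, hcA j, hD0 j]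
  have hdm : d + m ≤ c₀ := le_of_tendsto_of_tendsto (hd.add hm) (hc₀.mono_left hUle)
    (Eventually.of_forall hDN)
  have hGb : ∀ j, ‖G j‖ ≤ Real.sqrt A := fun j => by
    refine Real.le_sqrt_of_sq_le ?_
    rw [hG]; simp only [hGn]
    linarith [hDN j, hcA j, hN0 j, show D j = ∫ x, ‖g j x‖ ^ 2 ∂μ from rfl]
  obtain ⟨y, hy⟩ := exists_weak_limit U hGb
  have hyd : ‖y‖ ^ 2 ≤ d := by
    have h1 := hy y
    rw [real_inner_self_eq_norm_sq] at h1
    have h2 : Tendsto (fun j => ‖y‖ * Real.sqrt (D j)) U (𝓝 (‖y‖ * Real.sqrt d)) :=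
      (hd.sqrt).const_mul _
    have h3 : ‖y‖ ^ 2 ≤ ‖y‖ * Real.sqrt d := by
      refine le_of_tendsto_of_tendsto h1 h2 (Eventually.of_forall fun j => ?_)
      refine (real_inner_le_norm _ _).trans (mul_le_mul_of_nonneg_left ?_ (norm_nonneg _))
      refine Real.le_sqrt_of_sq_le ?_
      rw [hG]; simp only [hGn]; rfl
    have hd0 : 0 ≤ d := ge_of_tendsto hd (Eventually.of_forall hD0)
    by_cases hy0 : ‖y‖ = 0
    · rw [hy0]; simpa using hd0
    · have h4 : ‖y‖ ≤ Real.sqrt d := by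
        have : 0 < ‖y‖ := lt_of_le_of_ne (norm_nonneg _) (Ne.symm hy0)
        nlinarith
      calc ‖y‖ ^ 2 ≤ (Real.sqrt d) ^ 2 := by gcongr
        _ = d := Real.sq_sqrt hd0
  have hyL : MemLp y 2 μ := Lp.memLp y
  have hWk : W12 Ω w y := by
    refine ⟨MemLp.of_bound mw B ?_, hyL, fun φ hφ => ?_⟩
    · filter_upwards [hw, ae_all_iff.2 hvB] with x h1 h2
      exact le_of_tendsto h1.abs (Eventually.of_forall h2)
    have T1 : Tendsto (fun j => ∫ x in Ω, v j x • gradient φ x) atTop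
        (𝓝 (∫ x in Ω, w x • gradient φ x)) := by
      refine tendsto_integral_of_dominated_convergence (fun x => B * ‖gradient φ x‖)
        (fun j => ((hv j).integrable_smul_gradient hφ).1) ?_ (fun j => ?_) ?_
      · exact (hφ.memLp_gradient.integrable (by norm_num)).norm.const_mul B
      · filter_upwards [hvB j] with x hx
        rw [norm_smul]; gcongr; exact hx
      · filter_upwards [hw] with x hx using hx.smul_const _
    have hyi : Integrable (fun x => φ x • y x) μ := MemLp.integrable_smul_two hφ.memLp hyL
    refine ext_inner_left ℝ fun e => ?_
    have hφe : MemLp (fun x => φ x • e) 2 μ :=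
      (hφ.1.continuous.smul continuous_const).memLp_of_hasCompactSupport hφ.2.1.smul_right
    have h2 := hy (hφe.toLp _)
    have hin : ∀ {f : E n → E n} (hf : Integrable (fun x => φ x • f x) μ) {z : Lp (E n) 2 μ},
        z =ᵐ[μ] f → inner ℝ (hφe.toLp _) z = inner ℝ e (∫ x, φ x • f x ∂μ) := by
      intro f hf z hz
      rw [L2.inner_def, ← integral_inner hf]
      refine integral_congr_ae ?_
      filter_upwards [hφe.coeFn_toLp, hz] with x h3 h4
      rw [h3, h4, real_inner_smul_left, real_inner_smul_right]
    rw [hin hyi (EventuallyEq.refl _ _)] at h2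
    have h2 := h2.congr fun j =>
      hin ((hv j).integrable_smul_grad hφ) (hv j).memLp_grad.coeFn_toLp
    have h3 := (tendsto_const_nhds (x := e)).inner (T1.mono_left hUle) (𝕜 := ℝ)
    refine tendsto_nhds_unique h3 ?_
    rw [inner_neg_right]
    refine h2.neg.congr fun j => ?_
    rw [(hv j).2.2 φ hφ, inner_neg_right]
  refine ⟨y, hWk, ?_⟩
  have hN' := integral_indicator_interphase_le_of_tendsto (fun j => (hv j).1.1) hw hUle hm
  have : ∫ x in Ω, dens w y x = ‖y‖ ^ 2 +
      ∫ x, (interphase w).indicator (fun _ => (1 : ℝ)) x ∂μ := by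
    have e1 := hGn hyL
    rw [Lp.toLp_coeFn] at e1
    rw [e1, ← integral_add (MemLp.integrable_norm_sq' hyL) (integrable_indicator_interphase mw)]
    rfl
  linarith

/-! ### The scale derivative of mollifications -/

/-- An antiderivative of the profile `exp (-1 / t)` of the mollifier. -/
noncomputable def rho (t : ℝ) : ℝ := ∫ r in (0 : ℝ)..t, expNegInvGlue r

lemma hasDerivAt_rho (t : ℝ) : HasDerivAt rho (expNegInvGlue t) t :=
  have hc : Continuous expNegInvGlue := (expNegInvGlue.contDiff (n := 0)).continuous
  intervalIntegral.integral_hasDerivAt_right (hc.intervalIntegrable _ _)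
    (hc.stronglyMeasurableAtFilter _ _) hc.continuousAt

lemma rho_contDiff : ContDiff ℝ ∞ rho := by
  rw [contDiff_infty_iff_deriv]
  refine ⟨fun t => (hasDerivAt_rho t).differentiableAt, ?_⟩
  rw [show deriv rho = expNegInvGlue from funext fun t => (hasDerivAt_rho t).deriv]
  exact expNegInvGlue.contDiff (n := ⊤)

lemma rho_of_nonpos {t : ℝ} (ht : t ≤ 0) : rho t = 0 := by
  rw [rho, intervalIntegral.integral_symm, neg_eq_zero]
  rw [intervalIntegral.integral_congr (g := fun _ => 0)]
  · simp
  · intro r hr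
    rw [Set.uIcc_of_le ht] at hr
    exact expNegInvGlue.zero_of_nonpos hr.2

/-- The radial test function centred at `x` whose Laplacian is minus the derivative of the
mollifier in its scale. -/
noncomputable def pot (s : ℝ) (x y : E n) : ℝ :=
  -(kap n / 2) * (s ^ n)⁻¹ * rho (1 - ‖y - x‖ ^ 2 / s ^ 2)

lemma contDiff_profile (s : ℝ) (x : E n) :
    ContDiff ℝ ∞ (fun y : E n => 1 - ‖y - x‖ ^ 2 / s ^ 2) :=
  contDiff_const.sub (((contDiff_norm_sq ℝ).comp (contDiff_id.sub contDiff_const)).div_const _)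

lemma one_sub_le_zero {s : ℝ} (hs : 0 < s) {x y : E n} (h : y ∉ closedBall x s) :
    1 - ‖y - x‖ ^ 2 / s ^ 2 ≤ 0 := by
  rw [mem_closedBall, dist_eq_norm, not_le] at h
  rw [sub_nonpos, one_le_div (by positivity)]
  gcongr

lemma isTestFunction_of_forall_notMem {φ : E n → ℝ} (hφ : ContDiff ℝ ∞ φ) {x : E n} {s : ℝ}
    (h0 : ∀ y ∉ closedBall x s, φ y = 0) (h : closedBall x s ⊆ Ω) : IsTestFunction Ω φ := by
  have ht : tsupport φ ⊆ closedBall x s := closure_minimal (fun y hy => by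
    by_contra h'; exact hy (h0 y h')) isClosed_closedBall
  exact ⟨hφ, (isCompact_closedBall x s).of_isClosed_subset (isClosed_tsupport _) ht, ht.trans h⟩

lemma isTestFunction_pot {s : ℝ} (hs : 0 < s) {x : E n} (h : closedBall x s ⊆ Ω) :
    IsTestFunction Ω (pot s x) := by
  refine isTestFunction_of_forall_notMem (contDiff_const.mul (rho_contDiff.comp
    (contDiff_profile s x))) (fun y hy => ?_) h
  rw [pot, rho_of_nonpos (one_sub_le_zero hs hy), mul_zero]

lemma hasFDerivAt_profile (s : ℝ) (x y : E n) :
    HasFDerivAt (fun y : E n => 1 - ‖y - x‖ ^ 2 / s ^ 2)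
      ((-2 / s ^ 2) • innerSL ℝ (y - x)) y := by
  have h1 : HasFDerivAt (fun y : E n => ‖y - x‖ ^ 2) (2 • innerSL ℝ (y - x)) y := by
    have := ((hasFDerivAt_id y).sub_const x).norm_sq
    refine this.congr_fderiv ?_
    ext e; simp
  have h2 := (h1.mul_const (s ^ 2)⁻¹).const_sub 1
  refine (h2.congr_fderiv ?_).congr_of_eventuallyEq
    (Eventually.of_forall fun y => by simp only [div_eq_mul_inv])
  ext e; simp; ring

lemma gradient_pot {s : ℝ} (hs : 0 < s) (x y : E n) :
    gradient (pot s x) y =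
      (kap n * (s ^ (n + 2))⁻¹ * expNegInvGlue (1 - ‖y - x‖ ^ 2 / s ^ 2)) • (y - x) := by
  have h := ((hasDerivAt_rho (1 - ‖y - x‖ ^ 2 / s ^ 2)).comp_hasFDerivAt y
    (hasFDerivAt_profile s x y)).const_mul (-(kap n / 2) * (s ^ n)⁻¹)
  have h2 : HasFDerivAt (pot s x) _ y := h
  refine ext_inner_right ℝ fun e => ?_
  rw [← fderiv_eq_inner_gradient, h2.fderiv, real_inner_smul_left]
  simp only [smul_apply, innerSL_apply_apply, smul_eq_mul]
  field_simp
  ring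

lemma norm_gradient_pot_le {s : ℝ} (hs : 0 < s) (x y : E n) :
    ‖gradient (pot s x) y‖ ≤ kap n * expNegInvGlue 1 * (s ^ (n + 1))⁻¹ := by
  have hk := kap_pos n
  have he := expNegInvGlue.pos_of_pos one_pos
  rw [gradient_pot hs, norm_smul, Real.norm_eq_abs,
    abs_of_nonneg (mul_nonneg (by positivity) (expNegInvGlue.nonneg _))]
  by_cases hy : y ∈ closedBall x s
  · rw [mem_closedBall, dist_eq_norm] at hy
    calc kap n * (s ^ (n + 2))⁻¹ * expNegInvGlue (1 - ‖y - x‖ ^ 2 / s ^ 2) * ‖y - x‖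
        ≤ kap n * (s ^ (n + 2))⁻¹ * expNegInvGlue 1 * s := by
          gcongr
          refine expNegInvGlue.monotone ?_
          have : 0 ≤ ‖y - x‖ ^ 2 / s ^ 2 := by positivity
          linarith
      _ = _ := by field_simp; ring
  · rw [expNegInvGlue.zero_of_nonpos (one_sub_le_zero hs hy)]
    simp only [mul_zero, zero_mul]; positivity

/-- The derivative of the mollifier in its scale. -/
noncomputable def kerDeriv (s : ℝ) (z : E n) : ℝ :=
  -(kap n * (s ^ (n + 2))⁻¹ * ((n + 1) * expNegInvGlue (1 - ‖z‖ ^ 2 / s ^ 2) -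
    2 * (‖z‖ ^ 2 / s ^ 2) * deriv expNegInvGlue (1 - ‖z‖ ^ 2 / s ^ 2)))

lemma hasDerivAt_expNegInvGlue (t : ℝ) :
    HasDerivAt expNegInvGlue (deriv expNegInvGlue t) t :=
  ((expNegInvGlue.contDiff (n := 1)).differentiable (by simp) t).hasDerivAt

lemma hasDerivAt_ker {s : ℝ} (hs : 0 < s) (z : E n) :
    HasDerivAt (fun s => ker s z) (kerDeriv s z) s := by
  have h1 : HasDerivAt (fun s : ℝ => (s ^ (n + 1))⁻¹) (-((n + 1 : ℕ) * s ^ n) / (s ^ (n + 1)) ^ 2) s := by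
    simpa using (hasDerivAt_pow (n + 1) s).fun_inv (by positivity)
  have h2 : HasDerivAt (fun s : ℝ => 1 - ‖z‖ ^ 2 / s ^ 2) (2 * ‖z‖ ^ 2 / s ^ 3) s := by
    have := ((hasDerivAt_const s (‖z‖ ^ 2)).fun_div (hasDerivAt_pow 2 s) (by positivity)).const_sub 1
    refine this.congr_deriv ?_
    push_cast
    field_simp
    ring
  have h3 := (h1.const_mul (kap n)).mul ((hasDerivAt_expNegInvGlue _).comp s h2)
  refine h3.congr_deriv ?_
  simp only [kerDeriv, Function.comp]
  push_cast
  field_simp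
  ring

lemma exists_kerDeriv_bound (n : ℕ) : ∃ B : ℝ, ∀ s : ℝ, 0 < s → ∀ z : E n,
    |kerDeriv s z| ≤ B * (s ^ (n + 2))⁻¹ := by
  have hcd : Continuous (deriv expNegInvGlue) :=
    (expNegInvGlue.contDiff (n := 1)).continuous_deriv le_rfl
  obtain ⟨B, hB⟩ := (isCompact_Icc (a := (0 : ℝ)) (b := 1)).exists_bound_of_continuousOn
    hcd.continuousOn
  have hB0 : 0 ≤ B := (norm_nonneg _).trans (hB 0 (by simp))
  have hk := kap_pos n
  refine ⟨kap n * ((n + 1) * expNegInvGlue 1 + 2 * B), fun s hs z => ?_⟩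
  set q := ‖z‖ ^ 2 / s ^ 2 with hq
  have hq0 : 0 ≤ q := by positivity
  have h1 : |2 * q * deriv expNegInvGlue (1 - q)| ≤ 2 * B := by
    by_cases h : q ≤ 1
    · rw [abs_mul, abs_of_nonneg (by positivity)]
      have := hB (1 - q) ⟨by linarith, by linarith⟩
      rw [Real.norm_eq_abs] at this
      calc 2 * q * |deriv expNegInvGlue (1 - q)| ≤ 2 * 1 * B := by gcongr
        _ = 2 * B := by ring
    · have : deriv expNegInvGlue (1 - q) = 0 := by
        have he : expNegInvGlue =ᶠ[𝓝 (1 - q)] fun _ => 0 := by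
          filter_upwards [gt_mem_nhds (show 1 - q < 0 by linarith)] with t ht
          exact expNegInvGlue.zero_of_nonpos ht.le
        rw [he.deriv_eq]; simp
      rw [this]; simp [hB0]
  have h2 : |((n : ℝ) + 1) * expNegInvGlue (1 - q)| ≤ (n + 1) * expNegInvGlue 1 := by
    rw [abs_of_nonneg (mul_nonneg (by positivity) (expNegInvGlue.nonneg _))]
    gcongr
    exact expNegInvGlue.monotone (by linarith)
  rw [kerDeriv, abs_neg, abs_mul, abs_of_nonneg (by positivity)]
  calc kap n * (s ^ (n + 2))⁻¹ * |(n + 1) * expNegInvGlue (1 - q) -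
        2 * q * deriv expNegInvGlue (1 - q)|
      ≤ kap n * (s ^ (n + 2))⁻¹ * ((n + 1) * expNegInvGlue 1 + 2 * B) := by
        gcongr
        exact (abs_sub _ _).trans (add_le_add h2 h1)
    _ = _ := by ring

lemma continuous_kerDeriv (s : ℝ) : Continuous (kerDeriv (n := n) s) := by
  have hcd : Continuous (deriv expNegInvGlue) :=
    (expNegInvGlue.contDiff (n := 1)).continuous_deriv le_rfl
  have hce : Continuous expNegInvGlue := (expNegInvGlue.contDiff (n := 0)).continuous
  unfold kerDeriv
  fun_prop

/-- Differentiation of the mollification in its scale, under the integral sign. -/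
lemma hasDerivAt_integral_ker {u : E n → ℝ} (hu : IntegrableOn u Ω) {s : ℝ} (hs : 0 < s)
    (x : E n) : HasDerivAt (fun s => ∫ y in Ω, ker s (x - y) * u y)
      (∫ y in Ω, kerDeriv s (x - y) * u y) s := by
  obtain ⟨B, hB⟩ := exists_kerDeriv_bound n
  have hB0 : 0 ≤ B := by
    have := (abs_nonneg _).trans (hB 1 one_pos (0 : E n)); simpa using this
  have hk : ∀ t, AEStronglyMeasurable (fun y => ker t (x - y) * u y) (volume.restrict Ω) := fun t =>
    ((ker_contDiff n t).continuous.comp (continuous_const.sub continuous_id)).aestronglyMeasurable.mul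
      hu.1
  refine (hasDerivAt_integral_of_dominated_loc_of_deriv_le (𝕜 := ℝ)
    (F := fun s y => ker s (x - y) * u y) (F' := fun s y => kerDeriv s (x - y) * u y)
    (bound := fun y => B * ((s / 2) ^ (n + 2))⁻¹ * ‖u y‖) (s := Set.Ioi (s / 2))
    (Ioi_mem_nhds (by linarith)) (Eventually.of_forall hk) ?_ ?_ ?_ ?_ ?_).2
  · refine (hu.norm.const_mul (kap n * (s ^ (n + 1))⁻¹ * expNegInvGlue 1)).mono' (hk s)
      (ae_of_all _ fun y => ?_)
    rw [norm_mul]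
    gcongr
    rw [Real.norm_eq_abs, abs_of_nonneg (ker_nonneg hs _)]
    exact ker_le hs _
  · exact ((continuous_kerDeriv s).comp (continuous_const.sub continuous_id)).aestronglyMeasurable.mul
      hu.1
  · refine ae_of_all _ fun y t ht => ?_
    have ht0 : 0 < t := (by linarith : (0 : ℝ) < s / 2).trans ht
    rw [norm_mul]
    gcongr
    refine (hB t ht0 _).trans ?_
    have := (show s / 2 < t from ht).le
    gcongr
  · exact hu.norm.const_mul _
  · refine ae_of_all _ fun y t ht => ?_
    exact (hasDerivAt_ker ((by linarith : (0 : ℝ) < s / 2).trans ht) _).mul_const _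

/-- Weak differentiation along a coordinate direction. -/
lemma W12.integral_mul_fderiv {u : E n → ℝ} {g : E n → E n} (hu : W12 Ω u g) {φ : E n → ℝ}
    (hφ : IsTestFunction Ω φ) (e : E n) :
    ∫ y in Ω, u y * fderiv ℝ φ y e = - ∫ y in Ω, φ y * inner ℝ (g y) e := by
  have h := congrArg (fun z => inner ℝ e z) (hu.2.2 φ hφ)
  simp only [inner_neg_right] at h
  rw [← integral_inner (hu.integrable_smul_gradient hφ),
    ← integral_inner (hu.integrable_smul_grad hφ)] at h
  simp_rw [real_inner_smul_right] at h
  simp_rw [fderiv_eq_inner_gradient, real_inner_comm e]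
  simpa only [real_inner_comm] using h

/-- The scale derivative of the mollification of a Sobolev function is the Dirichlet pairing of its
weak gradient with the radial test function `pot`. -/
lemma W12.hasDerivAt_mol {u : E n → ℝ} {g : E n → E n} (hu : W12 Ω u g) (hui : IntegrableOn u Ω)
    {s : ℝ} (hs : 0 < s) {x : E n} (hx : closedBall x s ⊆ Ω) :
    HasDerivAt (fun s => ∫ y in Ω, ker s (x - y) * u y)
      (∫ y in Ω, inner ℝ (g y) (gradient (pot s x) y)) s := by
  refine (hasDerivAt_integral_ker hui hs x).congr_deriv ?_
  set c : ℝ := kap n * (s ^ (n + 2))⁻¹ with hc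
  set b := EuclideanSpace.basisFun (Fin (n + 1)) ℝ with hb
  set X : Fin (n + 1) → E n → ℝ := fun i y =>
    c * expNegInvGlue (1 - ‖y - x‖ ^ 2 / s ^ 2) * inner ℝ (y - x) (b i) with hX
  have hXc : ∀ i, ContDiff ℝ ∞ (X i) := fun i =>
    (contDiff_const.mul ((expNegInvGlue.contDiff (n := ⊤)).comp (contDiff_profile s x))).mul
      ((contDiff_id.sub contDiff_const).inner ℝ contDiff_const)
  have hXt : ∀ i, IsTestFunction Ω (X i) := fun i => by
    refine isTestFunction_of_forall_notMem (hXc i) (fun y hy => ?_) hx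
    simp only [hX, expNegInvGlue.zero_of_nonpos (one_sub_le_zero hs hy), mul_zero, zero_mul]
  have hXd : ∀ i y, fderiv ℝ (X i) y (b i) =
      c * (expNegInvGlue (1 - ‖y - x‖ ^ 2 / s ^ 2) - 2 * (inner ℝ (y - x) (b i)) ^ 2 / s ^ 2 *
        deriv expNegInvGlue (1 - ‖y - x‖ ^ 2 / s ^ 2)) := fun i y => by
    have h1 := ((hasDerivAt_expNegInvGlue _).comp_hasFDerivAt y
      (hasFDerivAt_profile s x y)).const_mul c
    have h2 : HasFDerivAt (fun y : E n => (inner ℝ (y - x) (b i) : ℝ)) (innerSL ℝ (b i)) y := by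
      have := ((innerSL ℝ (b i)).hasFDerivAt (x := y - x)).comp y ((hasFDerivAt_id y).sub_const x)
      refine this.congr_of_eventuallyEq (Eventually.of_forall fun y => ?_)
      simp [real_inner_comm]
    have h3 := h1.mul h2
    have h4 : HasFDerivAt (X i) _ y := h3
    rw [h4.fderiv]
    have hbi : ‖b i‖ = 1 := b.orthonormal.norm_eq_one i
    simp only [add_apply, smul_apply, innerSL_apply_apply,
      smul_eq_mul, Function.comp, real_inner_self_eq_norm_sq, hbi]
    ring
  have hsum : ∀ y, ∑ i, (inner ℝ (y - x) (b i)) ^ 2 = ‖y - x‖ ^ 2 := fun y => by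
    exact b.sum_sq_inner_left _
  have hkd : ∀ y, kerDeriv s (x - y) * u y = - ∑ i, u y * fderiv ℝ (X i) y (b i) := fun y => by
    simp_rw [hXd, ← Finset.mul_sum, Finset.sum_sub_distrib, ← Finset.sum_mul, ← Finset.sum_div,
      ← Finset.mul_sum, hsum]
    rw [kerDeriv, norm_sub_rev]
    simp only [Finset.sum_const, Finset.card_univ, Fintype.card_fin, nsmul_eq_mul]
    push_cast
    ring
  have hgr : ∀ y, inner ℝ (g y) (gradient (pot s x) y) = ∑ i, X i y * inner ℝ (g y) (b i) := fun y => by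
    rw [gradient_pot hs, real_inner_smul_right, ← b.sum_inner_mul_inner (g y) (y - x),
      Finset.mul_sum]
    refine Finset.sum_congr rfl fun i _ => ?_
    simp only [hX]
    rw [real_inner_comm (b i) (y - x)]
    ring
  simp_rw [hkd, hgr, integral_neg]
  rw [integral_finsetSum, integral_finsetSum, ← Finset.sum_neg_distrib]
  · refine Finset.sum_congr rfl fun i _ => ?_
    rw [hu.integral_mul_fderiv (hXt i), neg_neg]
  · intro i _
    refine ((hu.integrable_smul_grad (hXt i)).inner_const (b i)).congr (ae_of_all _ fun y => ?_)
    simp only [real_inner_smul_left]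
  · intro i _
    refine ((hu.integrable_smul_gradient (hXt i)).inner_const (b i)).congr (ae_of_all _ fun y => ?_)
    simp only [real_inner_smul_left, fderiv_eq_inner_gradient]

/-! ### Minimality under compactly supported perturbations -/

/-- `u`, with weak gradient `g`, lies between the `L`-Lipschitz obstacles `V` and `W` on the bounded
open set `Ω` and has least energy among all such functions that agree with `u` off a compact subset
of `Ω`. This is the only form of minimality that the interior regularity theory uses. -/
structure PerturbMin (V W : E n → ℝ) (L : NNReal) (Ω : Set (E n)) (u : E n → ℝ) (g : E n → E n) :
    Prop where
  isOpen : IsOpen Ω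
  isBounded : Bornology.IsBounded Ω
  lipV : LipschitzOnWith L V Ω
  lipW : LipschitzOnWith L W Ω
  abs_V : ∀ x, |V x| ≤ 1
  abs_W : ∀ x, |W x| ≤ 1
  w12 : W12 Ω u g
  mem : ∀ᵐ x ∂(volume.restrict Ω), V x ≤ u x ∧ u x ≤ W x
  le : ∀ v k K, W12 Ω v k → (∀ᵐ x ∂(volume.restrict Ω), V x ≤ v x ∧ v x ≤ W x) →
    IsCompact K → K ⊆ Ω → (∀ᵐ x ∂(volume.restrict Ω), x ∉ K → v x = u x) →
    ∫ x in Ω, dens u g x ≤ ∫ x in Ω, dens v k x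

variable {V W u : E n → ℝ} {g : E n → E n} {L : NNReal}

lemma PerturbMin.measure_lt_top (h : PerturbMin V W L Ω u g) : volume Ω < ⊤ :=
  h.isBounded.measure_lt_top

lemma PerturbMin.measurableSet (h : PerturbMin V W L Ω u g) : MeasurableSet Ω :=
  h.isOpen.measurableSet

lemma PerturbMin.congr (h : PerturbMin V W L Ω u g) {u' : E n → ℝ}
    (hu : u =ᵐ[volume.restrict Ω] u') : PerturbMin V W L Ω u' g := by
  refine ⟨h.1, h.2, h.3, h.4, h.5, h.6, h.w12.congr hu (ae_eq_refl _), ?_, ?_⟩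
  · filter_upwards [h.mem, hu] with x hx hx'
    rwa [← hx']
  · intro v k K hv hvm hK hKΩ hvK
    rw [← integral_congr_ae (dens_congr_ae hu (ae_eq_refl g))]
    refine h.le v k K hv hvm hK hKΩ ?_
    filter_upwards [hu, hvK] with x hx hx'
    rwa [hx]

lemma dens_neg (v : E n → ℝ) (k : E n → E n) :
    dens (fun x => -v x) (fun x => -k x) = dens v k := by
  funext x
  have : interphase (fun x => -v x) = interphase v := by
    ext x; simp [interphase]
  rw [dens, dens, norm_neg, this]

lemma PerturbMin.neg (h : PerturbMin V W L Ω u g) :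
    PerturbMin (fun x => -W x) (fun x => -V x) L Ω (fun x => -u x) (fun x => -g x) := by
  refine ⟨h.1, h.2, h.lipW.neg, h.lipV.neg, by simpa using h.abs_W,
    by simpa using h.abs_V, h.w12.neg, ?_, ?_⟩
  · filter_upwards [h.mem] with x hx
    exact ⟨neg_le_neg hx.2, neg_le_neg hx.1⟩
  · intro v k K hv hvm hK hKΩ hvK
    rw [dens_neg, ← dens_neg v k]
    refine h.le _ _ K hv.neg ?_ hK hKΩ ?_
    · filter_upwards [hvm] with x hx
      exact ⟨by linarith [hx.2], by linarith [hx.1]⟩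
    · filter_upwards [hvK] with x hx hxK
      rw [hx hxK, neg_neg]

lemma PerturbMin.abs_le_one (h : PerturbMin V W L Ω u g) :
    ∀ᵐ x ∂(volume.restrict Ω), |u x| ≤ 1 := by
  filter_upwards [h.mem] with x hx
  exact abs_le.2 ⟨(abs_le.1 (h.abs_V x)).1.trans hx.1, hx.2.trans (abs_le.1 (h.abs_W x)).2⟩

/-- Minimality is local: a competitor in `Ω'` is extended to `Ω` by `u`. -/
lemma PerturbMin.mono (h : PerturbMin V W L Ω u g) (hΩ : IsOpen Ω') (hsub : Ω' ⊆ Ω)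
    {L' : NNReal} (hV : LipschitzOnWith L' V Ω') (hW : LipschitzOnWith L' W Ω') :
    PerturbMin V W L' Ω' u g := by
  refine ⟨hΩ, h.2.subset hsub, hV, hW, h.5, h.6, h.w12.mono hsub h.measurableSet,
    ae_restrict_of_ae_restrict_of_subset hsub h.mem, ?_⟩
  intro v k K hv hvm hK hKΩ hvK
  have hu' := h.w12.mono hsub h.measurableSet
  have hfin := h.measure_lt_top
  have : IsFiniteMeasure (volume.restrict Ω) := ⟨by simpa using hfin⟩
  have : IsFiniteMeasure (volume.restrict Ω') := ⟨by
    simpa using (measure_mono hsub).trans_lt hfin⟩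
  have hd := (hv.sub hu').extend_zero hΩ hK hKΩ (by
    filter_upwards [hvK] with x hx hxK
    rw [hx hxK, sub_self])
  have hz := h.w12.add (hd.mono (Set.subset_univ Ω) MeasurableSet.univ)
  set v' := fun x => u x + K.indicator (fun x => v x - u x) x with hv'
  set k' := fun x => g x + K.indicator (fun x => k x - g x) x with hk'
  have hvK' : ∀ x ∈ K, v' x = v x := fun x hx => by
    simp [hv', hx]
  have hvK'' : ∀ x ∉ K, v' x = u x := fun x hx => by
    simp [hv', hx]
  have hkK : ∀ x ∈ K, k' x = k x := fun x hx => by simp [hk', hx]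
  have hkK' : ∀ x ∉ K, k' x = g x := fun x hx => by simp [hk', hx]
  have key := h.le v' k' K hz ?_ hK (hKΩ.trans hsub) (ae_of_all _ hvK'')
  · have hkg : ∀ᵐ x ∂(volume.restrict Ω'), x ∉ K → k x = g x := by
      have := (hv.sub hu').grad_ae_eq_zero hΩ hK.isClosed.isOpen_compl (by
        filter_upwards [hvK] with x hx hxK
        rw [hx hxK, sub_self])
      filter_upwards [this] with x hx hxK
      exact sub_eq_zero.1 (hx hxK)
    have hi1 := integrable_dens h.w12.memLp.1 h.w12.memLp_grad
    have hi2 := integrable_dens hz.memLp.1 hz.memLp_grad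
    have e1 := setIntegral_union (μ := volume) (f := dens u g) (s := Ω') (t := Ω \ Ω')
      Set.disjoint_sdiff_right (h.measurableSet.diff hΩ.measurableSet)
      (IntegrableOn.mono_set hi1 hsub) (IntegrableOn.mono_set hi1 Set.sdiff_subset)
    have e2 := setIntegral_union (μ := volume) (f := dens v' k') (s := Ω') (t := Ω \ Ω')
      Set.disjoint_sdiff_right (h.measurableSet.diff hΩ.measurableSet)
      (IntegrableOn.mono_set hi2 hsub) (IntegrableOn.mono_set hi2 Set.sdiff_subset)
    rw [Set.union_sdiff_cancel hsub] at e1 e2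
    have e3 : ∫ x in Ω \ Ω', dens v' k' x = ∫ x in Ω \ Ω', dens u g x :=
      setIntegral_congr_fun (h.measurableSet.diff hΩ.measurableSet) fun x hx => by
        have : x ∉ K := fun hxK => hx.2 (hKΩ hxK)
        exact dens_congr (hvK'' x this) (hkK' x this)
    have e4 : ∫ x in Ω', dens v' k' x = ∫ x in Ω', dens v k x := by
      refine integral_congr_ae ?_
      filter_upwards [hvK, hkg] with x h1 h2
      by_cases hxK : x ∈ K
      · exact dens_congr (hvK' x hxK) (hkK x hxK)
      · exact dens_congr ((hvK'' x hxK).trans (h1 hxK).symm) ((hkK' x hxK).trans (h2 hxK).symm)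
    linarith
  · have hvm' : ∀ᵐ x ∂(volume.restrict Ω), x ∈ Ω' → V x ≤ v x ∧ v x ≤ W x := by
      rw [ae_restrict_iff' h.measurableSet]
      rw [ae_restrict_iff' hΩ.measurableSet] at hvm
      filter_upwards [hvm] with x hx _
      exact hx
    filter_upwards [h.mem, hvm'] with x h1 h2
    by_cases hxK : x ∈ K
    · rw [hvK' x hxK]; exact h2 (hKΩ hxK)
    · rw [hvK'' x hxK]; exact h1

/-- Truncation of a Sobolev function between two Lipschitz obstacles: outside the contact sets the
gradient is unchanged, and on them it is bounded by the Lipschitz constant. -/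
lemma W12.clamp {v : E n → ℝ} {k : E n → E n} (hv : W12 Ω v k) (hΩ : IsOpen Ω)
    (hb : Bornology.IsBounded Ω) (hV : LipschitzOnWith L V Ω) (hW : LipschitzOnWith L W Ω) :
    ∃ q, W12 Ω (fun x => Max.max (V x) (Min.min (W x) (v x))) q ∧
      ∀ x ∈ Ω, ‖q x‖ ^ 2 ≤ ‖k x‖ ^ 2 + L ^ 2 := by
  refine ⟨_, (W12.of_lipschitzOn hV hΩ hb).max ((W12.of_lipschitzOn hW hΩ hb).min hv hΩ) hΩ,
    fun x hx => ?_⟩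
  have hV' := norm_gradient_le_of_lipschitzOn hV hΩ hx
  have hW' := norm_gradient_le_of_lipschitzOn hW hΩ hx
  have h1 : ‖gradient V x‖ ^ 2 ≤ (L : ℝ) ^ 2 := by gcongr
  have h2 : ‖gradient W x‖ ^ 2 ≤ (L : ℝ) ^ 2 := by gcongr
  split_ifs <;> nlinarith [sq_nonneg ‖k x‖, sq_nonneg (L : ℝ)]

/-- Minimizers are harmonic up to a bounded error. The competitors are the truncations of `u + t φ`
between the obstacles: the truncation and the interphase cost at most `L² + 1` per unit volume of
`K`, so a quadratic polynomial in `t` is nonnegative, and its discriminant gives the bound. -/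
lemma PerturbMin.sq_integral_inner_le (h : PerturbMin V W L Ω u g) {φ : E n → ℝ} {K : Set (E n)}
    (hφ : IsTestFunction Ω φ) (hK : IsCompact K) (hKΩ : K ⊆ Ω) (hφK : tsupport φ ⊆ K) :
    (∫ x in Ω, inner ℝ (g x) (gradient φ x)) ^ 2 ≤
      (L ^ 2 + 1) * volume.real K * ∫ x in Ω, ‖gradient φ x‖ ^ 2 := by
  have : IsFiniteMeasure (volume.restrict Ω) := ⟨by simpa using h.measure_lt_top⟩
  have hφw : W12 Ω φ (gradient φ) := hφ.w12
  have hKm : MeasurableSet K := hK.measurableSet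
  have hi := MemLp.integrable_inner_two h.w12.memLp_grad hφw.memLp_grad
  have hi2 := MemLp.integrable_norm_sq' hφw.memLp_grad
  have quad : ∀ t : ℝ, 0 ≤ (∫ x in Ω, ‖gradient φ x‖ ^ 2) * (t * t) +
      (2 * ∫ x in Ω, inner ℝ (g x) (gradient φ x)) * t + (L ^ 2 + 1) * volume.real K := by
    intro t
    obtain ⟨q, hq, hqb⟩ := (h.w12.add (hφw.const_mul t)).clamp h.isOpen h.isBounded h.lipV h.lipW
    have hne : ∀ᵐ x ∂(volume.restrict Ω), x ∉ K →
        Max.max (V x) (Min.min (W x) (u x + t * φ x)) = u x := by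
      filter_upwards [h.mem] with x hx hxK
      rw [image_eq_zero_of_notMem_tsupport fun hx' => hxK (hφK hx'), mul_zero, add_zero,
        min_eq_right hx.2, max_eq_right hx.1]
    have hm := h.le _ q K hq (by
      filter_upwards [h.mem] with x hx
      exact ⟨le_max_left _ _, max_le (hx.1.trans hx.2) (min_le_left _ _)⟩) hK hKΩ hne
    have hqg : ∀ᵐ x ∂(volume.restrict Ω), x ∉ K → q x = g x := by
      have := (hq.sub h.w12).grad_ae_eq_zero h.isOpen hK.isClosed.isOpen_compl (by
        filter_upwards [hne] with x hx hxK
        rw [hx hxK, sub_self])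
      filter_upwards [this] with x hx hxK
      exact sub_eq_zero.1 (hx hxK)
    have hle : ∫ x in Ω, dens (fun x => Max.max (V x) (Min.min (W x) (u x + t * φ x))) q x ≤
        ∫ x in Ω, (dens u g x + (t ^ 2 * ‖gradient φ x‖ ^ 2 +
          2 * t * inner ℝ (g x) (gradient φ x) + K.indicator (fun _ => (L : ℝ) ^ 2 + 1) x)) := by
      refine integral_mono_ae (integrable_dens hq.memLp.1 hq.memLp_grad)
        ((integrable_dens h.w12.memLp.1 h.w12.memLp_grad).add
          (((hi2.const_mul _).add (hi.const_mul _)).add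
            ((integrable_const _).indicator hKm))) ?_
      filter_upwards [hne, hqg, ae_restrict_mem h.measurableSet] with x h1 h2 hxΩ
      have h3 : ‖g x + t • gradient φ x‖ ^ 2 = ‖g x‖ ^ 2 + 2 * t * inner ℝ (g x) (gradient φ x) +
          t ^ 2 * ‖gradient φ x‖ ^ 2 := by
        rw [norm_add_sq_real, real_inner_smul_right, norm_smul, mul_pow, Real.norm_eq_abs, sq_abs]
        ring
      by_cases hxK : x ∈ K
      · have h4 := hqb x hxΩ
        have h5 := indicator_interphase_le_one
          (fun x => Max.max (V x) (Min.min (W x) (u x + t * φ x))) x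
        have h6 := indicator_interphase_nonneg u x
        rw [h3] at h4
        simp only [dens, Set.indicator_of_mem hxK] at *
        linarith
      · have h4 : gradient φ x = 0 :=
          gradient_eq_zero_of_notMem_tsupport fun hx' => hxK (hφK hx')
        rw [dens_congr (w := u) (k := g) (h1 hxK) (h2 hxK), h4]
        simp [hxK]
    have hsplit : ∫ x in Ω, (dens u g x + (t ^ 2 * ‖gradient φ x‖ ^ 2 +
        2 * t * inner ℝ (g x) (gradient φ x) + K.indicator (fun _ => (L : ℝ) ^ 2 + 1) x)) =
        (∫ x in Ω, dens u g x) + (t ^ 2 * (∫ x in Ω, ‖gradient φ x‖ ^ 2) +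
          2 * t * (∫ x in Ω, inner ℝ (g x) (gradient φ x)) +
          ∫ x in Ω, K.indicator (fun _ => (L : ℝ) ^ 2 + 1) x) := by
      have hi3 : Integrable (fun x => K.indicator (fun _ => (L : ℝ) ^ 2 + 1) x)
        (volume.restrict Ω) := (integrable_const _).indicator hKm
      have hi4 := hi2.const_mul (t ^ 2)
      have hi5 := hi.const_mul (2 * t)
      have hi6 : Integrable (fun x => t ^ 2 * ‖gradient φ x‖ ^ 2 +
        2 * t * inner ℝ (g x) (gradient φ x)) (volume.restrict Ω) := hi4.add hi5
      have hi7 : Integrable (fun x => t ^ 2 * ‖gradient φ x‖ ^ 2 +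
        2 * t * inner ℝ (g x) (gradient φ x) + K.indicator (fun _ => (L : ℝ) ^ 2 + 1) x)
        (volume.restrict Ω) := hi6.add hi3
      rw [integral_add (integrable_dens h.w12.memLp.1 h.w12.memLp_grad) hi7,
        integral_add hi6 hi3, integral_add hi4 hi5, integral_const_mul, integral_const_mul]
    rw [hsplit, integral_indicator hKm, Measure.restrict_restrict hKm,
      Set.inter_eq_left.2 hKΩ] at hle
    simp only [integral_const, smul_eq_mul, measureReal_restrict_apply_univ] at hle
    nlinarith
  have := discrim_le_zero quad
  rw [discrim] at this
  nlinarith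

/-- The mollifications of a minimizer move at bounded speed in the scale. -/
lemma PerturbMin.exists_deriv_mol_le (n : ℕ) : ∃ C : ℝ, 0 ≤ C ∧
    ∀ {Ω : Set (E n)} {V W u : E n → ℝ} {g : E n → E n} {L : NNReal}, PerturbMin V W L Ω u g →
    ∀ (x : E n) (s : ℝ), 0 < s → closedBall x s ⊆ Ω →
      |∫ y in Ω, inner ℝ (g y) (gradient (pot s x) y)| ≤ C * (L + 1) := by
  set ϖ := volume.real (ball (0 : E n) 1)
  have hk := kap_pos n
  have he := expNegInvGlue.pos_of_pos one_pos
  refine ⟨kap n * expNegInvGlue 1 * ϖ, by positivity, fun {Ω V W u g L} h x s hs hx => ?_⟩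
  have hvol : volume.real (closedBall x s) = s ^ (n + 1) * ϖ := by
    have := Measure.addHaar_real_closedBall (volume : Measure (E n)) x hs.le
    simpa using this
  have hφ := isTestFunction_pot hs hx
  have hsupp : tsupport (pot s x) ⊆ closedBall x s := (isTestFunction_pot hs subset_rfl).2.2
  have h1 := h.sq_integral_inner_le hφ (isCompact_closedBall x s) hx hsupp
  have h2 : ∫ y in Ω, ‖gradient (pot s x) y‖ ^ 2 ≤
      (kap n * expNegInvGlue 1 * (s ^ (n + 1))⁻¹) ^ 2 * (s ^ (n + 1) * ϖ) := by
    rw [setIntegral_eq_of_subset_of_forall_sdiff_eq_zero h.measurableSet hx]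
    · calc _ ≤ ∫ y in closedBall x s, (kap n * expNegInvGlue 1 * (s ^ (n + 1))⁻¹) ^ 2 := by
            refine integral_mono_of_nonneg (ae_of_all _ fun y => by positivity)
              (integrable_const_iff.2 (Or.inr ⟨by
                simpa using (isCompact_closedBall x s).measure_lt_top⟩)) (ae_of_all _ fun y => ?_)
            have := norm_gradient_pot_le hs x y
            simp only
            gcongr
        _ = _ := by
            rw [setIntegral_const, hvol, smul_eq_mul, mul_comm]
    · intro y hy
      rw [gradient_eq_zero_of_notMem_tsupport fun hy' => hy.2 (hsupp hy')]; simp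
  rw [hvol] at h1
  refine abs_le_of_sq_le_sq ?_ (by positivity)
  calc _ ≤ _ := h1
    _ ≤ ((L : ℝ) ^ 2 + 1) * (s ^ (n + 1) * ϖ) *
        ((kap n * expNegInvGlue 1 * (s ^ (n + 1))⁻¹) ^ 2 * (s ^ (n + 1) * ϖ)) := by gcongr
    _ = ((L : ℝ) ^ 2 + 1) * (kap n * expNegInvGlue 1 * ϖ) ^ 2 := by field_simp
    _ ≤ ((L : ℝ) + 1) ^ 2 * (kap n * expNegInvGlue 1 * ϖ) ^ 2 := by
        gcongr
        have := L.coe_nonneg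
        nlinarith
    _ = _ := by ring

/-- The precise representative: the limit of the mollifications. -/
noncomputable def rep (Ω : Set (E n)) (u : E n → ℝ) (x : E n) : ℝ :=
  limUnder (𝓝[>] (0 : ℝ)) fun s => mol s (Ω.indicator u) x

lemma mol_indicator (hΩ : MeasurableSet Ω) (s : ℝ) (x : E n) :
    mol s (Ω.indicator u) x = ∫ y in Ω, ker s (x - y) * u y := by
  rw [mol, ← integral_indicator hΩ]
  congr 1
  funext y
  by_cases hy : y ∈ Ω <;> simp [hy]

lemma PerturbMin.integrableOn (h : PerturbMin V W L Ω u g) : IntegrableOn u Ω := by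
  have : IsFiniteMeasure (volume.restrict Ω) := ⟨by simpa using h.measure_lt_top⟩
  exact h.w12.memLp.integrable (by norm_num)

lemma PerturbMin.locallyIntegrable (h : PerturbMin V W L Ω u g) :
    LocallyIntegrable (Ω.indicator u) :=
  ((integrable_indicator_iff h.measurableSet).2 h.integrableOn).locallyIntegrable

lemma PerturbMin.rep_ae_eq (h : PerturbMin V W L Ω u g) : u =ᵐ[volume.restrict Ω] rep Ω u := by
  rw [EventuallyEq, ae_restrict_iff' h.measurableSet]
  filter_upwards [ae_tendsto_mol h.locallyIntegrable] with x hx hxΩ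
  rw [rep, hx.limUnder_eq, Set.indicator_of_mem hxΩ]

/-- Since the scale derivative is bounded, the mollifications converge everywhere, at a linear rate
that is uniform in the point. -/
lemma PerturbMin.exists_mol_sub_rep_le (h : PerturbMin V W L Ω u g) : ∃ C : ℝ, 0 ≤ C ∧
    ∀ (x : E n) (r s : ℝ), closedBall x r ⊆ Ω → 0 < s → s ≤ r →
      |mol s (Ω.indicator u) x - rep Ω u x| ≤ C * s := by
  obtain ⟨C, hC0, hC⟩ := PerturbMin.exists_deriv_mol_le n
  refine ⟨C * (L + 1), by positivity, fun x r s hx hs hsr => ?_⟩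
  have hlip : ∀ t ∈ Set.Ioc 0 r, ∀ t' ∈ Set.Ioc 0 r,
      |mol t' (Ω.indicator u) x - mol t (Ω.indicator u) x| ≤ C * (L + 1) * |t' - t| := by
    intro t ht t' ht'
    rw [mol_indicator h.measurableSet, mol_indicator h.measurableSet]
    refine Convex.norm_image_sub_le_of_norm_hasDerivWithin_le
      (f := fun s => ∫ y in Ω, ker s (x - y) * u y)
      (f' := fun s => ∫ y in Ω, inner ℝ (g y) (gradient (pot s x) y)) (s := Set.Ioc 0 r)
      (fun t ht => (h.w12.hasDerivAt_mol h.integrableOn ht.1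
        ((closedBall_subset_closedBall ht.2).trans hx)).hasDerivWithinAt)
      (fun t ht => hC h x t ht.1 ((closedBall_subset_closedBall ht.2).trans hx))
      (convex_Ioc 0 r) ht ht'
  have hcau : Cauchy (map (fun s => mol s (Ω.indicator u) x) (𝓝[>] (0 : ℝ))) := by
    refine Metric.cauchy_iff.2 ⟨inferInstance, fun ε hε => ?_⟩
    set δ := min r (ε / (2 * (C * (L + 1) + 1)))
    have hδ : 0 < δ := lt_min (hs.trans_le hsr) (by positivity)
    refine ⟨_, image_mem_map (Ioo_mem_nhdsGT hδ), ?_⟩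
    rintro _ ⟨t, ht, rfl⟩ _ ⟨t', ht', rfl⟩
    rw [Real.dist_eq]
    have hδr : δ ≤ r := min_le_left _ _
    have hδ' : δ ≤ ε / (2 * (C * (L + 1) + 1)) := min_le_right _ _
    refine (hlip t' ⟨ht'.1, ht'.2.le.trans hδr⟩ t ⟨ht.1, ht.2.le.trans hδr⟩).trans_lt ?_
    have h1 : |t - t'| ≤ δ := abs_le.2 ⟨by linarith [ht.1, ht'.2], by linarith [ht.2, ht'.1]⟩
    have h0 : 0 ≤ C * (L + 1) := by positivity
    calc C * (L + 1) * |t - t'| ≤ C * (L + 1) * (ε / (2 * (C * (L + 1) + 1))) := by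
          gcongr; exact h1.trans hδ'
      _ < ε := by
          rw [← mul_div_assoc, div_lt_iff₀ (by positivity)]
          nlinarith
  have hlim : Tendsto (fun s => mol s (Ω.indicator u) x) (𝓝[>] (0 : ℝ)) (𝓝 (rep Ω u x)) :=
    tendsto_nhds_limUnder (CompleteSpace.complete hcau)
  refine le_of_tendsto ((tendsto_const_nhds.sub hlim).abs) ?_
  filter_upwards [Ioo_mem_nhdsGT hs] with t ht
  refine (hlip t ⟨ht.1, ht.2.le.trans hsr⟩ s ⟨hs, hsr⟩).trans ?_
  gcongr
  exact abs_le.2 ⟨by linarith [ht.2], by linarith [ht.1]⟩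

/-- The precise representative is a locally uniform limit of smooth functions. -/
lemma PerturbMin.continuousOn_rep (h : PerturbMin V W L Ω u g) : ContinuousOn (rep Ω u) Ω := by
  obtain ⟨C, hC0, hC⟩ := h.exists_mol_sub_rep_le
  intro x hx
  refine ContinuousAt.continuousWithinAt ?_
  obtain ⟨r, hr, hrΩ⟩ := Metric.nhds_basis_closedBall.mem_iff.1 (h.isOpen.mem_nhds hx)
  rw [Metric.continuousAt_iff']
  intro ε hε
  set s := min (r / 2) (ε / (4 * (C + 1)))
  have hs : 0 < s := lt_min (by positivity) (by positivity)
  have hCs : C * s < ε / 3 := by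
    have : s ≤ ε / (4 * (C + 1)) := min_le_right _ _
    calc C * s ≤ C * (ε / (4 * (C + 1))) := by gcongr
      _ < ε / 3 := by
        rw [← mul_div_assoc, div_lt_div_iff₀ (by positivity) (by positivity)]
        nlinarith
  have hcont := (mol_contDiff hs h.locallyIntegrable).continuous.continuousAt (x := x)
  filter_upwards [Metric.continuousAt_iff'.1 hcont (ε / 3) (by positivity),
    Metric.ball_mem_nhds x (half_pos hr)] with y hy hyr
  have h1 := hC x r s hrΩ hs ((min_le_left _ _).trans (by linarith))
  have h2 := hC y (r / 2) s ((closedBall_subset_closedBall' (by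
    rw [mem_ball] at hyr; linarith)).trans hrΩ) hs (min_le_left _ _)
  rw [Real.dist_eq] at *
  rw [abs_lt] at *
  rw [abs_le] at *
  constructor <;> linarith

/-- An inequality between continuous functions on an open set that holds almost everywhere. -/
lemma le_of_ae_le_of_continuousOn (hΩ : IsOpen Ω) {f f' : E n → ℝ} (hf : ContinuousOn f Ω)
    (hf' : ContinuousOn f' Ω) (h : ∀ᵐ x ∂(volume.restrict Ω), f x ≤ f' x) :
    ∀ x ∈ Ω, f x ≤ f' x := by
  by_contra! hc
  obtain ⟨x, hx, hlt⟩ := hc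
  have hU : {y | y ∈ Ω ∧ f' y < f y} ∈ 𝓝 x := by
    filter_upwards [hΩ.mem_nhds hx,
      (hf'.continuousAt (hΩ.mem_nhds hx)).eventually_lt (hf.continuousAt (hΩ.mem_nhds hx)) hlt]
      with y h1 h2 using ⟨h1, h2⟩
  rw [ae_restrict_iff' hΩ.measurableSet] at h
  have h0 : volume {y | y ∈ Ω ∧ f' y < f y} = 0 := by
    refine measure_mono_null (fun y hy => ?_) h
    simp only [Set.mem_compl_iff, Set.mem_ofPred_eq, not_forall, not_le]
    exact ⟨hy.1, hy.2⟩
  exact (Measure.measure_pos_of_mem_nhds volume hU).ne' h0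

lemma PerturbMin.mem_of_continuousOn (h : PerturbMin V W L Ω u g) (hu : ContinuousOn u Ω) :
    ∀ x ∈ Ω, V x ≤ u x ∧ u x ≤ W x := fun x hx =>
  ⟨le_of_ae_le_of_continuousOn h.isOpen h.lipV.continuousOn hu (h.mem.mono fun _ hx => hx.1) x hx,
    le_of_ae_le_of_continuousOn h.isOpen hu h.lipW.continuousOn (h.mem.mono fun _ hx => hx.2) x hx⟩

/-! ### Weakly subharmonic functions -/

lemma norm_mol_le_of_norm_le {F : Type*} [NormedAddCommGroup F] [NormedSpace ℝ F] {s : ℝ}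
    (hs : 0 < s) {f : E n → F} {C : ℝ} (hC : ∀ y, ‖f y‖ ≤ C) (x : E n) : ‖mol s f x‖ ≤ C := by
  calc ‖mol s f x‖ ≤ ∫ y, ‖ker s (x - y) • f y‖ := norm_integral_le_integral_norm _
    _ ≤ ∫ y, C * ker s (x - y) := by
        have hk : Integrable fun y : E n => ker s (x - y) := (ker_integrable hs).comp_sub_left x
        refine integral_mono_of_nonneg (ae_of_all _ fun y => norm_nonneg _)
          (hk.const_mul C) (ae_of_all _ fun y => ?_)
        simp only [norm_smul, Real.norm_eq_abs, abs_of_nonneg (ker_nonneg hs _)]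
        rw [mul_comm]
        exact mul_le_mul_of_nonneg_right (hC y) (ker_nonneg hs _)
    _ = C := by rw [integral_const_mul, integral_ker_sub hs, mul_one]

lemma hasCompactSupport_mol {s : ℝ} (hs : 0 < s) {f : E n → ℝ} (hf : HasCompactSupport f) :
    HasCompactSupport (mol s f) := by
  rw [mol_eq_convolution]
  exact (ker_hasCompactSupport hs).convolution _ hf

/-- Sobolev functions may be tested with compactly supported `C¹` functions. -/
lemma W12.integral_mul_fderiv_of_contDiff {p f : E n → ℝ} {q : E n → E n}
    (hp : W12 Set.univ p q) (hpi : Integrable p) (hqi : Integrable q) (hf : ContDiff ℝ 1 f)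
    (hfc : HasCompactSupport f) (e : E n) :
    ∫ x, p x * fderiv ℝ f x e = - ∫ x, f x * inner ℝ (q x) e := by
  have hg : Continuous (gradient f) :=
    (InnerProductSpace.toDual ℝ (E n)).symm.continuous.comp (hf.continuous_fderiv (by norm_num))
  have hfw := W12.of_contDiff hf hfc
  have hfl : LocallyIntegrable f := hf.continuous.locallyIntegrable
  have hgl : LocallyIntegrable (gradient f) := hg.locallyIntegrable
  obtain ⟨A, hA⟩ := hf.continuous.bounded_above_of_compact_support hfc
  obtain ⟨B, hB⟩ := hg.bounded_above_of_compact_support (HasCompactSupport.gradient hfc)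
  set s : ℕ → ℝ := fun k => 1 / ((k : ℝ) + 1) with hs_def
  have hs : ∀ k, 0 < s k := fun k => Nat.one_div_pos_of_nat
  have hs0 : Tendsto s atTop (𝓝[>] 0) := tendsto_nhdsWithin_iff.2
    ⟨tendsto_one_div_add_atTop_nhds_zero_nat, Eventually.of_forall hs⟩
  have ht : ∀ k, IsTestFunction Set.univ (mol (s k) f) := fun k =>
    ⟨mol_contDiff (hs k) hfl, hasCompactSupport_mol (hs k) hfc, Set.subset_univ _⟩
  have e1 : ∀ k, ∫ x, p x * inner ℝ (mol (s k) (gradient f) x) e =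
      - ∫ x, mol (s k) f x * inner ℝ (q x) e := fun k => by
    have := hp.integral_mul_fderiv (ht k) e
    simpa only [Measure.restrict_univ, fderiv_eq_inner_gradient, hfw.gradient_mol (hs k)] using this
  have hqe : Integrable (fun x => inner ℝ (q x) e) := hqi.inner_const e
  have l1 : Tendsto (fun k => ∫ x, p x * inner ℝ (mol (s k) (gradient f) x) e) atTop
      (𝓝 (∫ x, p x * inner ℝ (gradient f x) e)) := by
    refine tendsto_integral_of_dominated_convergence (fun x => ‖p x‖ * (B * ‖e‖)) (fun k => ?_)
      (hpi.norm.mul_const _) (fun k => ae_of_all _ fun x => ?_) ?_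
    · exact hpi.1.mul (((mol_contDiff (hs k) hgl).continuous.inner
        continuous_const).aestronglyMeasurable)
    · rw [norm_mul]
      gcongr
      refine (norm_inner_le_norm _ _).trans ?_
      gcongr
      exact norm_mol_le_of_norm_le (hs k) hB x
    · filter_upwards [ae_tendsto_mol hgl] with x hx
      exact ((hx.comp hs0).inner tendsto_const_nhds).const_mul _
  have l2 : Tendsto (fun k => ∫ x, mol (s k) f x * inner ℝ (q x) e) atTop
      (𝓝 (∫ x, f x * inner ℝ (q x) e)) := by
    refine tendsto_integral_of_dominated_convergence (fun x => A * ‖inner ℝ (q x) e‖) (fun k => ?_)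
      (hqe.norm.const_mul _) (fun k => ae_of_all _ fun x => ?_) ?_
    · exact (mol_contDiff (hs k) hfl).continuous.aestronglyMeasurable.mul hqe.1
    · rw [norm_mul]
      gcongr
      exact norm_mol_le_of_norm_le (hs k) hA x
    · filter_upwards [ae_tendsto_mol hfl] with x hx
      exact (hx.comp hs0).mul_const _
  simp_rw [fderiv_eq_inner_gradient]
  exact tendsto_nhds_unique l1 (by simpa only [e1] using l2.neg)

lemma integrable_of_memLp_two_of_compact {F : Type*} [NormedAddCommGroup F] {f : E n → F}
    (hf : MemLp f 2 (volume.restrict Set.univ)) {K : Set (E n)} (hK : IsCompact K)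
    (h0 : ∀ᵐ x, x ∉ K → f x = 0) : Integrable f := by
  rw [Measure.restrict_univ] at hf
  have h1 : Integrable (K.indicator f) := by
    rw [integrable_indicator_iff hK.measurableSet]
    have : IsFiniteMeasure (volume.restrict K) := ⟨by simpa using hK.measure_lt_top⟩
    exact (hf.restrict K).integrable (by norm_num)
  refine h1.congr ?_
  filter_upwards [h0] with x hx
  by_cases hxK : x ∈ K
  · simp [hxK]
  · simp [hxK, hx hxK]

lemma W12.ae_grad_eq_zero_of_compact {p : E n → ℝ} {q : E n → E n} (hp : W12 Set.univ p q)
    {K : Set (E n)} (hK : IsCompact K) (h0 : ∀ x ∉ K, p x = 0) : ∀ᵐ x, x ∉ K → q x = 0 := by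
  have := hp.grad_ae_eq_zero isOpen_univ hK.isClosed.isOpen_compl (ae_of_all _ fun x hx => h0 x hx)
  simpa using this

lemma laplacian_eq_sum_fderiv {w : E n → ℝ} {x : E n} (hw : ContDiffAt ℝ 2 w x) :
    (Δ w) x = ∑ i, fderiv ℝ (fun y => fderiv ℝ w y (EuclideanSpace.basisFun (Fin (n + 1)) ℝ i)) x
      (EuclideanSpace.basisFun (Fin (n + 1)) ℝ i) := by
  rw [InnerProductSpace.laplacian_eq_iteratedFDeriv_orthonormalBasis w
    (EuclideanSpace.basisFun (Fin (n + 1)) ℝ)]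
  refine Finset.sum_congr rfl fun i _ => ?_
  have hd : DifferentiableAt ℝ (fderiv ℝ w) x :=
    (hw.fderiv_right (m := 1) (by norm_num)).differentiableAt (by norm_num)
  rw [iteratedFDeriv_two_apply, fderiv_clm_apply hd (differentiableAt_const _)]
  simp

/-- Integration by parts for the field `ζ(w) ∇w`, whose divergence `ζ'(w) |∇w|² + ζ(w) Δw` is
nonnegative on the support of `p`. -/
lemma integral_comp_mul_inner_gradient_nonpos {w : E n → ℝ} {ζ : ℝ → ℝ} (hζ : ContDiff ℝ 1 ζ)
    (hζ0 : ∀ t, 0 ≤ ζ t) (hζ1 : ∀ t, 0 ≤ deriv ζ t) {K : Set (E n)} (hK : IsCompact K)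
    (hw : ∀ x ∈ K, (∀ᶠ y in 𝓝 x, ζ (w y) = 0) ∨ (ContDiffAt ℝ 2 w x ∧ 0 ≤ (Δ w) x))
    {p : E n → ℝ} {q : E n → E n} (hp : W12 Set.univ p q) (hp0 : ∀ x, 0 ≤ p x)
    (hpK : ∀ x ∉ K, p x = 0) : ∫ x, ζ (w x) * inner ℝ (gradient w x) (q x) ≤ 0 := by
  have hqK := hp.ae_grad_eq_zero_of_compact hK hpK
  have hpi : Integrable p := integrable_of_memLp_two_of_compact hp.memLp hK (ae_of_all _ hpK)
  have hqi : Integrable q := integrable_of_memLp_two_of_compact hp.memLp_grad hK hqK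
  set U : Set (E n) := {x | ∀ᶠ y in 𝓝 x, ζ (w y) = 0} ∪ {x | ContDiffAt ℝ 2 w x} with hUdef
  have hU : IsOpen U := by
    refine (isOpen_setOfPred_eventually_nhds).union (isOpen_iff_mem_nhds.2 fun x hx => ?_)
    exact ContDiffAt.eventually hx (by simp)
  have hKU : K ⊆ U := fun x hx => (hw x hx).imp id And.left
  obtain ⟨χ, hχ, hχ01, hχK⟩ := exists_cutoff hK hU hKU
  rw [eventually_nhdsSet_iff_forall] at hχK
  set b := EuclideanSpace.basisFun (Fin (n + 1)) ℝ with hb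
  set f : Fin (n + 1) → E n → ℝ := fun i y => χ y * (ζ (w y) * fderiv ℝ w y (b i)) with hf
  have hd1 : ∀ x, ContDiffAt ℝ 2 w x → ∀ i,
      ContDiffAt ℝ 1 (fun y => ζ (w y) * fderiv ℝ w y (b i)) x := fun x hx i =>
    (hζ.contDiffAt.comp x (hx.of_le (by norm_num))).mul
      ((hx.fderiv_right (m := 1) (by norm_num)).clm_apply contDiffAt_const)
  have hfc : ∀ i, ContDiff ℝ 1 (f i) := fun i => contDiff_iff_contDiffAt.2 fun x => by
    by_cases hx : x ∈ tsupport χ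
    · rcases hχ.2.2 hx with h | h
      · refine (contDiffAt_const (c := (0 : ℝ))).congr_of_eventuallyEq ?_
        filter_upwards [h] with y hy
        simp [hf, hy]
      · exact (hχ.1.contDiffAt.of_le (by exact_mod_cast le_top)).mul (hd1 x h i)
    · refine (contDiffAt_const (c := (0 : ℝ))).congr_of_eventuallyEq ?_
      filter_upwards [(isClosed_tsupport χ).isOpen_compl.mem_nhds hx] with y hy
      simp [hf, image_eq_zero_of_notMem_tsupport hy]
  have hfs : ∀ i, HasCompactSupport (f i) := fun i => hχ.2.1.mul_right
  have hfi := fun i => hp.integral_mul_fderiv_of_contDiff hpi hqi (hfc i) (hfs i) (b i)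
  have hfci : ∀ i, Integrable (fun x => f i x * inner ℝ (q x) (b i)) := fun i => by
    obtain ⟨A, hA⟩ := (hfc i).continuous.bounded_above_of_compact_support (hfs i)
    exact (hqi.inner_const (b i)).bdd_mul (hfc i).continuous.aestronglyMeasurable (ae_of_all _ hA)
  have hfdi : ∀ i, Integrable (fun x => p x * fderiv ℝ (f i) x (b i)) := fun i => by
    have hc : Continuous fun x => fderiv ℝ (f i) x (b i) :=
      ((hfc i).continuous_fderiv (by norm_num)).clm_apply continuous_const
    obtain ⟨A, hA⟩ := hc.bounded_above_of_compact_support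
      (((hfs i).fderiv ℝ).comp_left (g := fun l : E n →L[ℝ] ℝ => l (b i)) (by simp))
    exact hpi.mul_bdd hc.aestronglyMeasurable (ae_of_all _ hA)
  have e1 : ∫ x, ζ (w x) * inner ℝ (gradient w x) (q x) =
      ∫ x, ∑ i, f i x * inner ℝ (q x) (b i) := by
    refine integral_congr_ae ?_
    filter_upwards [hqK] with x hx
    by_cases hxK : x ∈ K
    · have h1 : χ x = 1 := (hχK x hxK).self_of_nhds
      simp_rw [hf, h1, one_mul, fderiv_eq_inner_gradient, mul_assoc, ← Finset.mul_sum]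
      congr 1
      rw [← b.sum_inner_mul_inner (gradient w x) (q x)]
      exact Finset.sum_congr rfl fun i _ => by rw [real_inner_comm (q x)]
    · simp [hx hxK]
  rw [e1, integral_finsetSum _ fun i _ => hfci i,
    ← neg_nonneg, ← Finset.sum_neg_distrib]
  simp_rw [← hfi]
  rw [← integral_finsetSum _ fun i _ => hfdi i]
  refine integral_nonneg fun x => ?_
  simp only [← Finset.mul_sum, Pi.zero_apply]
  by_cases hxK : x ∈ K
  · refine mul_nonneg (hp0 x) ?_
    have hfe : ∀ i, f i =ᶠ[𝓝 x] fun y => ζ (w y) * fderiv ℝ w y (b i) := fun i => by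
      filter_upwards [hχK x hxK] with y hy
      simp [hf, hy]
    rcases hw x hxK with h | ⟨h, hΔ⟩
    · have : ∀ i, fderiv ℝ (f i) x = 0 := fun i => by
        have h0 : f i =ᶠ[𝓝 x] fun _ => 0 := by
          filter_upwards [h] with y hy
          simp [hf, hy]
        rw [h0.fderiv_eq]; simp
      simp [this]
    · have hwd : DifferentiableAt ℝ w x := h.differentiableAt (by norm_num)
      have hζd : DifferentiableAt ℝ ζ (w x) := hζ.differentiable (by norm_num) _
      have hdd : ∀ i, DifferentiableAt ℝ (fun y => fderiv ℝ w y (b i)) x := fun i =>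
        ((h.fderiv_right (m := 1) (by norm_num)).clm_apply
          contDiffAt_const).differentiableAt (by norm_num)
      have : ∀ i, fderiv ℝ (f i) x (b i) =
          ζ (w x) * fderiv ℝ (fun y => fderiv ℝ w y (b i)) x (b i) +
            deriv ζ (w x) * (fderiv ℝ w x (b i)) ^ 2 := fun i => by
        have h1 := ((hζd.hasDerivAt.comp_hasFDerivAt x hwd.hasFDerivAt).mul (hdd i).hasFDerivAt)
        have h2 : HasFDerivAt (fun y => ζ (w y) * fderiv ℝ w y (b i)) _ x := h1
        rw [(hfe i).fderiv_eq, h2.fderiv]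
        simp only [add_apply, smul_apply, smul_eq_mul, Function.comp]
        ring
      simp_rw [this]
      rw [Finset.sum_add_distrib, ← Finset.mul_sum, ← Finset.mul_sum,
        ← laplacian_eq_sum_fderiv h]
      exact add_nonneg (mul_nonneg (hζ0 _) hΔ)
        (mul_nonneg (hζ1 _) (Finset.sum_nonneg fun i _ => sq_nonneg _))
  · simp [hpK x hxK]

/-- `V` is weakly subharmonic in `{V < 1}`: `∫ ∇V · ∇p ≤ 0` for every nonnegative Sobolev function
`p` supported in a compact subset of `{V < 1}`. -/
def WeakSubharm (V : E n → ℝ) : Prop :=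
  ∀ (p : E n → ℝ) (q : E n → E n) (K : Set (E n)), IsCompact K → (∀ x ∈ K, V x < 1) →
    W12 Set.univ p q → (∀ x, 0 ≤ p x) → (∀ x ∉ K, p x = 0) →
    ∫ x, inner ℝ (gradient V x) (q x) ≤ 0

/-- A function bounded below by `-1` that is classically subharmonic in `{|V| < 1}` is weakly
subharmonic across `{V = -1}`, where its gradient vanishes. -/
lemma weakSubharm_of_laplacian_nonneg {V : E n → ℝ} (hVc : Continuous V) (hV1 : ∀ x, -1 ≤ V x)
    (hV2 : ContDiffOn ℝ 2 V (interphase V)) (hΔ : ∀ x ∈ interphase V, 0 ≤ (Δ V) x)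
    (hb : ∀ K : Set (E n), IsCompact K → ∃ C, ∀ x ∈ K, ‖gradient V x‖ ≤ C) : WeakSubharm V := by
  intro p q K hK hKV hp hp0 hpK
  have hqK := hp.ae_grad_eq_zero_of_compact hK hpK
  have hqi : Integrable q := integrable_of_memLp_two_of_compact hp.memLp_grad hK hqK
  have hopen : IsOpen (interphase V) := isOpen_lt hVc.abs continuous_const
  set ζ : ℕ → ℝ → ℝ := fun j t => Real.smoothTransition (j * (t + 1) - 1) with hζ
  have hζc : ∀ j, ContDiff ℝ 1 (ζ j) := fun j =>
    Real.smoothTransition.contDiff.comp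
      ((contDiff_const.mul (contDiff_id.add contDiff_const)).sub contDiff_const)
  have hζm : ∀ j, Monotone (ζ j) := fun j a b hab =>
    Real.smoothTransition.monotone (by gcongr)
  have key : ∀ j, ∫ x, ζ j (V x) * inner ℝ (gradient V x) (q x) ≤ 0 := by
    intro j
    refine integral_comp_mul_inner_gradient_nonpos (hζc j)
      (fun t => Real.smoothTransition.nonneg _) (fun t => (hζm j).deriv_nonneg) hK
      (fun x hx => ?_) hp hp0 hpK
    rcases (hV1 x).eq_or_lt with h | h
    · left
      have : Tendsto (fun y => (j : ℝ) * (V y + 1) - 1) (𝓝 x) (𝓝 (j * (V x + 1) - 1)) :=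
        ((hVc.tendsto x).add_const 1).const_mul _ |>.sub_const 1
      rw [← h] at this
      filter_upwards [this.eventually (gt_mem_nhds (show (j : ℝ) * (-1 + 1) - 1 < 0 by norm_num))]
        with y hy
      exact Real.smoothTransition.zero_of_nonpos hy.le
    · have hx' : x ∈ interphase V := abs_lt.2 ⟨h, hKV x hx⟩
      exact Or.inr ⟨hV2.contDiffAt (hopen.mem_nhds hx'), hΔ x hx'⟩
  obtain ⟨C, hC⟩ := hb K hK
  have hint : Integrable (fun x => C * ‖q x‖) := hqi.norm.const_mul C
  refine le_of_tendsto' (f := fun j => ∫ x, ζ j (V x) * inner ℝ (gradient V x) (q x))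
    (x := atTop) ?_ key
  refine tendsto_integral_of_dominated_convergence (fun x => C * ‖q x‖) (fun j => ?_) hint
    (fun j => ?_) (ae_of_all _ fun x => ?_)
  · exact ((hζc j).continuous.comp hVc).aestronglyMeasurable.mul
      ((measurable_gradient V).aestronglyMeasurable.inner hqi.1)
  · filter_upwards [hqK] with x hx
    by_cases hxK : x ∈ K
    · rw [norm_mul, Real.norm_eq_abs, abs_of_nonneg (Real.smoothTransition.nonneg _)]
      calc _ ≤ 1 * (‖gradient V x‖ * ‖q x‖) := by
            gcongr
            · exact Real.smoothTransition.le_one _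
            · exact norm_inner_le_norm _ _
        _ ≤ _ := by rw [one_mul]; gcongr; exact hC x hxK
    · simp [hx hxK]
  · rcases (hV1 x).eq_or_lt with h | h
    · have : gradient V x = 0 := by
        have hmin : IsLocalMin V x := Eventually.of_forall fun y => h ▸ hV1 y
        rw [gradient_def, hmin.fderiv_eq_zero, map_zero]
      simp [this]
    · have h0 : 0 < V x + 1 := by linarith
      refine tendsto_const_nhds.congr' ?_
      filter_upwards [(tendsto_natCast_atTop_atTop (R := ℝ)).eventually_ge_atTop (2 / (V x + 1))]
        with j hj
      rw [div_le_iff₀ h0] at hj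
      rw [show ζ j (V x) = 1 from Real.smoothTransition.one_of_one_le (by linarith), one_mul]

/-! ### Harmonicity in the interphase -/

/-- Lowering the minimizer to `max (u - t φ) V` does not change the interphase for small `t`, and
the excess over `u - t φ` costs nothing since `V` is weakly subharmonic. -/
lemma PerturbMin.integral_inner_nonpos (h : PerturbMin V W L Ω u g) (hu : ContinuousOn u Ω)
    (hVs : WeakSubharm V) {φ : E n → ℝ} (hφ : IsTestFunction Ω φ) (hφ0 : ∀ x, 0 ≤ φ x)
    (hφu : ∀ x ∈ tsupport φ, |u x| < 1) : ∫ x in Ω, inner ℝ (g x) (gradient φ x) ≤ 0 := by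
  have : IsFiniteMeasure (volume.restrict Ω) := ⟨by simpa using h.measure_lt_top⟩
  set K := tsupport φ with hKdef
  have hK : IsCompact K := hφ.2.1
  have hKm := hK.measurableSet
  have hmem := h.mem_of_continuousOn hu
  obtain ⟨δ, hδ, hδK⟩ : ∃ δ > 0, ∀ x ∈ K, |u x| ≤ 1 - δ := by
    rcases K.eq_empty_or_nonempty with hKe | hKe
    · exact ⟨1, one_pos, by simp [hKe]⟩
    · obtain ⟨x, hx, hmax⟩ := hK.exists_isMaxOn hKe ((hu.mono hφ.2.2).abs)
      exact ⟨1 - |u x|, by linarith [hφu x hx], fun y hy => by linarith [isMaxOn_iff.1 hmax y hy]⟩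
  obtain ⟨M, hM⟩ := hφ.1.continuous.bounded_above_of_compact_support hφ.2.1
  have hM0 : 0 ≤ M := (norm_nonneg _).trans (hM 0)
  have hVw := W12.of_lipschitzOn h.lipV h.isOpen h.isBounded
  have hφw : W12 Ω φ (gradient φ) := hφ.w12
  have hi := MemLp.integrable_inner_two h.w12.memLp_grad hφw.memLp_grad
  have hi2 := MemLp.integrable_norm_sq' hφw.memLp_grad
  set C := ∫ x in Ω, ‖gradient φ x‖ ^ 2 with hC
  have key : ∀ t : ℝ, 0 < t → t * M < δ →
      2 * t * (∫ x in Ω, inner ℝ (g x) (gradient φ x)) ≤ t ^ 2 * C := by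
    intro t ht htM
    have ha := h.w12.sub (hφw.const_mul t)
    have hpw := (hVw.sub ha).posPart h.isOpen
    set a : E n → E n := fun x => g x - t • gradient φ x with ha_def
    set p : E n → ℝ := fun x => max (V x - (u x - t * φ x)) 0 with hp_def
    set q : E n → E n := {x | 0 < V x - (u x - t * φ x)}.indicator
      (fun x => gradient V x - (g x - t • gradient φ x)) with hq_def
    have hp0 : ∀ x ∈ Ω, x ∉ K → p x = 0 := fun x hx hxK => by
      simp only [hp_def, image_eq_zero_of_notMem_tsupport hxK, mul_zero, sub_zero]
      exact max_eq_right (by linarith [(hmem x hx).1])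
    have hq0 : ∀ x ∈ Ω, x ∉ K → q x = 0 := fun x hx hxK => by
      refine Set.indicator_of_notMem (fun hlt => ?_) _
      simp only [Set.mem_ofPred_eq, image_eq_zero_of_notMem_tsupport hxK] at hlt
      linarith [(hmem x hx).1]
    have hw := ha.add hpw
    have hval : ∀ x, u x - t * φ x + p x = max (V x) (u x - t * φ x) := fun x => by
      rcases le_total (V x) (u x - t * φ x) with h' | h'
      · simp only [hp_def]; rw [max_eq_right h', max_eq_right (by linarith)]; ring
      · simp only [hp_def]; rw [max_eq_left h', max_eq_left (by linarith)]; ring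
    have hle := h.le _ _ K hw (by
      filter_upwards [ae_restrict_mem h.measurableSet] with x hx
      rw [hval]
      have htφ : 0 ≤ t * φ x := mul_nonneg ht.le (hφ0 x)
      exact ⟨le_max_left _ _, max_le ((hmem x hx).1.trans (hmem x hx).2)
        (by linarith [(hmem x hx).2])⟩) hK hφ.2.2 (by
      filter_upwards [ae_restrict_mem h.measurableSet] with x hx hxK
      rw [hp0 x hx hxK, image_eq_zero_of_notMem_tsupport hxK]; ring)
    have hVq : ∫ x in Ω, inner ℝ (gradient V x) (q x) ≤ 0 := by
      have hext := hpw.extend_zero h.isOpen hK hφ.2.2 (by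
        filter_upwards [ae_restrict_mem h.measurableSet] with x hx hxK
        exact hp0 x hx hxK)
      have := hVs _ _ K hK (fun x hx => (hmem x (hφ.2.2 hx)).1.trans_lt
        (abs_lt.1 (hφu x hx)).2) hext (fun x => Set.indicator_nonneg
          (fun x _ => le_max_right _ _) x) (fun x hx => Set.indicator_of_notMem hx _)
      rw [← setIntegral_eq_integral_of_forall_compl_eq_zero (s := Ω) (μ := volume)] at this
      · refine le_of_eq_of_le (setIntegral_congr_fun h.measurableSet fun x hx => ?_) this
        by_cases hxK : x ∈ K
        · simp only [Set.indicator_of_mem hxK]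
        · simp only [Set.indicator_of_notMem hxK, hq0 x hx hxK]
      · intro x hx
        rw [Set.indicator_of_notMem fun hxK => hx (hφ.2.2 hxK), inner_zero_right]
    have hiq := MemLp.integrable_inner_two hVw.memLp_grad hpw.memLp_grad
    have hid := integrable_dens h.w12.memLp.1 h.w12.memLp_grad
    have hi3 := hi.const_mul (-(2 * t))
    have hi4 := hi2.const_mul (t ^ 2)
    have hi5 := hiq.const_mul 2
    have hi6 : Integrable (fun x => -(2 * t) * inner ℝ (g x) (gradient φ x) +
      t ^ 2 * ‖gradient φ x‖ ^ 2) (volume.restrict Ω) := hi3.add hi4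
    have hi7 : Integrable (fun x => -(2 * t) * inner ℝ (g x) (gradient φ x) +
      t ^ 2 * ‖gradient φ x‖ ^ 2 + 2 * inner ℝ (gradient V x) (q x)) (volume.restrict Ω) :=
      hi6.add hi5
    have hub : ∫ x in Ω, dens (fun x => u x - t * φ x + p x) (fun x => a x + q x) x ≤
        ∫ x in Ω, (dens u g x + (-(2 * t) * inner ℝ (g x) (gradient φ x) +
      t ^ 2 * ‖gradient φ x‖ ^ 2 + 2 * inner ℝ (gradient V x) (q x))) := by
      refine setIntegral_mono_on (integrable_dens hw.memLp.1 hw.memLp_grad) (hid.add hi7)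
        h.measurableSet fun x hx => ?_
      have h1 : (interphase fun x => u x - t * φ x + p x).indicator (fun _ => (1 : ℝ)) x =
          (interphase u).indicator (fun _ => (1 : ℝ)) x := by
        by_cases hxK : x ∈ K
        · have hux := abs_le.1 (hδK x hxK)
          have htφ : 0 ≤ t * φ x := mul_nonneg ht.le (hφ0 x)
          have htφ' : t * φ x ≤ t * M := by
            gcongr; exact (le_abs_self _).trans (hM x)
          rw [Set.indicator_of_mem, Set.indicator_of_mem (show x ∈ interphase u from hφu x hxK)]
          change |u x - t * φ x + p x| < 1
          rw [hval, abs_lt]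
          exact ⟨lt_of_lt_of_le (by linarith) (le_max_right _ _),
            max_lt (by linarith [(hmem x hx).1]) (by linarith)⟩
        · refine indicator_interphase_congr ?_
          rw [hp0 x hx hxK, image_eq_zero_of_notMem_tsupport hxK]; ring
      have h2 : ‖a x + q x‖ ^ 2 ≤ ‖a x‖ ^ 2 + 2 * inner ℝ (gradient V x) (q x) := by
        by_cases hlt : 0 < V x - (u x - t * φ x)
        · have hqx : q x = gradient V x - a x := Set.indicator_of_mem (by exact hlt) _
          have : gradient V x = a x + q x := by rw [hqx]; abel
          rw [this, norm_add_sq_real, inner_add_left, real_inner_self_eq_norm_sq]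
          nlinarith [sq_nonneg ‖q x‖]
        · have hqx : q x = 0 := Set.indicator_of_notMem (by exact hlt) _
          simp [hqx]
      have h3 : ‖a x‖ ^ 2 = ‖g x‖ ^ 2 + -(2 * t) * inner ℝ (g x) (gradient φ x) +
          t ^ 2 * ‖gradient φ x‖ ^ 2 := by
        simp only [ha_def]
        rw [norm_sub_sq_real, real_inner_smul_right, norm_smul, mul_pow, Real.norm_eq_abs, sq_abs]
        ring
      simp only [dens, h1]
      linarith
    rw [integral_add hid hi7, integral_add hi6 hi5, integral_add hi3 hi4, integral_const_mul,
      integral_const_mul, integral_const_mul] at hub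
    linarith
  have hev : ∀ᶠ t in 𝓝[>] (0 : ℝ), ∫ x in Ω, inner ℝ (g x) (gradient φ x) ≤ t * (C / 2) := by
    filter_upwards [Ioo_mem_nhdsGT (show 0 < δ / (M + 1) by positivity)] with t ht
    have h1 := ht.2
    rw [lt_div_iff₀ (by positivity)] at h1
    have := key t ht.1 (by nlinarith [ht.1])
    nlinarith [ht.1]
  refine ge_of_tendsto ?_ hev
  have : Tendsto (fun t : ℝ => t * (C / 2)) (𝓝 0) (𝓝 (0 * (C / 2))) :=
    tendsto_id.mul_const _
  rw [zero_mul] at this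
  exact this.mono_left nhdsWithin_le_nhds

lemma gradient_neg (f : E n → ℝ) (x : E n) : gradient (fun y => -f y) x = -gradient f x := by
  rw [gradient_def, gradient_def, ← map_neg]
  congr 1
  exact fderiv_neg

/-- In its interphase, a continuous minimizer is weakly harmonic. -/
lemma PerturbMin.integral_inner_eq_zero (h : PerturbMin V W L Ω u g) (hu : ContinuousOn u Ω)
    (hVs : WeakSubharm V) (hWs : WeakSubharm fun x => -W x) {φ : E n → ℝ}
    (hφ : IsTestFunction Ω φ) (hφ0 : ∀ x, 0 ≤ φ x)
    (hφu : ∀ x ∈ tsupport φ, |u x| < 1) : ∫ x in Ω, inner ℝ (g x) (gradient φ x) = 0 := by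
  refine le_antisymm (h.integral_inner_nonpos hu hVs hφ hφ0 hφu) ?_
  have := h.neg.integral_inner_nonpos hu.neg hWs hφ hφ0 (by simpa using hφu)
  simp only [inner_neg_left, integral_neg] at this
  linarith

lemma PerturbMin.rep_eq_of_continuousOn (h : PerturbMin V W L Ω u g) (hu : ContinuousOn u Ω) :
    ∀ x ∈ Ω, rep Ω u x = u x := fun x hx =>
  le_antisymm (le_of_ae_le_of_continuousOn h.isOpen h.continuousOn_rep hu
    (h.rep_ae_eq.mono fun _ hx => hx.ge) x hx) (le_of_ae_le_of_continuousOn h.isOpen hu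
    h.continuousOn_rep (h.rep_ae_eq.mono fun _ hx => hx.le) x hx)

/-- The mean value property in the interphase. -/
lemma PerturbMin.mol_eq (h : PerturbMin V W L Ω u g) (hu : ContinuousOn u Ω)
    (hVs : WeakSubharm V) (hWs : WeakSubharm fun x => -W x) {x : E n} {s : ℝ} (hs : 0 < s)
    (hx : closedBall x s ⊆ Ω) (hxu : ∀ y ∈ closedBall x s, |u y| < 1) :
    ∫ y in Ω, ker s (x - y) * u y = u x := by
  obtain ⟨C, hC0, hC⟩ := h.exists_mol_sub_rep_le
  have hder : ∀ t ∈ Set.Ioc 0 s, ∫ y in Ω, inner ℝ (g y) (gradient (pot t x) y) = 0 := by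
    intro t ht
    have hsub := closedBall_subset_closedBall (x := x) ht.2
    have hsupp : tsupport (pot t x) ⊆ closedBall x t :=
      (isTestFunction_pot ht.1 subset_rfl).2.2
    have hneg : IsTestFunction Ω (fun y => -pot t x y) := by
      have h1 := isTestFunction_pot ht.1 (hsub.trans hx)
      have h2 : tsupport (fun y => -pot t x y) = tsupport (pot t x) := by
        simp [tsupport, Function.support_fun_neg]
      exact ⟨h1.1.neg, by rw [HasCompactSupport, h2]; exact h1.2.1, by rw [h2]; exact h1.2.2⟩
    have := h.integral_inner_eq_zero hu hVs hWs hneg (fun y => ?_) (fun y hy => ?_)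
    · simpa [gradient_neg, integral_neg] using this
    · have hk := kap_pos n
      have : 0 ≤ rho (1 - ‖y - x‖ ^ 2 / t ^ 2) := by
        rcases le_total (1 - ‖y - x‖ ^ 2 / t ^ 2) 0 with h' | h'
        · rw [rho_of_nonpos h']
        · exact intervalIntegral.integral_nonneg h' fun r _ => expNegInvGlue.nonneg _
      have ht0 := ht.1
      have h2 : 0 ≤ kap n / 2 * (t ^ n)⁻¹ * rho (1 - ‖y - x‖ ^ 2 / t ^ 2) := by positivity
      simp only [pot]
      linarith
    · have h2 : tsupport (fun y => -pot t x y) = tsupport (pot t x) := by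
        simp [tsupport, Function.support_fun_neg]
      rw [h2] at hy
      exact hxu y (hsub (hsupp hy))
  have hconst : ∀ t ∈ Set.Ioc 0 s, mol t (Ω.indicator u) x = mol s (Ω.indicator u) x := by
    intro t ht
    have := Convex.norm_image_sub_le_of_norm_hasDerivWithin_le (C := 0)
      (f := fun s => ∫ y in Ω, ker s (x - y) * u y)
      (f' := fun s => ∫ y in Ω, inner ℝ (g y) (gradient (pot s x) y)) (s := Set.Ioc 0 s)
      (fun t ht => (h.w12.hasDerivAt_mol h.integrableOn ht.1
        ((closedBall_subset_closedBall ht.2).trans hx)).hasDerivWithinAt)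
      (fun t ht => by rw [hder t ht, norm_zero])
      (convex_Ioc 0 s) ⟨hs, le_rfl⟩ ht
    rw [mol_indicator h.measurableSet, mol_indicator h.measurableSet]
    rw [zero_mul, norm_le_zero_iff, sub_eq_zero] at this
    exact this
  rw [← mol_indicator h.measurableSet, ← sub_eq_zero, ← abs_nonpos_iff]
  have hev : ∀ᶠ t in 𝓝[>] (0 : ℝ), |mol s (Ω.indicator u) x - u x| ≤ C * t := by
    filter_upwards [Ioo_mem_nhdsGT hs] with t ht
    rw [← hconst t ⟨ht.1, ht.2.le⟩, ← h.rep_eq_of_continuousOn hu x (hx (mem_closedBall_self hs.le))]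
    exact hC x s t hx ht.1 ht.2.le
  refine ge_of_tendsto ?_ hev
  have : Tendsto (fun t : ℝ => C * t) (𝓝 0) (𝓝 (C * 0)) := tendsto_id.const_mul _
  rw [mul_zero] at this
  exact this.mono_left nhdsWithin_le_nhds

/-! ### From slope bounds to Lipschitz bounds -/

/-- A function with values in `[-1, 1]` whose slope is at most `Λ` wherever `|f| < 1` grows at most
with speed `Λ`: at points with `f = 1` it cannot grow, and `max f (f a + ε)` never takes the value
`-1`. -/
lemma le_add_of_slope_le {f : ℝ → ℝ} {a b Λ : ℝ} (hab : a ≤ b) (hΛ : 0 ≤ Λ)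
    (hf : ContinuousOn f (Set.Icc a b)) (h1 : ∀ x ∈ Set.Icc a b, |f x| ≤ 1)
    (hs : ∀ x ∈ Set.Ico a b, |f x| < 1 → ∀ᶠ z in 𝓝[>] x, f z - f x ≤ Λ * (z - x)) :
    f b ≤ f a + Λ * (b - a) := by
  refine le_of_forall_pos_le_add fun ε hε => ?_
  set F : ℝ → ℝ := fun x => max (f x) (f a + ε) with hF
  have hFc : ContinuousOn F (Set.Icc a b) := (continuous_id.max continuous_const).comp_continuousOn hf
  have key := image_le_of_liminf_slope_right_le_deriv_boundary (f := F)
    (B := fun x => f a + ε + Λ * (x - a)) (B' := fun _ => Λ) hFc (by simp [hF, hε.le])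
    (by fun_prop) (fun x _ => by
      have : HasDerivAt (fun x => f a + ε + Λ * (x - a)) (Λ * 1) x :=
        (((hasDerivAt_id x).sub_const a).const_mul Λ).const_add _
      rw [mul_one] at this
      exact this.hasDerivWithinAt) (fun x hx r hr => ?_) (Set.right_mem_Icc.2 hab)
  · have := le_max_left (f b) (f a + ε)
    simp only [hF] at key
    linarith
  · have hxI := Set.Ico_subset_Icc_self hx
    have hz : ∀ᶠ z in 𝓝[>] x, z ∈ Set.Ioo x b := Ioo_mem_nhdsGT hx.2
    have hle : ∀ᶠ z in 𝓝[>] x, F z - F x ≤ Λ * (z - x) := by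
      rcases lt_or_ge (f x) (f a + ε) with h | h
      · have hcw : Tendsto f (𝓝[>] x) (𝓝 (f x)) :=
          (hf x hxI).mono_left (nhdsWithin_le_of_mem (mem_of_superset (Ioo_mem_nhdsGT hx.2)
            fun z hz => ⟨hx.1.trans hz.1.le, hz.2.le⟩))
        filter_upwards [hcw.eventually (gt_mem_nhds h), hz] with z h2 h3
        simp only [hF]
        rw [max_eq_right h2.le, max_eq_right h.le, sub_self]
        exact mul_nonneg hΛ (by linarith [h3.1])
      · have hm1 : -1 < f x := by
          have := (abs_le.1 (h1 a (Set.left_mem_Icc.2 hab))).1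
          linarith
        have hF1 : F x = f x := max_eq_left h
        rcases (abs_le.1 (h1 x hxI)).2.lt_or_eq with h2 | h2
        · filter_upwards [hs x hx (abs_lt.2 ⟨hm1, h2⟩), hz] with z h3 h4
          have : 0 ≤ Λ * (z - x) := mul_nonneg hΛ (by linarith [h4.1])
          rw [hF1, sub_le_iff_le_add]
          exact max_le (by linarith) (by linarith)
        · filter_upwards [hz] with z h4
          have : 0 ≤ Λ * (z - x) := mul_nonneg hΛ (by linarith [h4.1])
          have h5 := (abs_le.1 (h1 z ⟨hx.1.trans h4.1.le, h4.2.le⟩)).2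
          rw [hF1, sub_le_iff_le_add]
          exact max_le (by linarith) (by linarith)
    refine Eventually.frequently ?_
    filter_upwards [hle, hz] with z h2 h3
    have h0 : 0 < z - x := by linarith [h3.1]
    rw [slope_def_field, div_lt_iff₀ h0]
    nlinarith

/-- A slope bound on the set `{|u| < 1}` alone is a Lipschitz bound, by restriction to segments. -/
lemma lipschitzOnWith_of_slope_le {u : E n → ℝ} {S : Set (E n)} (hS : Convex ℝ S) {Λ : NNReal}
    (hu : ContinuousOn u S) (h1 : ∀ x ∈ S, |u x| ≤ 1)
    (hs : ∀ x ∈ S, |u x| < 1 → ∀ᶠ z in 𝓝 x, |u z - u x| ≤ Λ * ‖z - x‖) :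
    LipschitzOnWith Λ u S := by
  have key : ∀ x ∈ S, ∀ y ∈ S, u y ≤ u x + Λ * ‖y - x‖ := by
    intro x hx y hy
    have hmem : ∀ t ∈ Set.Icc (0 : ℝ) 1, AffineMap.lineMap x y t ∈ S := fun t ht =>
      hS.lineMap_mem hx hy ht
    have := le_add_of_slope_le (f := fun t : ℝ => u (AffineMap.lineMap x y t)) (a := 0) (b := 1)
      (Λ := Λ * ‖y - x‖) zero_le_one (by positivity)
      (hu.comp AffineMap.lineMap_continuous.continuousOn hmem) (fun t ht => h1 _ (hmem t ht))
      (fun t ht hlt => ?_)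
    · simpa using this
    · have h2 := hs _ (hmem t ⟨ht.1, ht.2.le⟩) hlt
      have h3 : Tendsto (fun t : ℝ => (AffineMap.lineMap x y t : E n)) (𝓝[>] t)
        (𝓝 (AffineMap.lineMap x y t)) := (AffineMap.lineMap_continuous.tendsto t).mono_left
          nhdsWithin_le_nhds
      filter_upwards [h3.eventually h2, self_mem_nhdsWithin] with z hz hzt
      refine (le_abs_self _).trans (hz.trans_eq ?_)
      have h4 : (AffineMap.lineMap x y z : E n) - AffineMap.lineMap x y t = (z - t) • (y - x) := by
        simp only [AffineMap.lineMap_apply, vsub_eq_sub, vadd_eq_add]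
        module
      rw [h4, norm_smul, Real.norm_eq_abs, abs_of_pos (sub_pos.2 hzt)]
      ring
  refine LipschitzOnWith.of_dist_le_mul fun x hx y hy => ?_
  rw [Real.dist_eq, abs_le, dist_eq_norm]
  have h2 := key x hx y hy
  have h3 := key y hy x hx
  rw [norm_sub_rev] at h2
  constructor <;> linarith

/-! ### Functions with the mean value property -/

/-- The mean value property in the ball of radius `d` about `x₀`, for the weighted averages given
by the mollifier. -/
structure MeanValue (v : E n → ℝ) (x₀ : E n) (d : ℝ) : Prop where
  integrableOn : IntegrableOn v (ball x₀ d)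
  nonneg : ∀ x ∈ ball x₀ d, 0 ≤ v x
  eq : ∀ x s, 0 < s → closedBall x s ⊆ ball x₀ d → v x = ∫ y in ball x₀ d, ker s (x - y) * v y

lemma integrableOn_ker_mul {v : E n → ℝ} {S : Set (E n)} (hv : IntegrableOn v S) {s : ℝ}
    (hs : 0 < s) (x : E n) : IntegrableOn (fun y => ker s (x - y) * v y) S := by
  refine hv.bdd_mul (c := kap n * (s ^ (n + 1))⁻¹ * expNegInvGlue 1)
    ((ker_contDiff n s).continuous.comp
      (continuous_const.sub continuous_id)).aestronglyMeasurable (ae_of_all _ fun y => ?_)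
  rw [Real.norm_eq_abs, abs_of_nonneg (ker_nonneg hs _)]
  exact ker_le hs _

/-- Harnack's inequality, by comparing the mollifiers of scale `d / 8` at `x₀` and `d / 2` at
`x`. -/
lemma MeanValue.harnack {v : E n → ℝ} {x₀ : E n} {d : ℝ} (h : MeanValue v x₀ d) (hd : 0 < d)
    {x : E n} (hx : ‖x - x₀‖ ≤ d / 4) :
    ((4 : ℝ) ^ (n + 1))⁻¹ * (expNegInvGlue (7 / 16) / expNegInvGlue 1) * v x₀ ≤ v x := by
  have hk := kap_pos n
  have he := expNegInvGlue.pos_of_pos one_pos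
  have he' := expNegInvGlue.pos_of_pos (show (0 : ℝ) < 7 / 16 by norm_num)
  rw [h.eq x₀ (d / 8) (by positivity) (closedBall_subset_ball (by linarith)),
    h.eq x (d / 2) (by positivity) (fun y hy => ?_), ← integral_const_mul]
  · refine setIntegral_mono_on ((integrableOn_ker_mul h.integrableOn (by positivity) _).const_mul _)
      (integrableOn_ker_mul h.integrableOn (by positivity) _) measurableSet_ball fun y hy => ?_
    rw [← mul_assoc]
    refine mul_le_mul_of_nonneg_right ?_ (h.nonneg y hy)
    rcases le_total (d / 8) ‖x₀ - y‖ with h1 | h1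
    · rw [ker_eq_zero (by positivity) h1, mul_zero]
      exact ker_nonneg (by positivity) _
    · have h2 : ‖x - y‖ ≤ 3 / 4 * (d / 2) := by
        have : x - y = (x - x₀) + (x₀ - y) := by abel
        rw [this]
        exact (norm_add_le _ _).trans (by linarith)
      refine le_trans ?_ (le_ker (by positivity) h2)
      calc _ ≤ ((4 : ℝ) ^ (n + 1))⁻¹ * (expNegInvGlue (7 / 16) / expNegInvGlue 1) *
            (kap n * ((d / 8) ^ (n + 1))⁻¹ * expNegInvGlue 1) := by
            gcongr; exact ker_le (by positivity) _
        _ = kap n * ((d / 2) ^ (n + 1))⁻¹ * expNegInvGlue (7 / 16) := by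
            rw [show d / 2 = 4 * (d / 8) by ring, mul_pow]
            field_simp
        _ = _ := by norm_num
  · rw [mem_closedBall, dist_eq_norm] at hy
    rw [mem_ball, dist_eq_norm]
    have : y - x₀ = (y - x) + (x - x₀) := by abel
    rw [this]
    exact (norm_add_le _ _).trans_lt (by linarith)

/-- The slope of a nonnegative function with the mean value property is controlled by its value,
by the Lipschitz bound for the mollifier. -/
lemma MeanValue.exists_slope_le (n : ℕ) : ∃ C : ℝ, 0 < C ∧ ∀ {v : E n → ℝ} {x₀ : E n} {d : ℝ},
    MeanValue v x₀ d → 0 < d → ∀ x, ‖x - x₀‖ ≤ d / 4 →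
      |v x - v x₀| ≤ C * (v x₀ / d) * ‖x - x₀‖ := by
  obtain ⟨A, hA, hAk⟩ := exists_ker_lipschitz n
  have hk := kap_pos n
  have he := expNegInvGlue.pos_of_pos (show (0 : ℝ) < 5 / 9 by norm_num)
  refine ⟨4 * A * 3 ^ (n + 1) / (kap n * expNegInvGlue (5 / 9)), by positivity,
    fun {v x₀ d} h hd x hx => ?_⟩
  set C := 4 * A * 3 ^ (n + 1) / (kap n * expNegInvGlue (5 / 9)) with hC
  have hi := fun s (hs : 0 < s) x => integrableOn_ker_mul (s := s) h.integrableOn hs x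
  have e1 := h.eq x₀ (3 * d / 4) (by positivity) (closedBall_subset_ball (by linarith))
  have e2 := h.eq x₀ (d / 4) (by positivity) (closedBall_subset_ball (by linarith))
  have e3 := h.eq x (d / 4) (by positivity) (fun y hy => by
    rw [mem_closedBall, dist_eq_norm] at hy
    rw [mem_ball, dist_eq_norm]
    have : y - x₀ = (y - x) + (x - x₀) := by abel
    rw [this]
    exact (norm_add_le _ _).trans_lt (by linarith))
  have e4 : |v x - v x₀| ≤ ∫ y in ball x₀ d, C / d * ‖x - x₀‖ * (ker (3 * d / 4) (x₀ - y) * v y) := by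
    rw [e3, e2, ← integral_sub (hi _ (by positivity) _) (hi _ (by positivity) _)]
    refine (abs_integral_le_integral_abs).trans ?_
    refine setIntegral_mono_on (((hi _ (by positivity) _).sub (hi _ (by positivity) _)).abs)
      ((hi _ (by positivity) _).const_mul _) measurableSet_ball fun y hy => ?_
    have hv := h.nonneg y hy
    rw [← sub_mul, abs_mul, abs_of_nonneg hv, ← mul_assoc]
    refine mul_le_mul_of_nonneg_right ?_ hv
    rcases le_total (d / 2) ‖x₀ - y‖ with h1 | h1
    · have h2 : d / 4 ≤ ‖x - y‖ := by
        have : x₀ - y = (x - y) - (x - x₀) := by abel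
        rw [this] at h1
        linarith [norm_sub_le (x - y) (x - x₀)]
      rw [ker_eq_zero (by positivity) h2, ker_eq_zero (by positivity) (by linarith), sub_zero,
        abs_zero]
      exact mul_nonneg (by positivity) (ker_nonneg (by positivity) _)
    · have h2 : ‖x₀ - y‖ ≤ 2 / 3 * (3 * d / 4) := by linarith
      have h3 := le_ker (by positivity : (0 : ℝ) < 3 * d / 4) h2
      have h4 := hAk (d / 4) (by positivity) (x - y) (x₀ - y)
      rw [sub_sub_sub_cancel_right] at h4
      refine h4.trans ?_
      calc A * ((d / 4) ^ (n + 1))⁻¹ * (d / 4)⁻¹ * ‖x - x₀‖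
          = C / d * ‖x - x₀‖ * (kap n * ((3 * d / 4) ^ (n + 1))⁻¹ * expNegInvGlue (5 / 9)) := by
            rw [hC, show 3 * d / 4 = 3 * (d / 4) by ring, mul_pow]
            field_simp
        _ ≤ _ := by
            refine mul_le_mul_of_nonneg_left ?_ (by positivity)
            norm_num at h3 ⊢
            exact h3
  rw [integral_const_mul, ← e1] at e4
  refine e4.trans_eq ?_
  ring

/-! ### The barrier -/

/-- A radial barrier in the annulus `d / 4 < |x - x₀| < 3 d / 2`: subharmonic, equal to `m` on the
inner and to `0` on the outer sphere, and with gradient comparable to `m / d`. -/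
lemma exists_barrier (n : ℕ) : ∃ γ : ℝ, 0 < γ ∧ ∀ (x₀ : E n) (d m : ℝ), 0 < d → 0 < m →
    ∃ b : E n → ℝ, ContDiff ℝ ∞ b ∧ (∀ x, m ≤ b x → ‖x - x₀‖ ≤ d / 4) ∧
      (∀ x, 0 < b x ↔ ‖x - x₀‖ < 3 * d / 2) ∧ (∀ x, d / 4 ≤ ‖x - x₀‖ → 0 ≤ (Δ b) x) ∧
      ∀ x, d / 4 ≤ ‖x - x₀‖ → ‖x - x₀‖ ≤ 3 * d / 2 → γ * (m / d) ≤ ‖gradient b x‖ := by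
  set α : ℝ := 8 * (n + 1) with hα
  have hα0 : 0 < α := by positivity
  set e0 := Real.exp (-(α / 16)) with he0
  set e1 := Real.exp (-(9 * α / 4)) with he1
  have hlt : e1 < e0 := Real.exp_lt_exp.2 (by linarith)
  have he : 0 < e0 - e1 := sub_pos.2 hlt
  have he1p : 0 < e1 := Real.exp_pos _
  refine ⟨α / 2 * e1 / (e0 - e1), by positivity, fun x₀ d m hd hm => ?_⟩
  set A := m / (e0 - e1) with hA
  have hA0 : 0 < A := by positivity
  have hAm : A * (e0 - e1) = m := by rw [hA]; field_simp
  set P : E n → ℝ := fun x => -(α * (‖x - x₀‖ ^ 2 / d ^ 2)) with hP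
  have hPc : ContDiff ℝ ∞ P := (contDiff_const.mul
    (((contDiff_norm_sq ℝ).comp (contDiff_id.sub contDiff_const)).div_const _)).neg
  have hPd : ∀ y, HasFDerivAt P ((-(2 * α / d ^ 2)) • innerSL ℝ (y - x₀)) y := fun y => by
    have h1 := ((hasFDerivAt_profile d x₀ y).sub_const 1).const_mul α
    refine (h1.congr_fderiv ?_).congr_of_eventuallyEq
      (Eventually.of_forall fun y => by simp only [hP]; ring)
    ext e; simp; ring
  set b : E n → ℝ := fun x => A * (Real.exp (P x) - e1) with hb
  have hbc : ContDiff ℝ ∞ b := contDiff_const.mul (hPc.exp.sub contDiff_const)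
  have hbd : ∀ y, HasFDerivAt b ((-(A * (2 * α / d ^ 2) * Real.exp (P y))) • innerSL ℝ (y - x₀)) y :=
    fun y => by
    refine (((hPd y).exp.sub_const e1).const_mul A).congr_fderiv ?_
    ext e; simp; ring
  have hPm : ∀ x {t : ℝ}, 0 ≤ t → (‖x - x₀‖ ≤ t * d ↔ -(α * t ^ 2) ≤ P x) := fun x t ht => by
    simp only [hP, neg_le_neg_iff]
    rw [mul_le_mul_iff_right₀ hα0, div_le_iff₀ (by positivity), ← mul_pow]
    exact (pow_le_pow_iff_left₀ (norm_nonneg _) (by positivity) two_ne_zero).symm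
  have hPm' : ∀ x {t : ℝ}, 0 ≤ t → (‖x - x₀‖ < t * d ↔ -(α * t ^ 2) < P x) := fun x t ht => by
    simp only [hP, neg_lt_neg_iff]
    rw [mul_lt_mul_iff_right₀ hα0, div_lt_iff₀ (by positivity), ← mul_pow]
    exact (pow_lt_pow_iff_left₀ (norm_nonneg _) (by positivity) two_ne_zero).symm
  refine ⟨b, hbc, fun x hx => ?_, fun x => ?_, fun x hx => ?_, fun x hx hx' => ?_⟩
  · rw [← hAm] at hx
    have h1 := le_of_mul_le_mul_left hx hA0
    have h2 : -(α / 16) ≤ P x := Real.exp_le_exp.1 (by linarith)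
    have := (hPm x (t := 1 / 4) (by norm_num)).2 (by norm_num; linarith)
    linarith
  · rw [show 3 * d / 2 = 3 / 2 * d by ring, hPm' x (by norm_num)]
    simp only [hb]
    rw [mul_pos_iff_of_pos_left hA0, sub_pos, he1, Real.exp_lt_exp]
    norm_num
    ring_nf
  · set B := EuclideanSpace.basisFun (Fin (n + 1)) ℝ with hB
    rw [laplacian_eq_sum_fderiv (contDiff_infty.1 hbc 2).contDiffAt]
    have h1 : ∀ i y, fderiv ℝ b y (B i) =
        -(A * (2 * α / d ^ 2)) * (Real.exp (P y) * inner ℝ (B i) (y - x₀)) := fun i y => by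
      rw [(hbd y).fderiv]
      simp only [smul_apply, innerSL_apply_apply, smul_eq_mul]
      rw [real_inner_comm (B i)]
      ring
    have h2 : ∀ i, fderiv ℝ (fun y => fderiv ℝ b y (B i)) x (B i) =
        A * (2 * α / d ^ 2) * Real.exp (P x) *
          ((2 * α / d ^ 2) * (inner ℝ (x - x₀) (B i)) ^ 2 - 1) := fun i => by
      simp_rw [h1]
      have h3 : HasFDerivAt (fun y : E n => (inner ℝ (B i) (y - x₀) : ℝ)) (innerSL ℝ (B i)) x :=
        (((innerSL ℝ (B i)).hasFDerivAt (x := x - x₀)).comp x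
          ((hasFDerivAt_id x).sub_const x₀)).congr_fderiv (by ext; simp)
      have h4 := (((hPd x).exp).mul h3).const_mul (-(A * (2 * α / d ^ 2)))
      have h5 : HasFDerivAt (fun y => -(A * (2 * α / d ^ 2)) *
        (Real.exp (P y) * inner ℝ (B i) (y - x₀))) _ x := h4
      rw [h5.fderiv]
      have hbi : ‖B i‖ = 1 := B.orthonormal.norm_eq_one i
      simp only [add_apply, smul_apply, innerSL_apply_apply, smul_eq_mul,
        real_inner_self_eq_norm_sq, hbi]
      rw [real_inner_comm (B i) (x - x₀)]
      ring
    simp_rw [← hB, h2]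
    rw [← Finset.mul_sum, Finset.sum_sub_distrib, ← Finset.mul_sum, B.sum_sq_inner_left]
    refine mul_nonneg (by positivity) ?_
    simp only [Finset.sum_const, Finset.card_univ, Fintype.card_fin, nsmul_eq_mul, mul_one]
    have h6 : (d / 4) ^ 2 ≤ ‖x - x₀‖ ^ 2 := by gcongr
    have h7 : (2 * α / d ^ 2) * (d / 4) ^ 2 ≤ (2 * α / d ^ 2) * ‖x - x₀‖ ^ 2 := by gcongr
    have h8 : (2 * α / d ^ 2) * (d / 4) ^ 2 = n + 1 := by
      rw [hα]; field_simp; norm_num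
    push_cast
    linarith
  · have h1 : gradient b x = (-(A * (2 * α / d ^ 2) * Real.exp (P x))) • (x - x₀) := by
      refine ext_inner_right ℝ fun e => ?_
      rw [← fderiv_eq_inner_gradient, (hbd x).fderiv, real_inner_smul_left]
      simp only [smul_apply, innerSL_apply_apply, smul_eq_mul]
    have h2 : e1 ≤ Real.exp (P x) := by
      rw [he1, Real.exp_le_exp]
      have := (hPm x (t := 3 / 2) (by norm_num)).1 (by linarith)
      norm_num at this
      linarith
    rw [h1, norm_smul, norm_neg, Real.norm_eq_abs, abs_of_nonneg (by positivity)]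
    calc α / 2 * e1 / (e0 - e1) * (m / d) = A * (2 * α / d ^ 2) * e1 * (d / 4) := by
          rw [hA]; field_simp; ring
      _ ≤ _ := by gcongr

/-! ### Lipschitz regularity of minimizers -/

lemma W12.of_contDiff_of_isBounded (hΩ : Bornology.IsBounded Ω) {b : E n → ℝ}
    (hb : ContDiff ℝ ∞ b) : W12 Ω b (gradient b) := by
  obtain ⟨χ, hχ, -, hχ1⟩ := exists_cutoff (K := closure Ω) (U := Set.univ)
    hΩ.isCompact_closure isOpen_univ (Set.subset_univ _)
  rw [eventually_nhdsSet_iff_forall] at hχ1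
  have h1 : W12 Ω (fun x => χ x * b x) (gradient fun x => χ x * b x) :=
    (IsTestFunction.mul_of_tsupport hb hχ).w12
  -- measurability of `Ω` is not needed: the two functions agree near every point of `closure Ω`
  have h2 : ∀ x ∈ closure Ω, (fun x => χ x * b x) =ᶠ[𝓝 x] b := fun x hx => by
    filter_upwards [hχ1 x hx] with y hy
    rw [hy, one_mul]
  have hae : ∀ᵐ x ∂(volume.restrict Ω), x ∈ closure Ω :=
    ae_restrict_of_ae_restrict_of_subset subset_closure
      (ae_restrict_mem isClosed_closure.measurableSet)
  refine h1.congr ?_ ?_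
  · filter_upwards [hae] with x hx using (h2 x hx).self_of_nhds
  · filter_upwards [hae] with x hx
    rw [gradient_def, gradient_def, (h2 x hx).fderiv_eq]

/-- Testing the gradient with the last coordinate function, cut off outside of the support of `p`,
shows that `∫ p = 0`. -/
lemma W12.eq_zero_of_grad_eq_zero {p : E n → ℝ} {q : E n → E n} (hp : W12 Set.univ p q)
    (hp0 : ∀ x, 0 ≤ p x) {K : Set (E n)} (hK : IsCompact K) (hpK : ∀ x ∉ K, p x = 0)
    (hq : ∀ᵐ x, q x = 0) : ∀ᵐ x, p x = 0 := by
  obtain ⟨χ, hχ, -, hχ1⟩ := exists_cutoff (U := Set.univ) hK isOpen_univ (Set.subset_univ _)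
  rw [eventually_nhdsSet_iff_forall] at hχ1
  set e := eLast n with he
  have hee : inner ℝ e e = (1 : ℝ) := by
    rw [real_inner_self_eq_norm_sq, he, eLast]; simp
  set φ : E n → ℝ := fun x => χ x * inner ℝ e x with hφ
  have hφt : IsTestFunction Set.univ φ :=
    IsTestFunction.mul_of_tsupport (contDiff_const.inner ℝ contDiff_id) hχ
  have h1 := hp.integral_mul_fderiv hφt e
  have h2 : ∫ x, φ x * inner ℝ (q x) e = 0 := by
    refine integral_eq_zero_of_ae ?_
    filter_upwards [hq] with x hx
    simp [hx]
  rw [Measure.restrict_univ, h2, neg_zero] at h1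
  have h3 : ∫ x, p x = 0 := by
    rw [← h1]
    congr 1
    funext x
    by_cases hx : x ∈ K
    · have h4 : φ =ᶠ[𝓝 x] fun y => innerSL ℝ e y := by
        filter_upwards [hχ1 x hx] with y hy
        simp [hφ, hy]
      rw [h4.fderiv_eq, ContinuousLinearMap.fderiv, innerSL_apply_apply, hee, mul_one]
    · rw [hpK x hx, zero_mul]
  have hpi := integrable_of_memLp_two_of_compact hp.memLp hK (ae_of_all _ hpK)
  exact (integral_eq_zero_iff_of_nonneg hp0 hpi).1 h3

lemma PerturbMin.meanValue (h : PerturbMin V W L Ω u g) (hu : ContinuousOn u Ω)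
    (hVs : WeakSubharm V) (hWs : WeakSubharm fun x => -W x) {x₀ : E n} {d : ℝ}
    (hd : ball x₀ d ⊆ Ω) (hlt : ∀ x ∈ ball x₀ d, |u x| < 1) :
    MeanValue (fun x => 1 - u x) x₀ d := by
  have hui : IntegrableOn u (ball x₀ d) := h.integrableOn.mono_set hd
  have h1i : IntegrableOn (fun _ : E n => (1 : ℝ)) (ball x₀ d) :=
    integrableOn_const (measure_ball_lt_top).ne
  refine ⟨h1i.sub hui, fun x hx => by linarith [(abs_lt.1 (hlt x hx)).2], fun x s hs hx => ?_⟩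
  have e1 := h.mol_eq hu hVs hWs hs (hx.trans hd) (fun y hy => hlt y (hx hy))
  have hz : ∀ y ∉ ball x₀ d, ker s (x - y) = 0 := fun y hy => by
    refine ker_eq_zero hs ?_
    by_contra! hc
    exact hy (hx (by rw [mem_closedBall, dist_comm, dist_eq_norm]; exact hc.le))
  have e2 : ∫ y in ball x₀ d, ker s (x - y) * u y = u x := by
    rw [← e1]
    refine (setIntegral_eq_of_subset_of_forall_sdiff_eq_zero h.measurableSet hd fun y hy => ?_).symm
    rw [hz y hy.2, zero_mul]
  have e3 : ∫ y in ball x₀ d, ker s (x - y) * 1 = 1 := by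
    simp_rw [mul_one]
    rw [setIntegral_eq_integral_of_forall_compl_eq_zero hz, integral_ker_sub hs]
  have e4 := integral_sub (integrableOn_ker_mul h1i hs x) (integrableOn_ker_mul hui hs x)
  rw [e2, e3] at e4
  rw [← e4]
  congr 1
  funext y
  ring

/-- Nondegeneracy at the free boundary: if `|u| < 1` in the ball of radius `d` about `x₀` and
`u = 1` at a point of its boundary, then `1 - u` is at most of order `d` at the centre. Otherwise
Harnack's inequality and the barrier give a competitor `min u (1 - b)` that lies above `V`, since
`V` is Lipschitz, and whose gain in Dirichlet energy exceeds the cost `|{u = 1, b > 0}|` of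
enlarging the interphase, as `|∇b| ≥ 2`. -/
lemma PerturbMin.exists_one_sub_le (n : ℕ) : ∃ M : ℝ, 0 < M ∧
    ∀ {Ω : Set (E n)} {V W u : E n → ℝ} {g : E n → E n} {L : NNReal}, PerturbMin V W L Ω u g →
    ContinuousOn u Ω → WeakSubharm V → WeakSubharm (fun x => -W x) →
    ∀ (x₀ y : E n) (d : ℝ), 0 < d → ball x₀ (2 * d) ⊆ Ω → (∀ x ∈ ball x₀ d, |u x| < 1) →
      dist y x₀ = d → u y = 1 → 1 - u x₀ ≤ (3 * L + M) * d := by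
  obtain ⟨γ, hγ, hbar⟩ := exists_barrier n
  set c := min (1 / 2) (((4 : ℝ) ^ (n + 1))⁻¹ * (expNegInvGlue (7 / 16) / expNegInvGlue 1)) with hc
  have hc0 : 0 < c := by
    have he := expNegInvGlue.pos_of_pos one_pos
    have he' := expNegInvGlue.pos_of_pos (show (0 : ℝ) < 7 / 16 by norm_num)
    exact lt_min (by norm_num) (by positivity)
  have hc2 : c ≤ 1 / 2 := min_le_left _ _
  refine ⟨2 / (γ * c), by positivity, ?_⟩
  intro Ω V W u g L h hu hVs hWs x₀ y d hd hsub hlt hy huy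
  by_contra! hcon
  have : IsFiniteMeasure (volume.restrict Ω) := ⟨by simpa using h.measure_lt_top⟩
  have hmem := h.mem_of_continuousOn hu
  have hx₀ : x₀ ∈ Ω := hsub (mem_ball_self (by positivity))
  have hu1 : ∀ x ∈ Ω, u x ≤ 1 := fun x hx => (hmem x hx).2.trans (abs_le.1 (h.abs_W x)).2
  have hu2 := abs_lt.1 (hlt x₀ (mem_ball_self hd))
  set v₀ := 1 - u x₀ with hv₀
  have hv₀0 : 0 < v₀ := by linarith [hu2.2]
  have hMd : 0 < 2 / (γ * c) * d := by positivity
  have hLd : 3 * L * d ≤ v₀ := by nlinarith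
  have hγv : 2 ≤ γ * (c * v₀ / d) := by
    have h0 : 0 ≤ (L : ℝ) * d := by positivity
    have h1 : 2 / (γ * c) * d ≤ v₀ := by nlinarith
    rw [div_mul_eq_mul_div, div_le_iff₀ (by positivity)] at h1
    rw [← mul_div_assoc, le_div_iff₀ hd]
    linarith
  set m := c * v₀ with hm
  have hm0 : 0 < m := by positivity
  have hmv : m ≤ v₀ / 2 := by nlinarith
  obtain ⟨b, hbc, hbm, hbpos, hbΔ, hbγ⟩ := hbar x₀ d m hd hm0
  have hmvu : ∀ x, ‖x - x₀‖ ≤ d / 4 → m ≤ 1 - u x := fun x hx => by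
    refine le_trans ?_ ((h.meanValue hu hVs hWs ((ball_subset_ball (by linarith)).trans hsub)
      hlt).harnack hd hx)
    exact mul_le_mul_of_nonneg_right (min_le_right _ _) hv₀0.le
  -- the competitor is `u - p`
  have hbw : W12 Ω b (gradient b) := W12.of_contDiff_of_isBounded h.isBounded hbc
  have hconst : ∀ a : ℝ, W12 Ω (fun _ => a) (fun _ => (0 : E n)) := fun a =>
    (W12.of_contDiff_of_isBounded h.isBounded (contDiff_const (c := a))).congr (ae_eq_refl _)
      (ae_of_all _ fun x => gradient_eq_zero_of_eventually_const (c := a) (by simp))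
  have hminw := (hconst m).min hbw h.isOpen
  have hpw := ((hminw.add h.w12).sub (hconst 1)).posPart h.isOpen
  set p : E n → ℝ := fun x => max (min m (b x) + u x - 1) 0 with hp
  set q : E n → E n := {x | 0 < min m (b x) + u x - 1}.indicator fun x =>
    (open Classical in if b x < m then gradient b x else 0) + g x - 0 with hq
  have hpos : ∀ x ∈ Ω, 0 < min m (b x) + u x - 1 → b x < m ∧ 0 < b x ∧
      x ∈ closedBall x₀ (3 * d / 2) \ ball x₀ (d / 4) := by
    intro x hx hlt'
    have hux := hu1 x hx
    have h1 : 0 < min m (b x) := by linarith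
    have h2 : 0 < b x := h1.trans_le (min_le_right _ _)
    have h3 : ¬ ‖x - x₀‖ ≤ d / 4 := fun hle => by
      linarith [hmvu x hle, min_le_left m (b x)]
    refine ⟨lt_of_not_ge fun hge => h3 (hbm x hge), h2, ?_, ?_⟩
    · rw [mem_closedBall, dist_eq_norm]; exact ((hbpos x).1 h2).le
    · rw [mem_ball, dist_eq_norm]; exact fun hle => h3 hle.le
  have hqpos : ∀ x ∈ Ω, 0 < min m (b x) + u x - 1 → q x = gradient b x + g x := by
    intro x hx hlt'
    have h1 : q x = _ := Set.indicator_of_mem (by exact hlt') _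
    rw [h1, if_pos (hpos x hx hlt').1, sub_zero]
  have hqneg : ∀ x, ¬ 0 < min m (b x) + u x - 1 → q x = 0 := fun x hx =>
    Set.indicator_of_notMem (by exact hx) _
  set K := closedBall x₀ (3 * d / 2) \ ball x₀ (d / 4) with hKdef
  have hK : IsCompact K := (isCompact_closedBall _ _).diff isOpen_ball
  have hKΩ : K ⊆ Ω := fun x hx => hsub (closedBall_subset_ball (by linarith) hx.1)
  have hpK : ∀ x ∈ Ω, x ∉ K → p x = 0 := fun x hx hxK =>
    max_eq_right (not_lt.1 fun hlt' => hxK (hpos x hx hlt').2.2)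
  have hext := hpw.extend_zero h.isOpen hK hKΩ (by
    filter_upwards [ae_restrict_mem h.measurableSet] with x hx hxK using hpK x hx hxK)
  have hext0 : ∀ x, 0 ≤ K.indicator p x := fun x =>
    Set.indicator_nonneg (fun x _ => le_max_right _ _) x
  have hextK : ∀ x ∉ K, K.indicator p x = 0 := fun x hx => Set.indicator_of_notMem hx _
  -- `b` is subharmonic in the annulus that contains the support of `p`
  have hbq : ∫ x in Ω, inner ℝ (gradient b x) (q x) ≤ 0 := by
    have := integral_comp_mul_inner_gradient_nonpos (w := b) (ζ := fun _ => 1) contDiff_const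
      (fun _ => zero_le_one) (fun t => by simp) hK (fun x hx => Or.inr
        ⟨(contDiff_infty.1 hbc 2).contDiffAt, hbΔ x (by
          have := hx.2
          rw [mem_ball, dist_eq_norm, not_lt] at this
          exact this)⟩) hext hext0 hextK
    simp only [one_mul] at this
    rw [← setIntegral_eq_integral_of_forall_compl_eq_zero (s := Ω) (μ := volume)] at this
    · refine le_of_eq_of_le (setIntegral_congr_fun h.measurableSet fun x hx => ?_) this
      by_cases hxK : x ∈ K
      · simp only [Set.indicator_of_mem hxK]
      · simp only [Set.indicator_of_notMem hxK,
          hqneg x fun hlt' => hxK (hpos x hx hlt').2.2]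
    · intro x hx
      rw [Set.indicator_of_notMem fun hxK => hx (hKΩ hxK), inner_zero_right]
  have hw := h.w12.sub hpw
  have hle := h.le _ _ K hw (by
    filter_upwards [ae_restrict_mem h.measurableSet] with x hx
    have hp0 : 0 ≤ p x := le_max_right _ _
    refine ⟨?_, by linarith [(hmem x hx).2]⟩
    by_cases hlt' : 0 < min m (b x) + u x - 1
    · have h1 : p x = min m (b x) + u x - 1 := max_eq_left hlt'.le
      have h2 := (hpos x hx hlt').2.2.1
      have h3 := h.lipV.dist_le_mul x hx x₀ hx₀
      rw [mem_closedBall] at h2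
      rw [Real.dist_eq] at h3
      have h4 : (L : ℝ) * dist x x₀ ≤ L * (3 * d / 2) := by gcongr
      linarith [min_le_left m (b x), le_abs_self (V x - V x₀), (hmem x₀ hx₀).1]
    · have h1 : p x = 0 := max_eq_right (not_lt.1 hlt')
      rw [h1]; linarith [(hmem x hx).1]) hK hKΩ (by
    filter_upwards [ae_restrict_mem h.measurableSet] with x hx hxK
    rw [hpK x hx hxK, sub_zero])
  have hi1 := integrable_dens h.w12.memLp.1 h.w12.memLp_grad
  have hi2 := (MemLp.integrable_inner_two hbw.memLp_grad hpw.memLp_grad).const_mul 2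
  have hi3 := (MemLp.integrable_norm_sq' hpw.memLp_grad).const_mul (1 / 2)
  have hi4 : Integrable (fun x => 2 * inner ℝ (gradient b x) (q x) - 1 / 2 * ‖q x‖ ^ 2)
    (volume.restrict Ω) := hi2.sub hi3
  have hgrad0 := ((hconst 1).sub h.w12).grad_eq_zero_of_eq_zero h.isOpen
  -- where `u = 1` the gradient of `u` vanishes, and `|q| = |∇b| ≥ 2` pays for the new interphase
  have hub : ∫ x in Ω, dens (fun x => u x - p x) (fun x => g x - q x) x ≤
      ∫ x in Ω, (dens u g x + (2 * inner ℝ (gradient b x) (q x) - 1 / 2 * ‖q x‖ ^ 2)) := by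
    refine integral_mono_ae (integrable_dens hw.memLp.1 hw.memLp_grad) (hi1.add hi4) ?_
    filter_upwards [ae_restrict_mem h.measurableSet, hgrad0] with x hx hg0
    by_cases hlt' : 0 < min m (b x) + u x - 1
    · obtain ⟨h1, h2, h3⟩ := hpos x hx hlt'
      have h4 := hqpos x hx hlt'
      have h5 : ‖g x - q x‖ ^ 2 = ‖g x‖ ^ 2 + (2 * inner ℝ (gradient b x) (q x) - ‖q x‖ ^ 2) := by
        have : gradient b x = q x - g x := by rw [h4]; abel
        rw [this, inner_sub_left, real_inner_self_eq_norm_sq, norm_sub_sq_real]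
        ring
      have h6 := indicator_interphase_le_one (fun x => u x - p x) x
      rcases (hu1 x hx).lt_or_eq with h7 | h7
      · have h8 : x ∈ interphase u := by
          refine abs_lt.2 ⟨?_, h7⟩
          linarith [min_le_left m (b x)]
        simp only [dens, h5, Set.indicator_of_mem h8]
        linarith [sq_nonneg ‖q x‖]
      · have h8 : g x = 0 := by
          have := hg0 (by simp [h7])
          simpa using this
        have h9 : q x = gradient b x := by rw [h4, h8, add_zero]
        have h10 : 2 ≤ ‖q x‖ := by
          rw [h9]
          refine hγv.trans (hbγ x ?_ ?_)
          · have := h3.2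
            rw [mem_ball, dist_eq_norm, not_lt] at this
            exact this
          · have := h3.1
            rwa [mem_closedBall, dist_eq_norm] at this
        have h11 := indicator_interphase_nonneg u x
        simp only [dens, h5]
        nlinarith
    · have h1 : p x = 0 := max_eq_right (not_lt.1 hlt')
      have h2 := hqneg x hlt'
      rw [dens_congr (v := fun x => u x - p x) (w := u) (g := fun x => g x - q x) (k := g)
        (by rw [h1, sub_zero]) (by rw [h2, sub_zero]), h2]
      simp
  rw [integral_add hi1 hi4, integral_sub hi2 hi3, integral_const_mul, integral_const_mul] at hub
  have hle' : ∫ x in Ω, dens u g x ≤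
      ∫ x in Ω, dens (fun x => u x - p x) (fun x => g x - q x) x := hle
  have hq0 : ∫ x in Ω, ‖q x‖ ^ 2 ≤ 0 := by linarith
  -- hence `q` and `p` vanish, whereas `p y = min m (b y)` is positive
  have hq0' : ∀ᵐ x ∂(volume.restrict Ω), q x = 0 := by
    have h1 := (integral_eq_zero_iff_of_nonneg (fun x => by positivity)
      (MemLp.integrable_norm_sq' hpw.memLp_grad)).1
      (le_antisymm hq0 (integral_nonneg fun x => by positivity))
    filter_upwards [h1] with x hx
    simpa using hx
  have hp0 := hext.eq_zero_of_grad_eq_zero hext0 hK hextK (by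
    rw [ae_restrict_iff' h.measurableSet] at hq0'
    filter_upwards [hq0'] with x hx
    by_cases hxK : x ∈ K
    · rw [Set.indicator_of_mem hxK]; exact hx (hKΩ hxK)
    · exact Set.indicator_of_notMem hxK _)
  have hyΩ : y ∈ Ω := hsub (by rw [mem_ball, hy]; linarith)
  have hcont : ContinuousOn p Ω := by
    have h1 : ContinuousOn (fun x => min m (b x) + u x - 1) Ω :=
      ((continuous_const.min hbc.continuous).continuousOn.add hu).sub continuousOn_const
    exact (continuous_id.max continuous_const).comp_continuousOn h1
  have hfinal := le_of_ae_le_of_continuousOn h.isOpen hcont (continuousOn_const (c := (0 : ℝ))) (by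
    filter_upwards [ae_restrict_of_ae hp0, ae_restrict_mem h.measurableSet] with x hx hxΩ
    by_cases hxK : x ∈ K
    · rw [Set.indicator_of_mem hxK] at hx; exact hx.le
    · exact (hpK x hxΩ hxK).le) y hyΩ
  have hby : 0 < b y := (hbpos y).2 (by rw [← dist_eq_norm, hy]; linarith)
  have h1 : 0 < min m (b y) := lt_min hm0 hby
  have h2 := le_max_left (min m (b y) + u y - 1) 0
  simp only [hp, huy] at hfinal h2
  linarith

/-- Interior Lipschitz estimate, with a constant depending only on the dimension, on the Lipschitz
constant of the obstacles, and on the distance to the boundary. -/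
lemma PerturbMin.exists_slope_le (n : ℕ) : ∃ C : ℝ, 0 < C ∧
    ∀ {Ω : Set (E n)} {V W u : E n → ℝ} {g : E n → E n} {L : NNReal}, PerturbMin V W L Ω u g →
    ContinuousOn u Ω → WeakSubharm V → WeakSubharm (fun x => -W x) →
    ∀ (x₀ : E n) (r : ℝ), 0 < r → ball x₀ (2 * r) ⊆ Ω → |u x₀| < 1 →
      ∀ᶠ x in 𝓝 x₀, |u x - u x₀| ≤ C * (L + 1 + 1 / r) * ‖x - x₀‖ := by
  obtain ⟨M, hM, hMu⟩ := PerturbMin.exists_one_sub_le n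
  obtain ⟨A, hA, hAv⟩ := MeanValue.exists_slope_le n
  refine ⟨A * (3 + M), by positivity, ?_⟩
  -- the case in which the nearest point of the free boundary belongs to `{u = 1}`
  have one : ∀ {Ω : Set (E n)} {V W u : E n → ℝ} {g : E n → E n} {L : NNReal},
      PerturbMin V W L Ω u g → ContinuousOn u Ω → WeakSubharm V → WeakSubharm (fun x => -W x) →
      ∀ (x₀ y : E n) (r d : ℝ), 0 < r → 0 < d → ball x₀ (2 * d) ⊆ Ω →
      (∀ x ∈ ball x₀ d, |u x| < 1) → dist y x₀ = d → u y = 1 →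
      ∀ᶠ x in 𝓝 x₀, |u x - u x₀| ≤ A * (3 + M) * (L + 1 + 1 / r) * ‖x - x₀‖ := by
    intro Ω V W u g L h hu hVs hWs x₀ y r d hr hd hsub hlt hy huy
    have h1 := hMu h hu hVs hWs x₀ y d hd hsub hlt hy huy
    have hmv := h.meanValue hu hVs hWs ((ball_subset_ball (by linarith)).trans hsub) hlt
    filter_upwards [closedBall_mem_nhds x₀ (show 0 < d / 4 by positivity)] with x hx
    rw [mem_closedBall, dist_eq_norm] at hx
    have h2 := hAv hmv hd x hx
    rw [show (1 - u x) - (1 - u x₀) = -(u x - u x₀) by ring, abs_neg] at h2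
    refine h2.trans ?_
    have h3 : (1 - u x₀) / d ≤ 3 * L + M := by rwa [div_le_iff₀ hd]
    have h4 : 3 * (L : ℝ) + M ≤ (3 + M) * (L + 1 + 1 / r) := by
      have h5 : 0 ≤ M * (1 / r) := by positivity
      have h6 : 0 ≤ 1 / r := by positivity
      have h7 : 0 ≤ M * (L : ℝ) := by positivity
      nlinarith
    calc A * ((1 - u x₀) / d) * ‖x - x₀‖ ≤ A * ((3 + M) * (L + 1 + 1 / r)) * ‖x - x₀‖ := by
          gcongr; exact h3.trans h4
      _ = _ := by ring
  intro Ω V W u g L h hu hVs hWs x₀ r hr hsub hx₀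
  set Z : Set (E n) := closedBall x₀ r ∩ {z | 1 ≤ |u z|} with hZ
  have hcB : closedBall x₀ r ⊆ Ω := (closedBall_subset_ball (by linarith)).trans hsub
  have hZc : IsCompact Z := (isCompact_closedBall x₀ r).of_isClosed_subset
    ((hu.mono hcB).abs.preimage_isClosed_of_isClosed isClosed_closedBall isClosed_Ici)
    Set.inter_subset_left
  rcases Z.eq_empty_or_nonempty with hZe | hZne
  · have hlt : ∀ x ∈ ball x₀ r, |u x| < 1 := fun x hx => by
      by_contra! hc
      have : x ∈ Z := ⟨ball_subset_closedBall hx, hc⟩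
      rw [hZe] at this
      exact this
    have hmv := h.meanValue hu hVs hWs (ball_subset_closedBall.trans hcB) hlt
    filter_upwards [closedBall_mem_nhds x₀ (show 0 < r / 4 by positivity)] with x hx
    rw [mem_closedBall, dist_eq_norm] at hx
    have h2 := hAv hmv hr x hx
    rw [show (1 - u x) - (1 - u x₀) = -(u x - u x₀) by ring, abs_neg] at h2
    refine h2.trans ?_
    have h3 : (1 - u x₀) / r ≤ 2 * (1 / r) := by
      rw [mul_one_div]
      gcongr
      linarith [(abs_lt.1 hx₀).1]
    have h4 : 2 * (1 / r) ≤ (3 + M) * (L + 1 + 1 / r) := by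
      have h5 : 0 ≤ M * (1 / r) := by positivity
      have h6 : 0 ≤ 1 / r := by positivity
      have h7 : 0 ≤ M * (L : ℝ) := by positivity
      have h8 := L.coe_nonneg
      nlinarith
    calc A * ((1 - u x₀) / r) * ‖x - x₀‖ ≤ A * ((3 + M) * (L + 1 + 1 / r)) * ‖x - x₀‖ := by
          gcongr; exact h3.trans h4
      _ = _ := by ring
  · obtain ⟨y, hyZ, hymin⟩ := hZc.exists_isMinOn hZne
      (f := fun y => dist y x₀) (continuous_id.dist continuous_const).continuousOn
    rw [isMinOn_iff] at hymin
    set d := dist y x₀ with hd_def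
    have hyr : d ≤ r := hyZ.1
    have hd : 0 < d := by
      rw [hd_def, dist_pos]
      rintro rfl
      exact (not_le.2 hx₀) hyZ.2
    have hlt : ∀ x ∈ ball x₀ d, |u x| < 1 := fun x hx => by
      by_contra! hc
      exact absurd (hymin x ⟨(ball_subset_closedBall hx).trans hyr, hc⟩) (not_le.2 hx)
    have hsub' : ball x₀ (2 * d) ⊆ Ω := (ball_subset_ball (by linarith)).trans hsub
    have hmem := h.mem_of_continuousOn hu y (hcB hyZ.1)
    have hy1 : |u y| = 1 := le_antisymm (abs_le.2 ⟨(abs_le.1 (h.abs_V y)).1.trans hmem.1,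
      hmem.2.trans (abs_le.1 (h.abs_W y)).2⟩) hyZ.2
    rcases eq_or_eq_neg_of_abs_eq hy1 with h1 | h1
    · exact one h hu hVs hWs x₀ y r d hr hd hsub' hlt rfl h1
    · have := one h.neg hu.neg hWs (by simpa using hVs) x₀ y r d hr hd hsub' (by simpa using hlt)
        rfl (by simp [h1])
      filter_upwards [this] with x hx
      rw [abs_sub_comm]
      simpa [neg_add_eq_sub] using hx

/-- Uniform interior Lipschitz estimate on balls. -/
lemma PerturbMin.exists_lipschitzOnWith (n : ℕ) (L : NNReal) {r : ℝ} (hr : 0 < r) : ∃ Λ : NNReal,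
    ∀ {Ω : Set (E n)} {V W u : E n → ℝ} {g : E n → E n}, PerturbMin V W L Ω u g →
    ContinuousOn u Ω → WeakSubharm V → WeakSubharm (fun x => -W x) →
    ∀ c : E n, ball c (3 * r) ⊆ Ω → LipschitzOnWith Λ u (ball c r) := by
  obtain ⟨C, hC, hCu⟩ := PerturbMin.exists_slope_le n
  refine ⟨⟨C * (L + 1 + 1 / r), by positivity⟩, fun {Ω V W u g} h hu hVs hWs c hc => ?_⟩
  have hcΩ : ball c r ⊆ Ω := (ball_subset_ball (by linarith)).trans hc
  have hmem := h.mem_of_continuousOn hu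
  refine lipschitzOnWith_of_slope_le (convex_ball c r) (hu.mono hcΩ) (fun x hx =>
    abs_le.2 ⟨(abs_le.1 (h.abs_V x)).1.trans (hmem x (hcΩ hx)).1,
      (hmem x (hcΩ hx)).2.trans (abs_le.1 (h.abs_W x)).2⟩) (fun x hx hlt => ?_)
  refine hCu h hu hVs hWs x r hr (Set.Subset.trans (ball_subset_ball' ?_) hc) hlt
  rw [mem_ball] at hx
  linarith

/-! ### Cylinders -/

lemma norm_sq_eq_horiz (x : E n) : ‖x‖ ^ 2 = ‖horiz x‖ ^ 2 + x (Fin.last n) ^ 2 := by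
  simp only [EuclideanSpace.norm_sq_eq, Real.norm_eq_abs, sq_abs, horiz]
  rw [Fin.sum_univ_castSucc]

lemma horiz_sub (x y : E n) : horiz (x - y) = horiz x - horiz y := by
  ext i; simp [horiz]

lemma norm_horiz_le (x : E n) : ‖horiz x‖ ≤ ‖x‖ :=
  le_of_sq_le_sq (by rw [norm_sq_eq_horiz x]; nlinarith [sq_nonneg (x (Fin.last n))]) (norm_nonneg _)

lemma abs_last_le (x : E n) : |x (Fin.last n)| ≤ ‖x‖ :=
  abs_le_of_sq_le_sq (by rw [norm_sq_eq_horiz x]; nlinarith [sq_nonneg ‖horiz x‖]) (norm_nonneg _)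

lemma norm_le_horiz_add (x : E n) : ‖x‖ ≤ ‖horiz x‖ + |x (Fin.last n)| := by
  refine le_of_sq_le_sq ?_ (by positivity)
  rw [norm_sq_eq_horiz x, ← sq_abs (x (Fin.last n))]
  nlinarith [mul_nonneg (norm_nonneg (horiz x)) (abs_nonneg (x (Fin.last n)))]

lemma continuous_horiz : Continuous (horiz (n := n)) := by
  unfold horiz; fun_prop

lemma continuous_last : Continuous fun x : E n => x (Fin.last n) := by fun_prop

lemma cylinderAt_zero (R h : ℝ) : cylinderAt (0 : E n) R h = cylinder n R h := by
  have : horiz (0 : E n) = 0 := by ext i; simp [horiz]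
  simp [cylinderAt, cylinder, this]

lemma isOpen_cylinderAt (c : E n) (R h : ℝ) : IsOpen (cylinderAt c R h) :=
  (isOpen_lt ((continuous_horiz.sub continuous_const).norm) continuous_const).inter
    (isOpen_lt (f := fun x : E n => |x (Fin.last n) - c (Fin.last n)|)
      (by fun_prop) continuous_const)

lemma cylinderAt_subset_ball (c : E n) (R h : ℝ) : cylinderAt c R h ⊆ ball c (R + h) := by
  intro x hx
  rw [mem_ball, dist_eq_norm]
  refine (norm_le_horiz_add _).trans_lt ?_
  rw [horiz_sub]
  exact add_lt_add hx.1 hx.2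

lemma isBounded_cylinderAt (c : E n) (R h : ℝ) : Bornology.IsBounded (cylinderAt c R h) :=
  isBounded_ball.subset (cylinderAt_subset_ball c R h)

lemma isOpen_cylinder (R h : ℝ) : IsOpen (cylinder n R h) :=
  cylinderAt_zero (n := n) R h ▸ isOpen_cylinderAt 0 R h

lemma isBounded_cylinder (R h : ℝ) : Bornology.IsBounded (cylinder n R h) :=
  cylinderAt_zero (n := n) R h ▸ isBounded_cylinderAt 0 R h

lemma ball_subset_cylinder {R h r : ℝ} (hR : r ≤ R) (hh : r ≤ h) :
    ball (0 : E n) r ⊆ cylinder n R h := fun x hx => by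
  rw [mem_ball_zero_iff] at hx
  exact ⟨((norm_horiz_le x).trans_lt hx).trans_le hR, ((abs_last_le x).trans_lt hx).trans_le hh⟩

/-! ### Sub- and supersolutions as obstacles -/

/-- The gradient extends continuously to the closure of the interphase, so it is bounded on bounded
parts of the interphase, and this bounds the slope wherever `|w| < 1`. -/
lemma IsC2OnClosure.exists_lipschitzOnWith {w : E n → ℝ} {G : E n → E n} (hw : Continuous w)
    (hw1 : ∀ x, |w x| ≤ 1) (h : IsC2OnClosure w (interphase w) G) (R : ℝ) :
    ∃ L : NNReal, LipschitzOnWith L w (ball 0 R) := by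
  have hopen : IsOpen (interphase w) := isOpen_lt hw.abs continuous_const
  obtain ⟨C, hC⟩ := ((isCompact_closedBall (0 : E n) R).inter_right
    (isClosed_closure (s := interphase w))).exists_bound_of_continuousOn
      (h.gradient_cont.mono Set.inter_subset_right)
  set C' : NNReal := ⟨max C 0 + 1, by positivity⟩ with hC'
  refine ⟨C', lipschitzOnWith_of_slope_le (convex_ball 0 R) hw.continuousOn (fun x _ => hw1 x)
    fun x hx hlt => ?_⟩
  have hxI : x ∈ interphase w := hlt
  have hd : DifferentiableAt ℝ w x :=
    (h.contDiffOn.contDiffAt (hopen.mem_nhds hxI)).differentiableAt (by norm_num)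
  have hn : ‖fderiv ℝ w x‖ ≤ C := by
    rw [← norm_gradient, ← h.gradient_eq x hxI]
    exact hC x ⟨ball_subset_closedBall hx, subset_closure hxI⟩
  filter_upwards [(hd.hasFDerivAt.isLittleO.def one_pos)] with z hz
  rw [one_mul] at hz
  have h1 : |w z - w x| ≤ ‖w z - w x - fderiv ℝ w x (z - x)‖ + ‖fderiv ℝ w x (z - x)‖ := by
    have := norm_add_le (w z - w x - fderiv ℝ w x (z - x)) (fderiv ℝ w x (z - x))
    rwa [sub_add_cancel] at this
  have h2 : ‖fderiv ℝ w x (z - x)‖ ≤ max C 0 * ‖z - x‖ :=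
    (ContinuousLinearMap.le_opNorm _ _).trans
      (by gcongr; exact hn.trans (le_max_left _ _))
  calc |w z - w x| ≤ ‖z - x‖ + max C 0 * ‖z - x‖ := h1.trans (add_le_add hz h2)
    _ = (max C 0 + 1) * ‖z - x‖ := by ring

lemma exists_norm_gradient_le_of_lipschitz {w : E n → ℝ}
    (h : ∀ R : ℝ, ∃ L : NNReal, LipschitzOnWith L w (ball 0 R)) (K : Set (E n))
    (hK : IsCompact K) : ∃ C, ∀ x ∈ K, ‖gradient w x‖ ≤ C := by
  obtain ⟨R, hR⟩ := hK.isBounded.subset_ball 0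
  obtain ⟨L, hL⟩ := h R
  exact ⟨L, fun x hx => norm_gradient_le_of_lipschitzOn hL isOpen_ball (hR hx)⟩

/-- What the existence and regularity theory uses about the pair of obstacles. -/
structure Obstacles (V W : E n → ℝ) : Prop where
  abs_V : ∀ x, |V x| ≤ 1
  abs_W : ∀ x, |W x| ≤ 1
  le : ∀ x, V x ≤ W x
  lip : ∀ R : ℝ, ∃ L : NNReal, LipschitzOnWith L V (ball 0 R) ∧ LipschitzOnWith L W (ball 0 R)
  subharm : WeakSubharm V
  superharm : WeakSubharm fun x => -W x

lemma obstacles_of_solutions (hV : IsSubsolution V) (hW : IsSupersolution W)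
    (hVW : ∀ x, V x ≤ W x) : Obstacles V W := by
  obtain ⟨hVc, hV1, -, -, hVΔ, G, hG, -⟩ := hV
  obtain ⟨hWc, hW1, -, -, hWΔ, H, hH, -⟩ := hW
  have lV := hG.exists_lipschitzOnWith hVc hV1
  have lW := hH.exists_lipschitzOnWith hWc hW1
  refine ⟨hV1, hW1, hVW, fun R => ?_, ?_, ?_⟩
  · obtain ⟨L, hL⟩ := lV R
    obtain ⟨L', hL'⟩ := lW R
    exact ⟨max L L', hL.weaken (le_max_left _ _), hL'.weaken (le_max_right _ _)⟩
  · exact weakSubharm_of_laplacian_nonneg hVc (fun x => (abs_le.1 (hV1 x)).1) hG.contDiffOn hVΔ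
      (exists_norm_gradient_le_of_lipschitz lV)
  · have hi : interphase (fun x => -W x) = interphase W := by ext x; simp [interphase]
    refine weakSubharm_of_laplacian_nonneg hWc.neg
      (fun x => neg_le_neg (abs_le.1 (hW1 x)).2) (by rw [hi]; exact hH.contDiffOn.neg) ?_
      (exists_norm_gradient_le_of_lipschitz fun R => (lW R).imp fun L hL => hL.neg)
    intro x hx
    rw [hi] at hx
    have : (Δ fun y => -W y) x = -(Δ W) x := congrFun (InnerProductSpace.laplacian_neg (f := W)) x
    rw [this]
    linarith [hWΔ x hx]

lemma Obstacles.lip_of_isBounded (h : Obstacles V W) (hΩ : Bornology.IsBounded Ω) :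
    ∃ L : NNReal, LipschitzOnWith L V Ω ∧ LipschitzOnWith L W Ω := by
  obtain ⟨R, hR⟩ := hΩ.subset_ball 0
  obtain ⟨L, hL⟩ := h.lip R
  exact ⟨L, hL.1.mono hR, hL.2.mono hR⟩

lemma IsLocalMinimizer.perturbMin (h : Obstacles V W) (hΩ : IsOpen Ω)
    (hb : Bornology.IsBounded Ω) (hV : LipschitzOnWith L V Ω) (hW : LipschitzOnWith L W Ω)
    (hu : IsLocalMinimizer V W Ω u) : PerturbMin V W L Ω u (weakGradient Ω u) := by
  have hw : W12 Ω u (weakGradient Ω u) := MemH1.w12 hu.1.1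
  refine ⟨hΩ, hb, hV, hW, h.abs_V, h.abs_W, hw, hu.1.2, fun v k K hv hvm _ _ _ => ?_⟩
  rw [← hw.energy_eq hΩ, ← hv.energy_eq hΩ]
  exact hu.2 v ⟨hv.memH1, hvm⟩

/-! ### Existence of a largest minimizer -/

lemma Obstacles.admissible (h : Obstacles V W) (hΩ : IsOpen Ω) (hb : Bornology.IsBounded Ω) :
    Admissible V W Ω V := by
  obtain ⟨L, hL, -⟩ := h.lip_of_isBounded hb
  exact ⟨(W12.of_lipschitzOn hL hΩ hb).memH1, ae_of_all _ fun x => ⟨le_rfl, h.le x⟩⟩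

lemma Admissible.max {v w : E n → ℝ} (hΩ : IsOpen Ω) (hv : Admissible V W Ω v)
    (hw : Admissible V W Ω w) : Admissible V W Ω (fun x => max (v x) (w x)) := by
  refine ⟨((MemH1.w12 hv.1).max (MemH1.w12 hw.1) hΩ).memH1, ?_⟩
  filter_upwards [hv.2, hw.2] with x h1 h2
  exact ⟨h1.1.trans (le_max_left _ _), max_le h1.2 h2.2⟩

lemma Admissible.min {v w : E n → ℝ} (hΩ : IsOpen Ω) (hv : Admissible V W Ω v)
    (hw : Admissible V W Ω w) : Admissible V W Ω (fun x => min (v x) (w x)) := by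
  refine ⟨((MemH1.w12 hv.1).min (MemH1.w12 hw.1) hΩ).memH1, ?_⟩
  filter_upwards [hv.2, hw.2] with x h1 h2
  exact ⟨le_min h1.1 h2.1, (min_le_left _ _).trans h1.2⟩

lemma Obstacles.abs_le_one (h : Obstacles V W) {v : E n → ℝ} (hv : Admissible V W Ω v) :
    ∀ᵐ x ∂(volume.restrict Ω), |v x| ≤ 1 := by
  filter_upwards [hv.2] with x hx
  exact abs_le.2 ⟨(abs_le.1 (h.abs_V x)).1.trans hx.1, hx.2.trans (abs_le.1 (h.abs_W x)).2⟩

/-- Admissible functions are closed under pointwise limits with bounded energy, and the energy is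
lower semicontinuous. -/
lemma Obstacles.admissible_of_tendsto (h : Obstacles V W) (hΩ : IsOpen Ω)
    (hb : Bornology.IsBounded Ω) {v : ℕ → E n → ℝ} {w : E n → ℝ}
    (hv : ∀ j, Admissible V W Ω (v j))
    (hw : ∀ᵐ x ∂(volume.restrict Ω), Tendsto (fun j => v j x) atTop (𝓝 (w x)))
    {c : ℕ → ℝ} {c₀ : ℝ} (hc : ∀ j, energy Ω (v j) ≤ c j) (hc₀ : Tendsto c atTop (𝓝 c₀)) :
    Admissible V W Ω w ∧ energy Ω w ≤ c₀ := by
  obtain ⟨k, hk, hkc⟩ := W12.exists_of_tendsto_of_energy_le hb.measure_lt_top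
    (fun j => MemH1.w12 (hv j).1) (fun j => h.abs_le_one (hv j)) hw
    (fun j => by rw [← (MemH1.w12 (hv j).1).energy_eq hΩ]; exact hc j) hc₀
  refine ⟨⟨hk.memH1, ?_⟩, by rwa [hk.energy_eq hΩ]⟩
  filter_upwards [hw, ae_all_iff.2 fun j => (hv j).2] with x h1 h2
  exact ⟨ge_of_tendsto' h1 fun j => (h2 j).1, le_of_tendsto' h1 fun j => (h2 j).2⟩

/-- Running maxima of a sequence of functions. -/
noncomputable def runMax (v : ℕ → E n → ℝ) : ℕ → E n → ℝ
  | 0 => v 0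
  | N + 1 => fun x => max (runMax v N x) (v (N + 1) x)

lemma runMax_mono (v : ℕ → E n → ℝ) (x : E n) : Monotone fun N => runMax v N x :=
  monotone_nat_of_le_succ fun _ => le_max_left _ _

lemma le_runMax (v : ℕ → E n → ℝ) (N : ℕ) (x : E n) : v N x ≤ runMax v N x := by
  cases N with
  | zero => exact le_rfl
  | succ N => exact le_max_right _ _

lemma runMax_le {v : ℕ → E n → ℝ} {x : E n} {b : ℝ} (h : ∀ k, v k x ≤ b) (N : ℕ) :
    runMax v N x ≤ b := by
  induction N with
  | zero => exact h 0
  | succ N ih => exact max_le ih (h _)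

lemma tendsto_runMax {v : ℕ → E n → ℝ} {x : E n} {b : ℝ} (h : ∀ k, v k x ≤ b) :
    Tendsto (fun N => runMax v N x) atTop (𝓝 (⨆ N, runMax v N x)) :=
  tendsto_atTop_ciSup (runMax_mono v x) ⟨b, by rintro _ ⟨N, rfl⟩; exact runMax_le h N⟩

/-- Taking maxima adds up the excesses over the infimum `m` of the energy. -/
lemma admissible_runMax (hΩ : IsOpen Ω) (hb : Bornology.IsBounded Ω) {m : ℝ}
    (hm : ∀ v, Admissible V W Ω v → m ≤ energy Ω v) {v : ℕ → E n → ℝ} {e : ℕ → ℝ}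
    (hv : ∀ k, Admissible V W Ω (v k)) (he : ∀ k, energy Ω (v k) ≤ m + e k) (N : ℕ) :
    Admissible V W Ω (runMax v N) ∧
      energy Ω (runMax v N) ≤ m + ∑ k ∈ Finset.range (N + 1), e k := by
  induction N with
  | zero => exact ⟨hv 0, by simpa [runMax] using he 0⟩
  | succ N ih =>
    refine ⟨ih.1.max hΩ (hv _), ?_⟩
    have h1 := energy_max_add_energy_min hΩ hb.measure_lt_top ih.1.1 (hv (N + 1)).1
    have h2 := hm _ (ih.1.min hΩ (hv (N + 1)))
    rw [Finset.sum_range_succ]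
    change energy Ω (fun x => max (runMax v N x) (v (N + 1) x)) ≤ _
    linarith [he (N + 1), ih.2]

/-- Existence by the lattice structure: maxima and minima of admissible functions do not increase the
total energy, so the upper limit of a minimizing sequence with summable excess is a minimizer, and
strong compactness in `L²` is not needed. -/
lemma Obstacles.exists_isLocalMinimizer (h : Obstacles V W) (hΩ : IsOpen Ω)
    (hb : Bornology.IsBounded Ω) : ∃ u, IsLocalMinimizer V W Ω u := by
  set A : Set ℝ := energy Ω '' {v | Admissible V W Ω v} with hA
  have hne : A.Nonempty := ⟨_, V, h.admissible hΩ hb, rfl⟩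
  have hbdd : BddBelow A := ⟨0, by
    rintro _ ⟨v, hv, rfl⟩
    rw [(MemH1.w12 hv.1).energy_eq hΩ]
    exact integral_nonneg fun x => dens_nonneg _ _ _⟩
  set m := sInf A with hm_def
  have hm : ∀ v, Admissible V W Ω v → m ≤ energy Ω v := fun v hv => csInf_le hbdd ⟨v, hv, rfl⟩
  have hex : ∀ k : ℕ, ∃ v, Admissible V W Ω v ∧ energy Ω v ≤ m + (1 / 2 : ℝ) ^ k := fun k => by
    obtain ⟨_, ⟨v, hv, rfl⟩, hlt⟩ := exists_lt_of_csInf_lt hne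
      (show sInf A < m + (1 / 2 : ℝ) ^ k by linarith [show 0 < (1 / 2 : ℝ) ^ k by positivity])
    exact ⟨v, hv, hlt.le⟩
  choose v hv he using hex
  -- `w j` is the supremum of the tail of the sequence starting at `j`
  set w : ℕ → E n → ℝ := fun j x => ⨆ N, runMax (fun k => v (j + k)) N x with hw
  have hae : ∀ᵐ x ∂(volume.restrict Ω), ∀ k, V x ≤ v k x ∧ v k x ≤ W x :=
    ae_all_iff.2 fun k => (hv k).2
  have hwt : ∀ j, ∀ᵐ x ∂(volume.restrict Ω),
      Tendsto (fun N => runMax (fun k => v (j + k)) N x) atTop (𝓝 (w j x)) := fun j => by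
    filter_upwards [hae] with x hx
    exact tendsto_runMax (b := W x) fun k => (hx _).2
  have hwj : ∀ j, Admissible V W Ω (w j) ∧ energy Ω (w j) ≤ m + 2 * (1 / 2 : ℝ) ^ j := fun j => by
    have h1 := fun N => admissible_runMax hΩ hb hm (v := fun k => v (j + k)) (fun k => hv _)
      (fun k => he (j + k)) N
    refine h.admissible_of_tendsto hΩ hb (fun N => (h1 N).1) (hwt j) (c := fun _ => _)
      (fun N => (h1 N).2.trans ?_) tendsto_const_nhds
    simp_rw [pow_add, ← Finset.mul_sum]
    have h2 : ∑ k ∈ Finset.range (N + 1), (1 / 2 : ℝ) ^ k ≤ 2 := by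
      have := summable_geometric_two.sum_le_tsum (Finset.range (N + 1)) (fun k _ => by positivity)
      rwa [tsum_geometric_two] at this
    have h3 : 0 < (1 / 2 : ℝ) ^ j := by positivity
    nlinarith
  have hanti : ∀ᵐ x ∂(volume.restrict Ω), Antitone fun j => w j x := by
    filter_upwards [hae] with x hx
    refine antitone_nat_of_succ_le fun j => ?_
    refine ciSup_le fun N => ?_
    have h1 : ∀ k, v (j + 1 + k) x ≤ w j x := fun k => by
      have h2 : (fun k => v (j + k)) (k + 1) x ≤ _ := le_runMax (fun k => v (j + k)) (k + 1) x
      have h3 : BddAbove (Set.range fun N => runMax (fun k => v (j + k)) N x) :=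
        ⟨W x, by rintro _ ⟨N, rfl⟩; exact runMax_le (fun k => (hx _).2) N⟩
      rw [show j + 1 + k = j + (k + 1) by ring]
      exact h2.trans (le_ciSup h3 (k + 1))
    exact runMax_le h1 N
  have hlim : ∀ᵐ x ∂(volume.restrict Ω), Tendsto (fun j => w j x) atTop (𝓝 (⨅ j, w j x)) := by
    filter_upwards [hanti, ae_all_iff.2 fun j => (hwj j).1.2] with x h1 h2
    exact tendsto_atTop_ciInf h1 ⟨V x, by rintro _ ⟨j, rfl⟩; exact (h2 j).1⟩
  have hc : Tendsto (fun j : ℕ => m + 2 * (1 / 2 : ℝ) ^ j) atTop (𝓝 m) := by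
    have := ((tendsto_pow_atTop_nhds_zero_of_lt_one (r := (1 / 2 : ℝ)) (by norm_num)
      (by norm_num)).const_mul 2).const_add m
    simpa using this
  obtain ⟨h1, h2⟩ := h.admissible_of_tendsto hΩ hb (fun j => (hwj j).1) hlim
    (fun j => (hwj j).2) hc
  exact ⟨_, h1, fun v hv => h2.trans (hm v hv)⟩

/-- The minimizers form a lattice. -/
lemma IsLocalMinimizer.max {v w : E n → ℝ} (hΩ : IsOpen Ω) (hb : Bornology.IsBounded Ω)
    (hv : IsLocalMinimizer V W Ω v) (hw : IsLocalMinimizer V W Ω w) :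
    IsLocalMinimizer V W Ω (fun x => max (v x) (w x)) := by
  refine ⟨hv.1.max hΩ hw.1, fun z hz => ?_⟩
  have h1 := energy_max_add_energy_min hΩ hb.measure_lt_top hv.1.1 hw.1.1
  linarith [hw.2 _ (hv.1.min hΩ hw.1), hv.2 z hz]

/-- The largest minimizer, obtained by maximizing the integral among all minimizers. -/
lemma Obstacles.exists_largest (h : Obstacles V W) (hΩ : IsOpen Ω)
    (hb : Bornology.IsBounded Ω) : ∃ u, IsLocalMinimizer V W Ω u ∧
      ∀ v, IsLocalMinimizer V W Ω v → v ≤ᵐ[volume.restrict Ω] u := by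
  have : IsFiniteMeasure (volume.restrict Ω) := ⟨by simpa using hb.measure_lt_top⟩
  have hint : ∀ v, IsLocalMinimizer V W Ω v → IntegrableOn v Ω := fun v hv =>
    MemLp.integrable (q := 2) (by norm_num) hv.1.1.1
  set A : Set ℝ := (fun v => ∫ x in Ω, v x) '' {v | IsLocalMinimizer V W Ω v} with hA
  obtain ⟨v₀, hv₀⟩ := h.exists_isLocalMinimizer hΩ hb
  have hne : A.Nonempty := ⟨_, v₀, hv₀, rfl⟩
  have hbdd : BddAbove A := ⟨∫ _ in Ω, (1 : ℝ), by
    rintro _ ⟨v, hv, rfl⟩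
    refine integral_mono_ae (hint v hv) (integrable_const _) ?_
    filter_upwards [h.abs_le_one hv.1] with x hx using (abs_le.1 hx).2⟩
  set a := sSup A with ha_def
  have hex : ∀ k : ℕ, ∃ v, IsLocalMinimizer V W Ω v ∧
      a - 1 / ((k : ℝ) + 1) ≤ ∫ x in Ω, v x := fun k => by
    obtain ⟨_, ⟨v, hv, rfl⟩, hlt⟩ := exists_lt_of_lt_csSup hne
      (show a - 1 / ((k : ℝ) + 1) < sSup A by
        linarith [show 0 < 1 / ((k : ℝ) + 1) from Nat.one_div_pos_of_nat])
    exact ⟨v, hv, hlt.le⟩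
  choose v hv he using hex
  have hrm : ∀ N, IsLocalMinimizer V W Ω (runMax v N) := fun N => by
    induction N with
    | zero => exact hv 0
    | succ N ih => exact ih.max hΩ hb (hv _)
  have hae : ∀ᵐ x ∂(volume.restrict Ω), ∀ k, V x ≤ v k x ∧ v k x ≤ W x :=
    ae_all_iff.2 fun k => (hv k).1.2
  obtain ⟨h1, h2⟩ := h.admissible_of_tendsto hΩ hb (w := fun x => ⨆ N, runMax v N x)
    (fun N => (hrm N).1) (by
      filter_upwards [hae] with x hx
      exact tendsto_runMax (b := W x) fun k => (hx _).2)
    (c := fun _ => energy Ω v₀) (fun N => (hrm N).2 _ hv₀.1) tendsto_const_nhds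
  have hu : IsLocalMinimizer V W Ω (fun x => ⨆ N, runMax v N x) :=
    ⟨h1, fun z hz => h2.trans (hv₀.2 z hz)⟩
  refine ⟨_, hu, fun w hw => ?_⟩
  have hle : ∀ k : ℕ, a - 1 / ((k : ℝ) + 1) ≤ ∫ x in Ω, ⨆ N, runMax v N x := fun k => by
    refine (he k).trans (integral_mono_ae (hint _ (hv k)) (hint _ hu) ?_)
    filter_upwards [hae] with x hx
    exact (le_runMax v k x).trans (le_ciSup (f := fun N => runMax v N x)
      ⟨W x, by rintro _ ⟨N, rfl⟩; exact runMax_le (fun k => (hx _).2) N⟩ k)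
  have hae' : a ≤ ∫ x in Ω, ⨆ N, runMax v N x := by
    have : Tendsto (fun k : ℕ => a - 1 / ((k : ℝ) + 1)) atTop (𝓝 (a - 0)) :=
      tendsto_const_nhds.sub tendsto_one_div_add_atTop_nhds_zero_nat
    rw [sub_zero] at this
    exact le_of_tendsto' this hle
  have hmax := hu.max hΩ hb hw
  have hmle : ∫ x in Ω, Max.max (⨆ N, runMax v N x) (w x) ≤ a := le_csSup hbdd ⟨_, hmax, rfl⟩
  have hdiff := hint _ hmax
  have hz : ∫ x in Ω, (Max.max (⨆ N, runMax v N x) (w x) - ⨆ N, runMax v N x) = 0 := by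
    refine le_antisymm ?_ (integral_nonneg fun x => sub_nonneg.2 (le_max_left _ _))
    rw [integral_sub hdiff (hint _ hu)]
    linarith
  rw [integral_eq_zero_iff_of_nonneg (fun x => sub_nonneg.2 (le_max_left _ _))
    (hdiff.sub (hint _ hu))] at hz
  filter_upwards [hz] with x hx
  have hx' : Max.max (⨆ N, runMax v N x) (w x) - (⨆ N, runMax v N x) = 0 := hx
  linarith [le_max_right (⨆ N, runMax v N x) (w x)]

/-! ### Euclidean motions -/

/-- The motion `x ↦ A x + c`. -/
noncomputable def motion (A : E n ≃ₗᵢ[ℝ] E n) (c : E n) : E n ≃ₜ E n :=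
  A.toHomeomorph.trans (Homeomorph.addRight c)

@[simp] lemma motion_apply (A : E n ≃ₗᵢ[ℝ] E n) (c x : E n) : motion A c x = A x + c := rfl

@[simp] lemma motion_symm_apply (A : E n ≃ₗᵢ[ℝ] E n) (c x : E n) :
    (motion A c).symm x = A.symm (x - c) := by
  rw [Homeomorph.symm_apply_eq]; simp

lemma measurePreserving_motion (A : E n ≃ₗᵢ[ℝ] E n) (c : E n) :
    MeasurePreserving (motion A c) volume volume :=
  (measurePreserving_add_right volume c).comp A.measurePreserving

lemma measurePreserving_motion_restrict (A : E n ≃ₗᵢ[ℝ] E n) (c : E n) (Q : Set (E n)) :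
    MeasurePreserving (motion A c) (volume.restrict (motion A c ⁻¹' Q)) (volume.restrict Q) :=
  (measurePreserving_motion A c).restrict_preimage_emb (motion A c).measurableEmbedding Q

lemma setIntegral_motion {F : Type*} [NormedAddCommGroup F] [NormedSpace ℝ F]
    (A : E n ≃ₗᵢ[ℝ] E n) (c : E n) (Q : Set (E n)) (f : E n → F) :
    ∫ x in motion A c ⁻¹' Q, f (motion A c x) = ∫ y in Q, f y :=
  (measurePreserving_motion_restrict A c Q).integral_comp (motion A c).measurableEmbedding f

lemma gradient_comp_motion (A : E n ≃ₗᵢ[ℝ] E n) (c : E n) {ψ : E n → ℝ} {x : E n}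
    (hψ : DifferentiableAt ℝ ψ (motion A c x)) :
    gradient (fun x => ψ (motion A c x)) x = A.symm (gradient ψ (motion A c x)) := by
  have h1 : HasFDerivAt (motion A c) (A : E n →L[ℝ] E n) x :=
    (A : E n →L[ℝ] E n).hasFDerivAt.add_const c
  have h2 : HasFDerivAt (fun x => ψ (motion A c x)) _ x := hψ.hasFDerivAt.comp x h1
  refine ext_inner_right ℝ fun e => ?_
  rw [← fderiv_eq_inner_gradient, h2.fderiv, ← A.inner_map_map, A.apply_symm_apply,
    ← fderiv_eq_inner_gradient]
  rfl

lemma W12.comp_motion {Q : Set (E n)} {v : E n → ℝ} (hv : W12 Q v g) (A : E n ≃ₗᵢ[ℝ] E n)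
    (c : E n) : W12 (motion A c ⁻¹' Q) (fun x => v (motion A c x))
      (fun x => A.symm (g (motion A c x))) := by
  have hmp := measurePreserving_motion_restrict A c Q
  refine ⟨hv.memLp.comp_measurePreserving hmp, ?_, fun φ hφ => ?_⟩
  · have h1 := hv.memLp_grad.comp_measurePreserving hmp
    exact h1.continuousLinearMap_comp (A.symm : E n →L[ℝ] E n)
  · set ψ : E n → ℝ := fun y => φ ((motion A c).symm y) with hψ
    have hφψ : ∀ x, φ x = ψ (motion A c x) := fun x => by simp only [hψ, Homeomorph.symm_apply_apply]
    have hsm : ContDiff ℝ ∞ (motion A c).symm := by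
      have : ((motion A c).symm : E n → E n) = fun x => A.symm (x - c) :=
        funext fun x => motion_symm_apply A c x
      rw [this]
      exact A.symm.contDiff.comp (contDiff_id.sub contDiff_const)
    have hsupp : tsupport ψ = motion A c '' tsupport φ := by
      rw [(motion A c).image_eq_preimage_symm]
      exact tsupport_comp_eq_preimage φ (motion A c).symm
    have hψt : IsTestFunction Q ψ := by
      refine ⟨hφ.1.comp hsm, ?_, ?_⟩
      · rw [HasCompactSupport, hsupp]; exact hφ.2.1.image (motion A c).continuous
      · rw [hsupp]; exact Set.image_subset_iff.2 hφ.2.2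
    have hgr : ∀ x, gradient φ x = A.symm (gradient ψ (motion A c x)) := fun x => by
      rw [← gradient_comp_motion A c (hψt.1.differentiable (by simp) _)]
      congr 1
      exact funext hφψ
    simp_rw [hgr, hφψ]
    have e1 := setIntegral_motion A c Q (fun y => v y • A.symm (gradient ψ y))
    have e2 := setIntegral_motion A c Q (fun y => ψ y • A.symm (g y))
    rw [e1, e2]
    simp_rw [← map_smul]
    have e3 := (A.symm : E n →L[ℝ] E n).integral_comp_comm (hv.integrable_smul_gradient hψt)
    have e4 := (A.symm : E n →L[ℝ] E n).integral_comp_comm (hv.integrable_smul_grad hψt)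
    have e5 := congrArg A.symm (hv.2.2 ψ hψt)
    rw [map_neg] at e5
    exact (e3.trans e5).trans (congrArg Neg.neg e4.symm)

lemma energy_comp_motion {Q : Set (E n)} (hQ : IsOpen Q) {v : E n → ℝ} (hv : MemH1 Q v)
    (A : E n ≃ₗᵢ[ℝ] E n) (c : E n) :
    energy (motion A c ⁻¹' Q) (fun x => v (motion A c x)) = energy Q v := by
  have hw := MemH1.w12 hv
  rw [(hw.comp_motion A c).energy_eq (hQ.preimage (motion A c).continuous), hw.energy_eq hQ,
    ← setIntegral_motion A c Q]
  congr 1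
  funext x
  rw [dens, dens, A.symm.norm_map]
  rfl

/-- Exchanging the values of a function at the points `x ∈ P` and `T x`, so that the smaller one is
at `x`, does not change the energy. -/
lemma energy_min_add_energy_max_motion {P : Set (E n)} (A : E n ≃ₗᵢ[ℝ] E n) (c : E n)
    {Q : Set (E n)} (hQ : IsOpen Q) (hP : motion A c ⁻¹' Q = P) (hfin : volume P < ⊤)
    {v : E n → ℝ} (hvP : MemH1 P v) (hvQ : MemH1 Q v) {S : E n → E n}
    (hS : ∀ x, S (motion A c x) = x) (hSQ : MemH1 Q fun y => max (v y) (v (S y))) :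
    energy P (fun x => min (v x) (v (motion A c x))) + energy Q (fun y => max (v y) (v (S y))) =
      energy P v + energy Q v := by
  subst hP
  have hPo : IsOpen (motion A c ⁻¹' Q) := hQ.preimage (motion A c).continuous
  have hvc : MemH1 (motion A c ⁻¹' Q) fun x => v (motion A c x) :=
    ((MemH1.w12 hvQ).comp_motion A c).memH1
  rw [← energy_comp_motion hQ hSQ A c, ← energy_comp_motion hQ hvQ A c,
    ← energy_max_add_energy_min hPo hfin hvP hvc, add_comm]
  congr 2
  funext x
  rw [hS, max_comm]

/-! ### Slabs -/

lemma volume_hyperplane (p : ℝ) : volume {x : E n | x (Fin.last n) = p} = 0 := by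
  have h1 : volume {f : Fin (n + 1) → ℝ | f (Fin.last n) = p} = 0 :=
    Measure.pi_hyperplane (fun _ : Fin (n + 1) => (volume : Measure ℝ)) (Fin.last n) p
  have hm : MeasurableSet {f : Fin (n + 1) → ℝ | f (Fin.last n) = p} :=
    measurableSet_eq_fun (measurable_pi_apply _) measurable_const
  rw [← (PiLp.volume_preserving_ofLp (Fin (n + 1))).measure_preimage hm.nullMeasurableSet] at h1
  exact h1

lemma ae_ne_hyperplane (p : ℝ) (Ω : Set (E n)) :
    ∀ᵐ x ∂(volume.restrict Ω), x (Fin.last n) ≠ p :=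
  ae_restrict_of_ae (measure_eq_zero_iff_ae_notMem.1 (volume_hyperplane p))

/-- The part of the vertical cylinder of radius `R` strictly between the heights `α` and `β`. -/
def slab (n : ℕ) (R α β : ℝ) : Set (E n) :=
  {x | ‖horiz x‖ < R ∧ α < x (Fin.last n) ∧ x (Fin.last n) < β}

lemma cylinder_eq_slab (R h : ℝ) : cylinder n R h = slab n R (-h) h := by
  ext x; simp [cylinder, slab, abs_lt]

lemma isOpen_slab (R α β : ℝ) : IsOpen (slab n R α β) :=
  (isOpen_lt continuous_horiz.norm continuous_const).inter
    ((isOpen_lt continuous_const continuous_last).inter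
      (isOpen_lt continuous_last continuous_const))

lemma slab_mono {R α β α' β' : ℝ} (h : α' ≤ α) (h' : β ≤ β') : slab n R α β ⊆ slab n R α' β' :=
  fun _ hx => ⟨hx.1, h.trans_lt hx.2.1, hx.2.2.trans_le h'⟩

lemma isBounded_slab (R α β : ℝ) : Bornology.IsBounded (slab n R α β) := by
  refine (isBounded_cylinder R (max |α| |β|)).subset ?_
  rw [cylinder_eq_slab]
  refine slab_mono ?_ ((le_abs_self β).trans (le_max_right _ _))
  linarith [neg_abs_le α, le_max_left |α| |β|]

lemma MemH1.mono {v : E n → ℝ} (hv : MemH1 Ω v) (h : Ω' ⊆ Ω) (hΩ : MeasurableSet Ω) :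
    MemH1 Ω' v := ((MemH1.w12 hv).mono h hΩ).memH1

/-- The energy is additive over slabs, as a hyperplane is a null set. -/
lemma energy_slab_add {R α β γ : ℝ} (h1 : α ≤ γ) (h2 : γ ≤ β) {v : E n → ℝ}
    (hv : MemH1 (slab n R α β) v) :
    energy (slab n R α β) v = energy (slab n R α γ) v + energy (slab n R γ β) v := by
  have hw := MemH1.w12 hv
  have hm := (isOpen_slab (n := n) R α β).measurableSet
  have hs1 : slab n R α γ ⊆ slab n R α β := slab_mono le_rfl h2
  have hs2 : slab n R γ β ⊆ slab n R α β := slab_mono h1 le_rfl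
  have : IsFiniteMeasure (volume.restrict (slab n R α β)) :=
    ⟨by simpa using (isBounded_slab R α β).measure_lt_top⟩
  have hi : IntegrableOn (dens v (weakGradient (slab n R α β) v)) (slab n R α β) :=
    integrable_dens hw.memLp.1 hw.memLp_grad
  rw [hw.energy_eq (isOpen_slab _ _ _), (hw.mono hs1 hm).energy_eq (isOpen_slab _ _ _),
    (hw.mono hs2 hm).energy_eq (isOpen_slab _ _ _), ← setIntegral_union ?_
      (isOpen_slab _ _ _).measurableSet (hi.mono_set hs1) (hi.mono_set hs2)]
  · refine setIntegral_congr_set ?_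
    have hne := measure_eq_zero_iff_ae_notMem.1 (volume_hyperplane (n := n) γ)
    filter_upwards [hne] with x hx
    refine propext ⟨fun hx' => ?_, fun hx' => hx'.elim (fun h => hs1 h) fun h => hs2 h⟩
    rcases lt_or_gt_of_ne hx with h | h
    · exact Or.inl ⟨hx'.1, hx'.2.1, h⟩
    · exact Or.inr ⟨hx'.1, h, hx'.2.2⟩
  · rw [Set.disjoint_left]
    intro x hx hx'
    exact absurd (hx.2.2.trans hx'.2.1) (lt_irrefl _)

/-- Reflection of the last coordinate. -/
noncomputable def flip (n : ℕ) : E n ≃ₗᵢ[ℝ] E n :=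
  LinearIsometryEquiv.piLpCongrRight 2 fun i =>
    if i = Fin.last n then LinearIsometryEquiv.neg ℝ else LinearIsometryEquiv.refl ℝ ℝ

@[simp] lemma flip_last (x : E n) : flip n x (Fin.last n) = -x (Fin.last n) := by
  simp [flip]

@[simp] lemma horiz_flip (x : E n) : horiz (flip n x) = horiz x := by
  ext i
  simp [flip, horiz]

lemma ext_horiz_last {x y : E n} (h1 : horiz x = horiz y)
    (h2 : x (Fin.last n) = y (Fin.last n)) : x = y := by
  ext i
  refine Fin.lastCases h2 (fun i => ?_) i
  have := congrArg (fun z : EuclideanSpace ℝ (Fin n) => z i) h1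
  simpa [horiz] using this

@[simp] lemma flip_flip (x : E n) : flip n (flip n x) = x :=
  ext_horiz_last (by simp) (by simp)

/-- Vertical translation by `c`. -/
noncomputable def shift (c : ℝ) : E n ≃ₜ E n :=
  motion (LinearIsometryEquiv.refl ℝ (E n)) (c • eLast n)

/-- Reflection in the hyperplane `{xₙ = s}`. -/
noncomputable def refl (s : ℝ) : E n ≃ₜ E n := motion (flip n) ((2 * s) • eLast n)

@[simp] lemma eLast_last : eLast n (Fin.last n) = 1 := by simp [eLast]

@[simp] lemma horiz_add_smul_eLast (x : E n) (c : ℝ) : horiz (x + c • eLast n) = horiz x := by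
  ext i; simp [horiz, eLast]

lemma shift_apply (c : ℝ) (x : E n) : shift c x = x + c • eLast n := rfl

@[simp] lemma shift_last (c : ℝ) (x : E n) : shift c x (Fin.last n) = x (Fin.last n) + c := by
  simp [shift_apply]

@[simp] lemma horiz_shift (c : ℝ) (x : E n) : horiz (shift c x) = horiz x := by
  simp [shift_apply]

lemma refl_apply (s : ℝ) (x : E n) : refl s x = flip n x + (2 * s) • eLast n := rfl

@[simp] lemma refl_last (s : ℝ) (x : E n) : refl s x (Fin.last n) = 2 * s - x (Fin.last n) := by
  simp [refl_apply]; ring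

@[simp] lemma horiz_refl (s : ℝ) (x : E n) : horiz (refl s x) = horiz x := by
  simp [refl_apply]

@[simp] lemma refl_refl (s : ℝ) (x : E n) : refl s (refl s x) = x :=
  ext_horiz_last (by simp) (by simp)

lemma norm_refl_sub (s : ℝ) (x : E n) : ‖refl s x - x‖ = 2 * |x (Fin.last n) - s| := by
  have h1 : horiz (refl s x - x) = 0 := by rw [horiz_sub, horiz_refl, sub_self]
  have h2 : (refl s x - x) (Fin.last n) = -2 * (x (Fin.last n) - s) := by
    rw [PiLp.sub_apply, refl_last]; ring
  have h3 := norm_sq_eq_horiz (refl s x - x)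
  rw [h1, h2, norm_zero] at h3
  have h4 : ‖refl s x - x‖ ^ 2 = (2 * |x (Fin.last n) - s|) ^ 2 := by
    rw [h3, mul_pow 2, sq_abs]; ring
  exact (pow_left_inj₀ (norm_nonneg _) (by positivity) two_ne_zero).1 h4

/-! ### Gluing across a hyperplane -/

/-- Two Sobolev functions on the two sides of a hyperplane define a Sobolev function if their
traces agree, in the sense that the jump at distance `t` from the hyperplane is `O(t)`. -/
lemma W12.glue (hΩ : IsOpen Ω) {p : ℝ} {v : E n → ℝ} {g₁ g₂ : E n → E n}
    (h1 : W12 (Ω ∩ {x | x (Fin.last n) < p}) v g₁) (h2 : W12 (Ω ∩ {x | p < x (Fin.last n)}) v g₂)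
    (hc : ∀ φ, IsTestFunction Ω φ → ∃ C, ∀ x,
      |v x * φ x - v (refl p x) * φ (refl p x)| ≤ C * |x (Fin.last n) - p|) :
    W12 Ω v ({x | x (Fin.last n) < p}.piecewise g₁ g₂) := by
  classical
  set D₁ : Set (E n) := {x | x (Fin.last n) < p} with hD₁
  set D₂ : Set (E n) := {x | p < x (Fin.last n)} with hD₂
  have ho1 : IsOpen D₁ := isOpen_lt continuous_last continuous_const
  have ho2 : IsOpen D₂ := isOpen_lt continuous_const continuous_last
  have hm := hΩ.measurableSet
  have hr1 : (volume.restrict Ω).restrict D₁ = volume.restrict (Ω ∩ D₁) := by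
    rw [Measure.restrict_restrict ho1.measurableSet, Set.inter_comm]
  have hr2 : (volume.restrict Ω).restrict D₁ᶜ = volume.restrict (Ω ∩ D₂) := by
    rw [Measure.restrict_restrict ho1.measurableSet.compl, Set.inter_comm]
    refine Measure.restrict_congr_set ?_
    filter_upwards [measure_eq_zero_iff_ae_notMem.1 (volume_hyperplane (n := n) p)] with x hx
    refine propext (and_congr_right fun _ => ?_)
    change ¬ (x (Fin.last n) < p) ↔ p < x (Fin.last n)
    exact ⟨fun h => lt_of_le_of_ne (not_lt.1 h) (Ne.symm hx), fun h => not_lt.2 h.le⟩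
  have hv : MemLp v 2 (volume.restrict Ω) := by
    have := MemLp.piecewise (μ := volume.restrict Ω) (p := 2) ho1.measurableSet
      (by rw [hr1]; exact h1.memLp) (by rw [hr2]; exact h2.memLp)
    rwa [Set.piecewise_same] at this
  have hg : MemLp (D₁.piecewise g₁ g₂) 2 (volume.restrict Ω) :=
    MemLp.piecewise (μ := volume.restrict Ω) (p := 2) ho1.measurableSet
      (by rw [hr1]; exact h1.memLp_grad) (by rw [hr2]; exact h2.memLp_grad)
  refine ⟨hv, hg, fun φ hφ => ?_⟩
  obtain ⟨C, hC⟩ := hc φ hφ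
  set τ : E n → ℝ := fun x => x (Fin.last n) - p with hτ
  set θ : ℝ → ℝ := fun t => Real.smoothTransition (2 * t - 1) with hθ
  have hθc : ContDiff ℝ ∞ θ :=
    Real.smoothTransition.contDiff.comp ((contDiff_const.mul contDiff_id).sub contDiff_const)
  have hθ0 : ∀ t ≤ 1 / 2, θ t = 0 := fun t ht =>
    Real.smoothTransition.zero_of_nonpos (by linarith)
  have hθ1 : ∀ t, 1 ≤ t → θ t = 1 := fun t ht =>
    Real.smoothTransition.one_of_one_le (by linarith)
  have hθd0 : ∀ t < 1 / 2, deriv θ t = 0 := fun t ht => by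
    have : θ =ᶠ[𝓝 t] fun _ => 0 := by
      filter_upwards [gt_mem_nhds ht] with y hy using hθ0 y (le_of_lt hy)
    rw [this.deriv_eq]; simp
  have hθd1 : ∀ t > 1, deriv θ t = 0 := fun t ht => by
    have : θ =ᶠ[𝓝 t] fun _ => 1 := by
      filter_upwards [lt_mem_nhds ht] with y hy using hθ1 y (le_of_lt hy)
    rw [this.deriv_eq]; simp
  obtain ⟨M, hM⟩ : ∃ M, ∀ t, |deriv θ t| ≤ M := by
    have hcd : Continuous (deriv θ) := hθc.continuous_deriv (by simp)
    obtain ⟨M, hM⟩ := (isCompact_Icc (a := (0 : ℝ)) (b := 2)).exists_bound_of_continuousOn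
      hcd.continuousOn
    refine ⟨M, fun t => ?_⟩
    have hM0 : 0 ≤ M := (norm_nonneg _).trans (hM 0 (by simp))
    rcases lt_or_ge t (1 / 2) with h | h
    · rw [hθd0 t h, abs_zero]; exact hM0
    rcases lt_or_ge 1 t with h' | h'
    · rw [hθd1 t h', abs_zero]; exact hM0
    · exact hM t ⟨by linarith, by linarith⟩
  -- the two one-sided cutoffs at scale `ε = 1 / (k + 1)`
  set χ : ℝ → ℕ → E n → ℝ := fun σ k x => θ (σ * ((k : ℝ) + 1) * τ x) with hχ
  have hτd : ∀ x, HasFDerivAt τ (innerSL ℝ (eLast n)) x := fun x => by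
    have h : τ = fun x => innerSL ℝ (eLast n) x - p := by
      funext x
      simp [hτ, eLast, EuclideanSpace.inner_single_left]
    rw [h]
    exact (innerSL ℝ (eLast n)).hasFDerivAt.sub_const p
  have hτc : ContDiff ℝ ∞ τ := by
    have : ContDiff ℝ ∞ fun x : E n => x (Fin.last n) := by fun_prop
    exact this.sub contDiff_const
  have hχc : ∀ σ k, ContDiff ℝ ∞ (χ σ k) := fun σ k => hθc.comp (contDiff_const.mul hτc)
  have hχg : ∀ σ k x, gradient (χ σ k) x =
      (deriv θ (σ * ((k : ℝ) + 1) * τ x) * (σ * ((k : ℝ) + 1))) • eLast n := fun σ k x => by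
    have h := ((hθc.differentiable (by simp) _).hasDerivAt.comp_hasFDerivAt x
      ((hτd x).const_mul (σ * ((k : ℝ) + 1))))
    have h' : HasFDerivAt (χ σ k) _ x := h
    refine ext_inner_right ℝ fun e => ?_
    rw [← fderiv_eq_inner_gradient, h'.fderiv, real_inner_smul_left]
    simp only [smul_apply, innerSL_apply_apply, smul_eq_mul]
    ring
  have hχτ : ∀ (σ : ℝ) (k : ℕ) (x : E n), σ * τ x ≤ 0 → χ σ k x = 0 := fun σ k x hx => by
    refine hθ0 _ ?_
    have : 0 ≤ (k : ℝ) + 1 := by positivity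
    nlinarith
  have htest : ∀ (σ : ℝ) (D : Set (E n)), (∀ x, 0 < σ * τ x → x ∈ D) → ∀ k,
      IsTestFunction (Ω ∩ D) (fun x => χ σ k x * φ x) := fun σ D hD k => by
    have h := hφ.mul_left (hχc σ k)
    refine ⟨h.1, h.2.1, Set.subset_inter h.2.2 ?_⟩
    have hsub : tsupport (fun x => χ σ k x * φ x) ⊆ {x | 1 / 2 ≤ σ * ((k : ℝ) + 1) * τ x} := by
      refine closure_minimal (fun x hx => ?_)
        (isClosed_le continuous_const (continuous_const.mul hτc.continuous))
      by_contra hc'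
      exact hx (by simp only [hχ]; rw [hθ0 _ (le_of_lt (not_le.1 hc')), zero_mul])
    refine hsub.trans fun x hx => hD x ?_
    have h3 : 1 / 2 ≤ σ * ((k : ℝ) + 1) * τ x := hx
    have h4 : (0 : ℝ) < (k : ℝ) + 1 := by positivity
    by_contra! hc'
    nlinarith
  have hgr : ∀ σ k x, gradient (fun x => χ σ k x * φ x) x =
      χ σ k x • gradient φ x + (deriv θ (σ * ((k : ℝ) + 1) * τ x) * (σ * ((k : ℝ) + 1)) * φ x) •
        eLast n := fun σ k x => by
    rw [gradient_mul ((hχc σ k).differentiable (by simp) _) (hφ.1.differentiable (by simp) _),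
      hχg, smul_smul, mul_comm (φ x)]
  have hdχ : ∀ (σ : ℝ) (k : ℕ) (x : E n), σ * τ x ≤ 0 →
      deriv θ (σ * ((k : ℝ) + 1) * τ x) = 0 := fun σ k x hx => by
    refine hθd0 _ ?_
    have : 0 ≤ (k : ℝ) + 1 := by positivity
    nlinarith
  have hvi := fun k σ => MemLp.integrable_smul_two hv
    ((hφ.mul_left (hχc σ k)).memLp_gradient (Ω := Ω))
  have hgi := fun k σ => MemLp.integrable_smul_two ((hφ.mul_left (hχc σ k)).memLp (Ω := Ω)) hg
  -- the weak formulation on each side, written as integrals over `Ω`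
  have side : ∀ (σ : ℝ) (D : Set (E n)) (k' : E n → E n), (∀ x, x ∈ D ↔ 0 < σ * τ x) →
      IsOpen D → W12 (Ω ∩ D) v k' → (∀ x ∈ D, k' x = D₁.piecewise g₁ g₂ x) → ∀ k,
      ∫ x in Ω, v x • gradient (fun x => χ σ k x * φ x) x =
        - ∫ x in Ω, (χ σ k x * φ x) • D₁.piecewise g₁ g₂ x := by
    intro σ D k' hD hDo hw hk' k
    have h3 := hw.2.2 _ (htest σ D (fun x hx => (hD x).2 hx) k)
    rw [setIntegral_eq_of_subset_of_forall_sdiff_eq_zero hm Set.inter_subset_left,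
      setIntegral_eq_of_subset_of_forall_sdiff_eq_zero hm Set.inter_subset_left, h3]
    · congr 1
      refine setIntegral_congr_fun (hm.inter hDo.measurableSet) fun x hx => ?_
      simp only [hk' x hx.2]
    · intro x hx
      have : σ * τ x ≤ 0 := not_lt.1 fun h => hx.2 ⟨hx.1, (hD x).2 h⟩
      rw [hχτ σ k x this, zero_mul, zero_smul]
    · intro x hx
      have : σ * τ x ≤ 0 := not_lt.1 fun h => hx.2 ⟨hx.1, (hD x).2 h⟩
      rw [hgr, hχτ σ k x this, hdχ σ k x this]
      simp
  have s1 := side (-1) D₁ g₁ (fun x => by simp [hD₁, hτ]) ho1 h1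
    (fun x hx => (Set.piecewise_eq_of_mem _ _ _ hx).symm)
  have s2 := side 1 D₂ g₂ (fun x => by simp [hD₂, hτ]) ho2 h2
    (fun x hx => (Set.piecewise_eq_of_notMem _ _ _ (by
      have : p < x (Fin.last n) := hx
      simp [hD₁, this.le])).symm)
  have hsum0 : ∀ x, τ x ≠ 0 → ∀ᶠ k : ℕ in atTop, χ (-1) k x + χ 1 k x = 1 := fun x hx => by
    filter_upwards [(tendsto_natCast_atTop_atTop (R := ℝ)).eventually_ge_atTop (1 / |τ x|)]
      with k hk
    have h0 : 0 < |τ x| := abs_pos.2 hx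
    rw [div_le_iff₀ h0] at hk
    rcases lt_or_gt_of_ne hx with h | h
    · rw [abs_of_neg h] at hk h0
      rw [hχτ 1 k x (by linarith), add_zero]
      exact hθ1 _ (by nlinarith)
    · rw [abs_of_pos h] at hk h0
      rw [hχτ (-1) k x (by linarith), zero_add]
      exact hθ1 _ (by nlinarith)
  have hχle : ∀ σ k x, |χ σ k x| ≤ 1 := fun σ k x => by
    rw [abs_of_nonneg (Real.smoothTransition.nonneg _)]
    exact Real.smoothTransition.le_one _
  -- removing the cutoffs in the limit
  have lim : ∀ {f : E n → E n}, Integrable f (volume.restrict Ω) →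
      Tendsto (fun k => ∫ x in Ω, (χ (-1) k x + χ 1 k x) • f x) atTop (𝓝 (∫ x in Ω, f x)) := by
    intro f hf
    refine tendsto_integral_of_dominated_convergence (fun x => 2 * ‖f x‖) (fun k => ?_)
      (hf.norm.const_mul 2) (fun k => ae_of_all _ fun x => ?_) ?_
    · exact ((hχc _ k).continuous.add (hχc _ k).continuous).aestronglyMeasurable.smul hf.1
    · rw [norm_smul]
      gcongr
      exact (norm_add_le _ _).trans (by
        rw [Real.norm_eq_abs, Real.norm_eq_abs]; linarith [hχle (-1) k x, hχle 1 k x])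
    · filter_upwards [ae_ne_hyperplane p Ω] with x hx
      refine tendsto_const_nhds.congr' ?_
      filter_upwards [hsum0 x (sub_ne_zero.2 hx)] with k hk
      rw [hk, one_smul]
  have hvφ : Integrable (fun x => v x • gradient φ x) (volume.restrict Ω) :=
    MemLp.integrable_smul_two hv hφ.memLp_gradient
  have hφg : Integrable (fun x => φ x • D₁.piecewise g₁ g₂ x) (volume.restrict Ω) :=
    MemLp.integrable_smul_two hφ.memLp hg
  have l1 := lim hvφ
  have l2 := lim hφg
  -- the boundary terms
  set J : ℕ → E n → ℝ := fun k x => deriv θ (((k : ℝ) + 1) * τ x) * ((k : ℝ) + 1) with hJ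
  have hJc : ∀ k, Continuous (J k) := fun k =>
    ((hθc.continuous_deriv (by simp)).comp (continuous_const.mul hτc.continuous)).mul
      continuous_const
  have hvφi : Integrable (fun x => v x * φ x) := by
    have h3 : IntegrableOn (fun x => v x * φ x) Ω := by
      have := MemLp.integrable_smul_two hv (hφ.memLp (Ω := Ω))
      exact this
    have h4 : Integrable (Ω.indicator fun x => v x * φ x) := (integrable_indicator_iff hm).2 h3
    refine h4.congr (ae_of_all _ fun x => ?_)
    by_cases hx : x ∈ Ω
    · simp [hx]
    · simp [hx, image_eq_zero_of_notMem_tsupport fun hx' => hx (hφ.2.2 hx')]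
  have hmp : MeasurePreserving (refl (n := n) p) volume volume := measurePreserving_motion _ _
  have hτr : ∀ x, τ (refl p x) = -τ x := fun x => by simp only [hτ, refl_last]; ring
  have hJi : ∀ k, Integrable fun x => v x * φ x * J k x := fun k => by
    refine hvφi.mul_bdd (c := M * ((k : ℝ) + 1)) (hJc k).aestronglyMeasurable
      (ae_of_all _ fun x => ?_)
    rw [norm_mul, Real.norm_eq_abs, Real.norm_eq_abs, abs_of_pos (by positivity : (0 : ℝ) < k + 1)]
    gcongr
    exact hM _
  have hJi' : ∀ k, Integrable fun x => v (refl p x) * φ (refl p x) * J k x := fun k => by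
    have h3 : Integrable (fun x => v (refl p x) * φ (refl p x)) :=
      hmp.integrable_comp_of_integrable hvφi
    refine h3.mul_bdd (c := M * ((k : ℝ) + 1)) (hJc k).aestronglyMeasurable
      (ae_of_all _ fun x => ?_)
    rw [norm_mul, Real.norm_eq_abs, Real.norm_eq_abs, abs_of_pos (by positivity : (0 : ℝ) < k + 1)]
    gcongr
    exact hM _
  set d : ℕ → ℝ := fun k =>
    ∫ x, (v x * φ x - v (refl p x) * φ (refl p x)) * J k x with hd
  have hd0 : Tendsto d atTop (𝓝 0) := by
    have hC0 : 0 ≤ M * |C| := mul_nonneg ((abs_nonneg _).trans (hM 0)) (abs_nonneg _)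
    set B : Set (E n) := tsupport φ ∪ refl p '' tsupport φ with hB
    have hBc : IsCompact B := hφ.2.1.union (IsCompact.image hφ.2.1 (refl p).continuous)
    have hlim : Tendsto d atTop (𝓝 (∫ _ : E n, (0 : ℝ))) := by
      refine tendsto_integral_of_dominated_convergence (B.indicator fun _ => M * |C|) (fun k => ?_)
        ((integrable_indicator_iff hBc.measurableSet).2
          (integrableOn_const hBc.measure_lt_top.ne)) (fun k => ae_of_all _ fun x => ?_)
        (ae_of_all _ fun x => ?_)
      · exact ((hJi k).sub (hJi' k)).1.congr (ae_of_all _ fun x => by simp only [Pi.sub_apply]; ring)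
      · by_cases hx : x ∈ B
        · rw [Set.indicator_of_mem hx, norm_mul, Real.norm_eq_abs, Real.norm_eq_abs]
          by_cases hx1 : ((k : ℝ) + 1) * τ x ≤ 1 ∧ 0 ≤ ((k : ℝ) + 1) * τ x
          · have hk : (0 : ℝ) < (k : ℝ) + 1 := by positivity
            have h3 : |x (Fin.last n) - p| * ((k : ℝ) + 1) ≤ 1 := by
              have h4 : 0 ≤ τ x := by
                by_contra! hneg
                nlinarith [hx1.2]
              have h5 : |x (Fin.last n) - p| = τ x := abs_of_nonneg h4
              rw [h5, mul_comm]; exact hx1.1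
            have h6 := hC x
            have h7 : C * |x (Fin.last n) - p| ≤ |C| * |x (Fin.last n) - p| := by
              gcongr; exact le_abs_self C
            simp only [hJ]
            rw [abs_mul, abs_of_pos hk]
            calc _ ≤ (|C| * |x (Fin.last n) - p|) * (M * ((k : ℝ) + 1)) := by
                  gcongr
                  · exact h6.trans h7
                  · exact hM _
              _ = (M * |C|) * (|x (Fin.last n) - p| * ((k : ℝ) + 1)) := by ring
              _ ≤ (M * |C|) * 1 := by gcongr
              _ = _ := mul_one _
          · have : deriv θ (((k : ℝ) + 1) * τ x) = 0 := by
              rw [not_and_or, not_le, not_le] at hx1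
              rcases hx1 with h3 | h3
              · exact hθd1 _ h3
              · exact hθd0 _ (by linarith)
            simp only [hJ, this]
            simpa using hC0
        · have h3 : φ x = 0 := image_eq_zero_of_notMem_tsupport fun h => hx (Or.inl h)
          have h4 : φ (refl p x) = 0 := image_eq_zero_of_notMem_tsupport fun h =>
            hx (Or.inr ⟨_, h, refl_refl p x⟩)
          rw [h3, h4]
          simp [hx]
      · refine tendsto_const_nhds.congr' ?_
        rcases le_or_gt (τ x) 0 with h | h
        · refine Eventually.of_forall fun k => ?_
          have := hdχ 1 k x (by linarith)
          rw [one_mul] at this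
          simp [hJ, this]
        · filter_upwards [(tendsto_natCast_atTop_atTop (R := ℝ)).eventually_ge_atTop (1 / τ x)]
            with k hk
          rw [div_le_iff₀ h] at hk
          have : deriv θ (((k : ℝ) + 1) * τ x) = 0 := hθd1 _ (by nlinarith)
          simp [hJ, this]
    simpa using hlim
  have hdk : ∀ k, d k = (∫ x, v x * φ x * J k x) - ∫ x, v x * φ x * J k (refl p x) := fun k => by
    have h3 : ∫ x, v x * φ x * J k (refl p x) = ∫ x, v (refl p x) * φ (refl p x) * J k x := by
      rw [← hmp.integral_comp (refl p).measurableEmbedding]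
      simp only [refl_refl]
    rw [h3, ← integral_sub (hJi k) (hJi' k)]
    simp only [hd]
    congr 1
    funext x
    ring
  have key : ∀ k, (∫ x in Ω, (χ (-1) k x + χ 1 k x) • (v x • gradient φ x)) + d k • eLast n =
      - ∫ x in Ω, (χ (-1) k x + χ 1 k x) • (φ x • D₁.piecewise g₁ g₂ x) := fun k => by
    have e0 : ∀ f : E n → ℝ, ∫ x in Ω, v x * φ x * f x = ∫ x, v x * φ x * f x := fun f => by
      refine setIntegral_eq_integral_of_forall_compl_eq_zero fun x hx => ?_
      rw [image_eq_zero_of_notMem_tsupport fun hx' => hx (hφ.2.2 hx')]; ring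
    have hJr : ∀ x, J k (refl p x) = deriv θ (-1 * ((k : ℝ) + 1) * τ x) * ((k : ℝ) + 1) :=
      fun x => by
      simp only [hJ, hτr]
      congr 2
      ring
    have hJri : Integrable fun x => v x * φ x * J k (refl p x) := by
      have := hmp.integrable_comp_of_integrable (hJi' k)
      simpa only [Function.comp_def, refl_refl] using this
    have e1 : ∫ x in Ω, v x • gradient (fun x => χ 1 k x * φ x) x +
        v x • gradient (fun x => χ (-1) k x * φ x) x =
        (∫ x in Ω, (χ (-1) k x + χ 1 k x) • (v x • gradient φ x)) + d k • eLast n := by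
      have hA : Integrable (fun x => (χ (-1) k x + χ 1 k x) • (v x • gradient φ x))
          (volume.restrict Ω) := integrable_bdd_smul hvφ
            ((hχc _ k).continuous.add (hχc _ k).continuous).aestronglyMeasurable (C := 2)
            fun x => (abs_add_le _ _).trans (by linarith [hχle (-1) k x, hχle 1 k x])
      have hB : Integrable (fun x => (v x * φ x * J k x - v x * φ x * J k (refl p x)) • eLast n)
          (volume.restrict Ω) := (((hJi k).sub hJri).smul_const _).restrict
      rw [hdk, ← e0, ← e0, ← integral_sub (hJi k).restrict hJri.restrict, ← integral_smul_const,
        ← integral_add hA hB]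
      refine integral_congr_ae (ae_of_all _ fun x => ?_)
      simp only [hgr]
      rw [hJr]
      simp only [hJ]
      rw [one_mul]
      module
    rw [← e1, integral_add (hvi k 1) (hvi k (-1)), s1 k, s2 k, ← neg_add, neg_inj,
      ← integral_add (hgi k 1) (hgi k (-1))]
    refine integral_congr_ae (ae_of_all _ fun x => ?_)
    module
  have l3 := l1.add (hd0.smul_const (eLast n))
  rw [zero_smul, add_zero] at l3
  simp_rw [key] at l3
  exact tendsto_nhds_unique l3 l2.neg

/-! ### Polarization of functions on a cylinder -/

/-- The reflection of `u` at height `s`, where `u` is thought of as extended evenly across the top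
`{xₙ = h}` of the cylinder. -/
noncomputable def fold (h s : ℝ) (u : E n → ℝ) (x : E n) : ℝ :=
  if 2 * s - h < x (Fin.last n) then u (refl s x) else u (shift (2 * (h - s)) x)

/-- The polarization of `u` at height `s`: of the two values `u` and `fold h s u`, the smaller one
is taken below the height `s` and the larger one above it. -/
noncomputable def polar (h s : ℝ) (u : E n → ℝ) (x : E n) : ℝ :=
  if x (Fin.last n) < s then min (u x) (fold h s u x) else max (u x) (fold h s u x)

/-- Bounded Sobolev functions that are locally Lipschitz in the interior. -/
structure Tame (Ω : Set (E n)) (u : E n → ℝ) : Prop where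
  memH1 : MemH1 Ω u
  abs_le : ∀ x, |u x| ≤ 1
  lip : ∀ K, IsCompact K → K ⊆ Ω → ∃ r > 0, ∃ Λ : ℝ, ∀ x ∈ K, ∀ y, ‖y - x‖ < r →
    |u y - u x| ≤ Λ * ‖y - x‖

lemma fold_of_lt {h s : ℝ} {x : E n} (hx : 2 * s - h < x (Fin.last n)) :
    fold h s u x = u (refl s x) := if_pos hx

lemma fold_of_ge {h s : ℝ} {x : E n} (hx : x (Fin.last n) ≤ 2 * s - h) :
    fold h s u x = u (shift (2 * (h - s)) x) := if_neg (not_lt.2 hx)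

lemma abs_fold_le {h s : ℝ} (hu : ∀ x, |u x| ≤ 1) (x : E n) : |fold h s u x| ≤ 1 := by
  unfold fold; split_ifs <;> exact hu _

lemma abs_polar_le {h s : ℝ} (hu : ∀ x, |u x| ≤ 1) (x : E n) : |polar h s u x| ≤ 1 := by
  have h1 := hu x
  have h2 := abs_fold_le (h := h) (s := s) hu x
  unfold polar
  split_ifs
  · rcases min_choice (u x) (fold h s u x) with h3 | h3 <;> rw [h3] <;> assumption
  · rcases max_choice (u x) (fold h s u x) with h3 | h3 <;> rw [h3] <;> assumption

lemma refl_eq_self {s : ℝ} {x : E n} (hx : x (Fin.last n) = s) : refl s x = x :=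
  ext_horiz_last (by simp) (by simp [hx]; ring)

lemma abs_refl_last_sub (s : ℝ) (x : E n) :
    |refl s x (Fin.last n) - s| = |x (Fin.last n) - s| := by
  rw [refl_last, abs_sub_comm]; congr 1; ring

lemma IsTestFunction.exists_lipschitz {φ : E n → ℝ} (hφ : IsTestFunction Ω φ) :
    ∃ C : ℝ, 0 ≤ C ∧ ∀ x y, |φ x - φ y| ≤ C * ‖x - y‖ := by
  obtain ⟨C, hC⟩ := ContDiff.lipschitzWith_of_hasCompactSupport (𝕂 := ℝ) hφ.2.1 hφ.1 (by simp)
  exact ⟨C, C.2, fun x y => by simpa [Real.dist_eq, dist_eq_norm] using hC.dist_le_mul x y⟩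

/-- Even reflection across the hyperplane `{xₙ = 2 s - h}` preserves the Sobolev class. -/
lemma memH1_fold {R h s : ℝ} (h0 : 0 ≤ s) (hs : s < h) (hu : MemH1 (slab n R (-h) h) u)
    (hu1 : ∀ x, |u x| ≤ 1) : MemH1 (slab n R (-h) h) (fold h s u) := by
  set p := 2 * s - h with hp
  have hw := MemH1.w12 hu
  have ho := isOpen_slab (n := n) R (-h) h
  have ho1 : IsOpen (slab n R (-h) h ∩ {x | x (Fin.last n) < p}) :=
    ho.inter (isOpen_lt continuous_last continuous_const)
  have ho2 : IsOpen (slab n R (-h) h ∩ {x | p < x (Fin.last n)}) :=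
    ho.inter (isOpen_lt continuous_const continuous_last)
  have h1 : MemH1 (slab n R (-h) h ∩ {x | x (Fin.last n) < p}) (fold h s u) := by
    refine (((hw.comp_motion (LinearIsometryEquiv.refl ℝ (E n)) ((2 * (h - s)) • eLast n)).mono
      (fun x hx => ?_) (ho.preimage (motion _ _).continuous).measurableSet).congr ?_
      (ae_eq_refl _)).memH1
    · change shift (2 * (h - s)) x ∈ slab n R (-h) h
      have h2 : x (Fin.last n) < 2 * s - h := hx.2
      refine ⟨by simpa using hx.1.1, ?_, ?_⟩ <;> rw [shift_last]
      · linarith [hx.1.2.1, hx.1.2.2]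
      · linarith
    · filter_upwards [ae_restrict_mem ho1.measurableSet] with x hx
      exact (fold_of_ge (le_of_lt hx.2)).symm
  have h2 : MemH1 (slab n R (-h) h ∩ {x | p < x (Fin.last n)}) (fold h s u) := by
    refine (((hw.comp_motion (flip n) ((2 * s) • eLast n)).mono
      (fun x hx => ?_) (ho.preimage (motion _ _).continuous).measurableSet).congr ?_
      (ae_eq_refl _)).memH1
    · change refl s x ∈ slab n R (-h) h
      have h2 : 2 * s - h < x (Fin.last n) := hx.2
      refine ⟨by simpa using hx.1.1, ?_, ?_⟩ <;> rw [refl_last]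
      · linarith [hx.1.2.2]
      · linarith
    · filter_upwards [ae_restrict_mem ho2.measurableSet] with x hx
      exact (fold_of_lt hx.2).symm
  refine ((MemH1.w12 h1).glue ho (MemH1.w12 h2) fun φ hφ => ?_).memH1
  obtain ⟨C, hC0, hC⟩ := hφ.exists_lipschitz
  have hsymm : ∀ x : E n, fold h s u (refl p x) = fold h s u x := by
    have one : ∀ x : E n, x (Fin.last n) < p → fold h s u (refl p x) = fold h s u x := by
      intro x hx
      rw [fold_of_lt (x := refl p x) (by rw [refl_last]; linarith), fold_of_ge hx.le]
      congr 1
      refine ext_horiz_last (by simp) ?_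
      rw [refl_last, refl_last, shift_last, hp]
      ring
    intro x
    rcases lt_trichotomy (x (Fin.last n)) p with hx | hx | hx
    · exact one x hx
    · rw [refl_eq_self hx]
    · have := one (refl p x) (by rw [refl_last]; linarith)
      rw [refl_refl] at this
      exact this.symm
  refine ⟨2 * C, fun x => ?_⟩
  rw [hsymm, ← mul_sub, abs_mul]
  calc _ ≤ 1 * (C * ‖x - refl p x‖) := by
        gcongr
        · exact abs_fold_le hu1 x
        · exact hC _ _
    _ = 2 * C * |x (Fin.last n) - p| := by
        rw [norm_sub_rev, norm_refl_sub]; ring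

/-- The polarization is a Sobolev function: near the hyperplane `{xₙ = s}` it takes the values
`u x` and `u (refl s x)`, whose difference vanishes linearly. -/
lemma memH1_polar {R h s : ℝ} (h0 : 0 ≤ s) (hs : s < h) (hu : Tame (slab n R (-h) h) u) :
    MemH1 (slab n R (-h) h) (polar h s u) := by
  have ho := isOpen_slab (n := n) R (-h) h
  have hm := ho.measurableSet
  have hf := memH1_fold h0 hs hu.memH1 hu.abs_le
  have ho1 : IsOpen (slab n R (-h) h ∩ {x | x (Fin.last n) < s}) :=
    ho.inter (isOpen_lt continuous_last continuous_const)
  have ho2 : IsOpen (slab n R (-h) h ∩ {x | s < x (Fin.last n)}) :=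
    ho.inter (isOpen_lt continuous_const continuous_last)
  have h1 : MemH1 (slab n R (-h) h ∩ {x | x (Fin.last n) < s}) (polar h s u) := by
    refine ((((MemH1.w12 hu.memH1).min (MemH1.w12 hf) ho).mono Set.inter_subset_left hm).congr ?_
      (ae_eq_refl _)).memH1
    filter_upwards [ae_restrict_mem ho1.measurableSet] with x hx
    exact (if_pos hx.2).symm
  have h2 : MemH1 (slab n R (-h) h ∩ {x | s < x (Fin.last n)}) (polar h s u) := by
    refine ((((MemH1.w12 hu.memH1).max (MemH1.w12 hf) ho).mono Set.inter_subset_left hm).congr ?_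
      (ae_eq_refl _)).memH1
    filter_upwards [ae_restrict_mem ho2.measurableSet] with x hx
    exact (if_neg (not_lt.2 (le_of_lt hx.2))).symm
  refine ((MemH1.w12 h1).glue ho (MemH1.w12 h2) fun φ hφ => ?_).memH1
  obtain ⟨C, hC0, hC⟩ := hφ.exists_lipschitz
  obtain ⟨M, hM⟩ := hφ.1.continuous.bounded_above_of_compact_support hφ.2.1
  have hM0 : 0 ≤ M := (norm_nonneg _).trans (hM 0)
  obtain ⟨r, hr, Λ, hΛ⟩ := hu.lip _ hφ.2.1 hφ.2.2
  set δ := min (r / 2) (h - s) with hδ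
  have hδ0 : 0 < δ := lt_min (by positivity) (by linarith)
  set a := polar h s u with ha
  have ha1 := fun x => abs_polar_le (h := h) (s := s) hu.abs_le x
  have hterm : 0 ≤ 2 * M / δ := by positivity
  have one : ∀ x : E n, x (Fin.last n) < s → |a x * φ x - a (refl s x) * φ (refl s x)| ≤
      (2 * M / δ + 2 * |Λ| * M + 2 * C) * |x (Fin.last n) - s| := by
    intro x hx
    rcases le_or_gt δ |x (Fin.last n) - s| with hge | hlt
    · have h3 : |a x * φ x - a (refl s x) * φ (refl s x)| ≤ 2 * M := by
        refine (abs_sub _ _).trans ?_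
        rw [abs_mul, abs_mul]
        have h4 : |a x| * |φ x| ≤ 1 * M := by gcongr; exacts [ha1 x, hM x]
        have h5 : |a (refl s x)| * |φ (refl s x)| ≤ 1 * M := by gcongr; exacts [ha1 _, hM _]
        linarith
      have h4 : 2 * M ≤ 2 * M / δ * |x (Fin.last n) - s| := by
        calc 2 * M = 2 * M / δ * δ := by field_simp
          _ ≤ _ := by gcongr
      refine h3.trans (h4.trans ?_)
      gcongr
      have : 0 ≤ 2 * |Λ| * M := by positivity
      linarith
    · set y := refl s x with hy
      have hnorm : ‖y - x‖ = 2 * |x (Fin.last n) - s| := norm_refl_sub s x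
      have hnr : ‖y - x‖ < r := by
        have := min_le_left (r / 2) (h - s)
        rw [hnorm]; linarith
      by_cases hK : x ∈ tsupport φ ∨ y ∈ tsupport φ
      · have hux : |u x - u y| ≤ |Λ| * ‖y - x‖ := by
          rcases hK with hK | hK
          · rw [abs_sub_comm]
            exact (hΛ x hK y hnr).trans (by gcongr; exact le_abs_self _)
          · have := hΛ y hK x (by rwa [norm_sub_rev])
            rw [norm_sub_rev] at this
            exact this.trans (by gcongr; exact le_abs_self _)
        have h3 : s - x (Fin.last n) < h - s := by
          rw [abs_of_neg (by linarith)] at hlt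
          linarith [min_le_right (r / 2) (h - s)]
        have hax : a x = min (u x) (u y) := by
          simp only [ha, polar]
          rw [if_pos hx, fold_of_lt (by linarith)]
        have hay : a y = max (u x) (u y) := by
          simp only [ha, polar]
          rw [if_neg (by rw [hy, refl_last]; linarith), fold_of_lt (by rw [hy, refl_last]; linarith),
            hy, refl_refl, max_comm]
        have h4 : |a x - a y| ≤ |Λ| * ‖y - x‖ := by
          rw [hax, hay, abs_sub_comm, max_sub_min_eq_abs', abs_abs]
          exact hux
        have h5 : a x * φ x - a y * φ y = (a x - a y) * φ x + a y * (φ x - φ y) := by ring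
        have h6 := hC x y
        rw [norm_sub_rev] at h6
        rw [h5]
        calc _ ≤ |a x - a y| * |φ x| + |a y| * |φ x - φ y| := by
              refine (abs_add_le _ _).trans ?_
              rw [abs_mul, abs_mul]
          _ ≤ (|Λ| * ‖y - x‖) * M + 1 * (C * ‖y - x‖) := by
              gcongr
              · exact hM x
              · exact ha1 y
          _ = (2 * |Λ| * M + 2 * C) * |x (Fin.last n) - s| := by rw [hnorm]; ring
          _ ≤ _ := by gcongr; linarith
      · rw [not_or] at hK
        rw [image_eq_zero_of_notMem_tsupport hK.1, image_eq_zero_of_notMem_tsupport hK.2]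
        simp only [mul_zero, sub_zero, abs_zero]
        positivity
  refine ⟨2 * M / δ + 2 * |Λ| * M + 2 * C, fun x => ?_⟩
  rcases lt_trichotomy (x (Fin.last n)) s with hx | hx | hx
  · exact one x hx
  · rw [refl_eq_self hx, sub_self, abs_zero]
    positivity
  · have := one (refl s x) (by rw [refl_last]; linarith)
    rwa [refl_refl, abs_sub_comm, abs_refl_last_sub] at this

lemma MonotoneLastOn.le_of_horiz_eq (hV : MonotoneLastOn V Set.univ) {x y : E n}
    (h1 : horiz x = horiz y) (h2 : x (Fin.last n) ≤ y (Fin.last n)) : V x ≤ V y := by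
  have : y = x + (y (Fin.last n) - x (Fin.last n)) • eLast n :=
    ext_horiz_last (by simp [h1]) (by simp)
  rw [this]
  exact hV x trivial _ (sub_nonneg.2 h2) trivial

/-- Polarization moves larger values upwards, hence respects increasing obstacles. -/
lemma polar_mem {R h s : ℝ} (h0 : 0 ≤ s) (hs : s < h) (hV : MonotoneLastOn V Set.univ)
    (hW : MonotoneLastOn W Set.univ) (hu : ∀ x ∈ slab n R (-h) h, V x ≤ u x ∧ u x ≤ W x)
    {x : E n} (hx : x ∈ slab n R (-h) h) (hxp : x (Fin.last n) ≠ 2 * s - h) :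
    V x ≤ polar h s u x ∧ polar h s u x ≤ W x := by
  have hux := hu x hx
  unfold polar
  split_ifs with hxs
  · refine ⟨le_min hux.1 ?_, (min_le_left _ _).trans hux.2⟩
    rcases lt_or_gt_of_ne hxp with h1 | h1
    · rw [fold_of_ge h1.le]
      refine (hV.le_of_horiz_eq (by simp) ?_).trans (hu (shift (2 * (h - s)) x)
        ⟨by simpa using hx.1, ?_, ?_⟩).1 <;> rw [shift_last] <;> linarith [hx.2.1]
    · rw [fold_of_lt h1]
      refine (hV.le_of_horiz_eq (by simp) ?_).trans (hu (refl s x)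
        ⟨by simpa using hx.1, ?_, ?_⟩).1 <;> rw [refl_last] <;> linarith [hx.2.2]
  · refine ⟨hux.1.trans (le_max_left _ _), max_le hux.2 ?_⟩
    rw [fold_of_lt (by linarith)]
    refine (hu (refl s x) ⟨by simpa using hx.1, ?_, ?_⟩).2.trans
      (hW.le_of_horiz_eq (by simp) ?_) <;> rw [refl_last] <;> linarith [hx.2.2]

/-- The upside-down function `-u(x', -xₙ)`. -/
noncomputable def dual (u : E n → ℝ) (x : E n) : ℝ := -u (flip n x)

lemma flip_mem_slab {R h : ℝ} {x : E n} : flip n x ∈ slab n R (-h) h ↔ x ∈ slab n R (-h) h := by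
  simp only [slab, Set.mem_ofPred_eq, horiz_flip, flip_last]
  constructor <;> rintro ⟨h1, h2, h3⟩ <;> exact ⟨h1, by linarith, by linarith⟩

lemma MemH1.dual {R h : ℝ} (hu : MemH1 (slab n R (-h) h) u) :
    MemH1 (slab n R (-h) h) (dual u) := by
  have h1 := ((MemH1.w12 hu).comp_motion (flip n) 0).neg
  have h2 : motion (flip n) 0 ⁻¹' slab n R (-h) h = slab n R (-h) h := by
    ext x; simp [flip_mem_slab]
  rw [h2] at h1
  have h3 : (fun x => -u (motion (flip n) 0 x)) = FreeBoundary.dual u := by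
    funext x; simp [FreeBoundary.dual]
  exact h3 ▸ h1.memH1

lemma Tame.dual {R h : ℝ} (hu : Tame (slab n R (-h) h) u) : Tame (slab n R (-h) h) (dual u) := by
  refine ⟨hu.memH1.dual, fun x => by simpa [FreeBoundary.dual] using hu.abs_le _, fun K hK hKΩ => ?_⟩
  obtain ⟨r, hr, Λ, hΛ⟩ := hu.lip (flip n '' K) (hK.image (flip n).continuous) (by
    rintro _ ⟨x, hx, rfl⟩
    exact flip_mem_slab.2 (hKΩ hx))
  refine ⟨r, hr, Λ, fun x hx y hy => ?_⟩
  have h1 : ‖flip n y - flip n x‖ = ‖y - x‖ := by rw [← map_sub, (flip n).norm_map]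
  have h2 := hΛ (flip n x) ⟨x, hx, rfl⟩ (flip n y) (by rwa [h1])
  rw [h1] at h2
  simp only [FreeBoundary.dual]
  rw [neg_sub_neg, abs_sub_comm]
  exact h2

lemma MonotoneLastOn.dual (hV : MonotoneLastOn V Set.univ) :
    MonotoneLastOn (dual V) Set.univ := by
  intro x _ t ht _
  refine neg_le_neg (hV.le_of_horiz_eq
    (by rw [horiz_flip, horiz_flip, horiz_add_smul_eLast]) ?_)
  simp only [flip_last, PiLp.add_apply, PiLp.smul_apply, eLast_last, smul_eq_mul, mul_one]
  linarith

/-- Polarization at the height `-s` with even extension across the bottom of the cylinder. -/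
lemma dual_polar_dual_of_lt {h s : ℝ} (hs : s < h) {y : E n} (hy : y (Fin.last n) < -s) :
    dual (polar h s (dual u)) y = min (u y) (u (refl (-s) y)) := by
  have h1 : flip n (refl s (flip n y)) = refl (-s) y :=
    ext_horiz_last (by simp) (by simp; ring)
  simp only [dual, polar]
  rw [if_neg (by rw [flip_last]; linarith), fold_of_lt (by rw [flip_last]; linarith)]
  simp only [dual]
  rw [h1, flip_flip,
    max_neg_neg, neg_neg]

lemma dual_polar_dual_of_gt {h s : ℝ} {y : E n} (hy : -s < y (Fin.last n))
    (hy' : y (Fin.last n) < h - 2 * s) :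
    dual (polar h s (dual u)) y = max (u y) (u (refl (-s) y)) := by
  have h1 : flip n (refl s (flip n y)) = refl (-s) y :=
    ext_horiz_last (by simp) (by simp; ring)
  simp only [dual, polar]
  rw [if_pos (by rw [flip_last]; linarith), fold_of_lt (by rw [flip_last]; linarith)]
  simp only [dual]
  rw [h1, flip_flip,
    min_neg_neg, neg_neg]

lemma dual_polar_dual_of_ge {h s : ℝ} (hs : s < h) {y : E n} (hy : h - 2 * s < y (Fin.last n)) :
    dual (polar h s (dual u)) y = max (u y) (u (shift (-(2 * (h - s))) y)) := by
  have h1 : flip n (shift (2 * (h - s)) (flip n y)) = shift (-(2 * (h - s))) y :=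
    ext_horiz_last (by simp) (by simp; ring)
  simp only [dual, polar]
  rw [if_pos (by rw [flip_last]; linarith), fold_of_ge (by rw [flip_last]; linarith)]
  simp only [dual]
  rw [h1, flip_flip,
    min_neg_neg, neg_neg]

/-- The two polarizations at the heights `s` and `-s` rearrange the values of two copies of `u`: the
cylinder doubled across its top and bottom is a circle in the vertical direction, on which both
arise from one and the same reflection. -/
lemma energy_polar_add {R h s : ℝ} (h0 : 0 ≤ s) (hs : s < h) (hu : Tame (slab n R (-h) h) u) :
    energy (slab n R (-h) h) (polar h s u) +
      energy (slab n R (-h) h) (dual (polar h s (dual u))) = 2 * energy (slab n R (-h) h) u := by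
  have ha := memH1_polar h0 hs hu
  have hb : MemH1 (slab n R (-h) h) (dual (polar h s (dual u))) := (memH1_polar h0 hs hu.dual).dual
  have hm := (isOpen_slab (n := n) R (-h) h).measurableSet
  have sub : ∀ {v : E n → ℝ} {α β : ℝ}, -h ≤ α → β ≤ h → MemH1 (slab n R (-h) h) v →
      MemH1 (slab n R α β) v := fun h1 h2 hv => hv.mono (slab_mono h1 h2) hm
  have cut : ∀ {v : E n → ℝ} {α β : ℝ}, -h ≤ α → α ≤ β → β ≤ h → MemH1 (slab n R (-h) h) v →
      energy (slab n R (-h) h) v = energy (slab n R (-h) α) v + energy (slab n R α β) v +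
        energy (slab n R β h) v := fun {v α β} h1 h2 h3 hv => by
    rw [energy_slab_add (h1.trans h2) h3 hv, energy_slab_add h1 h2 (sub le_rfl h3 hv)]
  have cutu1 := cut (α := 2 * s - h) (β := s) (by linarith) (by linarith) hs.le hu.memH1
  have cuta := cut (α := 2 * s - h) (β := s) (by linarith) (by linarith) hs.le ha
  have cutu2 := cut (α := -s) (β := h - 2 * s) (by linarith) (by linarith) (by linarith) hu.memH1
  have cutb := cut (α := -s) (β := h - 2 * s) (by linarith) (by linarith) (by linarith) hb
  have congr : ∀ {v w : E n → ℝ} {α β : ℝ}, MemH1 (slab n R α β) v →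
      (∀ x ∈ slab n R α β, v x = w x) → energy (slab n R α β) v = energy (slab n R α β) w ∧
        MemH1 (slab n R α β) w := fun {v w α β} hv hvw => by
    have hae : v =ᵐ[volume.restrict (slab n R α β)] w := by
      filter_upwards [ae_restrict_mem (isOpen_slab R α β).measurableSet] with x hx using hvw x hx
    exact ⟨energy_congr (isOpen_slab R α β) hv hae, ((MemH1.w12 hv).congr hae (ae_eq_refl _)).memH1⟩
  -- the values of the two polarizations on the six pieces
  obtain ⟨a1, -⟩ := congr (sub (α := -h) (β := 2 * s - h) le_rfl (by linarith) ha)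
    (w := fun x => min (u x) (u (shift (2 * (h - s)) x))) fun x hx => by
      simp only [polar]
      rw [if_pos (by linarith [hx.2.2]), fold_of_ge hx.2.2.le]
  obtain ⟨a2, -⟩ := congr (sub (α := 2 * s - h) (β := s) (by linarith) hs.le ha)
    (w := fun x => min (u x) (u (refl s x))) fun x hx => by
      simp only [polar]
      rw [if_pos hx.2.2, fold_of_lt hx.2.1]
  obtain ⟨a3, a3'⟩ := congr (sub (α := s) (β := h) (by linarith) le_rfl ha)
    (w := fun x => max (u x) (u (refl s x))) fun x hx => by
      simp only [polar]
      rw [if_neg (not_lt.2 hx.2.1.le), fold_of_lt (by linarith [hx.2.1])]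
  obtain ⟨b1, -⟩ := congr (sub (α := -h) (β := -s) le_rfl (by linarith) hb)
    (w := fun x => min (u x) (u (refl (-s) x))) fun x hx => dual_polar_dual_of_lt hs hx.2.2
  obtain ⟨b2, b2'⟩ := congr (sub (α := -s) (β := h - 2 * s) (by linarith) (by linarith) hb)
    (w := fun x => max (u x) (u (refl (-s) x))) fun x hx => dual_polar_dual_of_gt hx.2.1 hx.2.2
  obtain ⟨b3, b3'⟩ := congr (sub (α := h - 2 * s) (β := h) (by linarith) le_rfl hb)
    (w := fun x => max (u x) (u (shift (-(2 * (h - s))) x))) fun x hx =>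
      dual_polar_dual_of_ge hs hx.2.1
  have p1 := energy_min_add_energy_max_motion (LinearIsometryEquiv.refl ℝ (E n))
    ((2 * (h - s)) • eLast n) (P := slab n R (-h) (2 * s - h)) (Q := slab n R (h - 2 * s) h)
    (v := u) (S := shift (-(2 * (h - s)))) (isOpen_slab _ _ _) (by
      ext x
      change shift (2 * (h - s)) x ∈ slab n R (h - 2 * s) h ↔ x ∈ slab n R (-h) (2 * s - h)
      simp only [slab, Set.mem_ofPred_eq, horiz_shift, shift_last]
      constructor <;> rintro ⟨h1, h2, h3⟩ <;> exact ⟨h1, by linarith, by linarith⟩)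
    (isBounded_slab _ _ _).measure_lt_top (sub le_rfl (by linarith) hu.memH1)
    (sub (by linarith) le_rfl hu.memH1) (fun x => by
      change shift _ (shift _ x) = x
      exact ext_horiz_last (by simp) (by simp)) b3'
  have p2 := energy_min_add_energy_max_motion (flip n) ((2 * s) • eLast n)
    (P := slab n R (2 * s - h) s) (Q := slab n R s h) (v := u) (S := refl s)
    (isOpen_slab _ _ _) (by
      ext x
      change refl s x ∈ slab n R s h ↔ x ∈ slab n R (2 * s - h) s
      simp only [slab, Set.mem_ofPred_eq, horiz_refl, refl_last]
      constructor <;> rintro ⟨h1, h2, h3⟩ <;> exact ⟨h1, by linarith, by linarith⟩)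
    (isBounded_slab _ _ _).measure_lt_top (sub (by linarith) hs.le hu.memH1)
    (sub (by linarith) le_rfl hu.memH1) (refl_refl s) a3'
  have p3 := energy_min_add_energy_max_motion (flip n) ((2 * -s) • eLast n)
    (P := slab n R (-h) (-s)) (Q := slab n R (-s) (h - 2 * s)) (v := u) (S := refl (-s))
    (isOpen_slab _ _ _) (by
      ext x
      change refl (-s) x ∈ slab n R (-s) (h - 2 * s) ↔ x ∈ slab n R (-h) (-s)
      simp only [slab, Set.mem_ofPred_eq, horiz_refl, refl_last]
      constructor <;> rintro ⟨h1, h2, h3⟩ <;> exact ⟨h1, by linarith, by linarith⟩)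
    (isBounded_slab _ _ _).measure_lt_top (sub le_rfl (by linarith) hu.memH1)
    (sub (by linarith) (by linarith) hu.memH1) (refl_refl (-s)) b2'
  change energy _ (fun x => min (u x) (u (shift (2 * (h - s)) x))) + _ = _ at p1
  change energy _ (fun x => min (u x) (u (refl s x))) + _ = _ at p2
  change energy _ (fun x => min (u x) (u (refl (-s) x))) + _ = _ at p3
  linarith

/-! ### Monotone minimizers in a cylinder -/

lemma IsLocalMinimizer.congr {u' : E n → ℝ} (hΩ : IsOpen Ω) (hu : IsLocalMinimizer V W Ω u)
    (h : u =ᵐ[volume.restrict Ω] u') : IsLocalMinimizer V W Ω u' := by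
  refine ⟨⟨((MemH1.w12 hu.1.1).congr h (ae_eq_refl _)).memH1, ?_⟩, fun v hv => ?_⟩
  · filter_upwards [hu.1.2, h] with x hx hx'
    rwa [← hx']
  · rw [← energy_congr hΩ hu.1.1 h]
    exact hu.2 v hv

/-- A minimizer can be modified on a null set of `Ω`, and arbitrarily outside of `Ω`, so that it
becomes continuous in `Ω`. -/
lemma IsLocalMinimizer.exists_tame (h : Obstacles V W) (hΩ : IsOpen Ω)
    (hb : Bornology.IsBounded Ω) (hu : IsLocalMinimizer V W Ω u) :
    ∃ u', u =ᵐ[volume.restrict Ω] u' ∧ ContinuousOn u' Ω ∧ Tame Ω u' ∧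
      ∀ x ∈ Ω, V x ≤ u' x ∧ u' x ≤ W x := by
  obtain ⟨L, hLV, hLW⟩ := h.lip_of_isBounded hb
  have hp := hu.perturbMin h hΩ hb hLV hLW
  have hae : u =ᵐ[volume.restrict Ω] Ω.indicator (rep Ω u) := by
    filter_upwards [hp.rep_ae_eq, ae_restrict_mem hΩ.measurableSet] with x hx hxΩ
    rw [hx, Set.indicator_of_mem hxΩ]
  have hp' := hp.congr hae
  have hc : ContinuousOn (Ω.indicator (rep Ω u)) Ω :=
    hp.continuousOn_rep.congr fun x hx => Set.indicator_of_mem hx _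
  have hmem := hp'.mem_of_continuousOn hc
  have h1 : ∀ x, |Ω.indicator (rep Ω u) x| ≤ 1 := fun x => by
    by_cases hx : x ∈ Ω
    · exact abs_le.2 ⟨(abs_le.1 (h.abs_V x)).1.trans (hmem x hx).1,
        (hmem x hx).2.trans (abs_le.1 (h.abs_W x)).2⟩
    · simp [hx]
  refine ⟨_, hae, hc, ⟨(hu.congr hΩ hae).1.1, h1, fun K hK hKΩ => ?_⟩, hmem⟩
  obtain ⟨δ, hδ, hδΩ⟩ := hK.exists_thickening_subset_open hΩ hKΩ
  obtain ⟨Λ, hΛ⟩ := PerturbMin.exists_lipschitzOnWith n L (r := δ / 3) (by positivity)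
  refine ⟨δ / 3, by positivity, Λ, fun x hx y hy => ?_⟩
  have h2 := hΛ hp' hc h.subharm h.superharm x (by
    rw [mul_div_cancel₀ δ (by norm_num)]
    exact (ball_subset_thickening hx δ).trans hδΩ)
  have h3 := h2.dist_le_mul y (by rwa [mem_ball, dist_eq_norm]) x (mem_ball_self (by positivity))
  rwa [Real.dist_eq, dist_eq_norm] at h3

lemma IsLocalMinimizer.of_energy_add {a b : E n → ℝ} (hu : IsLocalMinimizer V W Ω u)
    (ha : Admissible V W Ω a) (hb : Admissible V W Ω b)
    (h : energy Ω a + energy Ω b = 2 * energy Ω u) :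
    IsLocalMinimizer V W Ω a ∧ IsLocalMinimizer V W Ω b := by
  have h1 := hu.2 a ha
  have h2 := hu.2 b hb
  exact ⟨⟨ha, fun v hv => by linarith [hu.2 v hv]⟩, ⟨hb, fun v hv => by linarith [hu.2 v hv]⟩⟩

lemma admissible_polar {R h s : ℝ} (h0 : 0 ≤ s) (hs : s < h) (hV : MonotoneLastOn V Set.univ)
    (hW : MonotoneLastOn W Set.univ) (ht : Tame (slab n R (-h) h) u)
    (hu : ∀ x ∈ slab n R (-h) h, V x ≤ u x ∧ u x ≤ W x) :
    Admissible V W (slab n R (-h) h) (polar h s u) := by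
  refine ⟨memH1_polar h0 hs ht, ?_⟩
  filter_upwards [ae_restrict_mem (isOpen_slab R (-h) h).measurableSet,
    ae_ne_hyperplane (2 * s - h) _] with x hx hx'
  exact polar_mem h0 hs hV hW hu hx hx'

lemma dual_dual (u : E n → ℝ) : dual (dual u) = u := by
  funext x; simp [dual]

lemma Admissible.dual {R h : ℝ} (hu : Admissible V W (slab n R (-h) h) u) :
    Admissible (dual W) (dual V) (slab n R (-h) h) (dual u) := by
  refine ⟨hu.1.dual, ?_⟩
  have h1 : MeasurePreserving (flip n) volume volume := (flip n).measurePreserving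
  have h2 := (ae_restrict_iff' (isOpen_slab R (-h) h).measurableSet).1 hu.2
  rw [ae_restrict_iff' (isOpen_slab R (-h) h).measurableSet]
  filter_upwards [h1.quasiMeasurePreserving.ae h2] with x hx hxs
  obtain ⟨h3, h4⟩ := hx (flip_mem_slab.2 hxs)
  exact ⟨neg_le_neg h4, neg_le_neg h3⟩

/-- The largest minimizer dominates both of its polarizations, which are minimizers too. Hence it is
increasing. -/
theorem Obstacles.exists_monotone_isLocalMinimizer (h : Obstacles V W)
    (hV : MonotoneLastOn V Set.univ) (hW : MonotoneLastOn W Set.univ) (R H : ℝ) :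
    ∃ u, IsLocalMinimizer V W (cylinder n R H) u ∧ MonotoneLastOn u (cylinder n R H) := by
  rw [cylinder_eq_slab]
  have ho := isOpen_slab (n := n) R (-H) H
  have hb := isBounded_slab (n := n) R (-H) H
  obtain ⟨u₀, hu₀, hmax⟩ := h.exists_largest ho hb
  obtain ⟨u, hae, hc, ht, hmem⟩ := hu₀.exists_tame h ho hb
  have hu := hu₀.congr ho hae
  refine ⟨u, hu, fun x hx t ht0 hy => ?_⟩
  rcases ht0.eq_or_lt with rfl | ht0
  · simp
  set y := x + t • eLast n with hy_def
  have hyl : y (Fin.last n) = x (Fin.last n) + t := by simp [hy_def]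
  set s := x (Fin.last n) + t / 2 with hs_def
  have hxy : refl s y = x := ext_horiz_last (by simp [hy_def]) (by rw [refl_last, hyl, hs_def]; ring)
  have hy2 := hy.2.2
  have hx2 := hx.2.1
  rw [hyl] at hy2
  have key : ∀ {s : ℝ}, 0 ≤ s → s < H →
      polar H s u ≤ᵐ[volume.restrict (slab n R (-H) H)] u ∧
      dual (polar H s (dual u)) ≤ᵐ[volume.restrict (slab n R (-H) H)] u := fun {s} h0 hs => by
    have hb1 := (admissible_polar h0 hs hW.dual hV.dual ht.dual fun x hx =>
      ⟨neg_le_neg (hmem _ (flip_mem_slab.2 hx)).2, neg_le_neg (hmem _ (flip_mem_slab.2 hx)).1⟩).dual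
    rw [dual_dual, dual_dual] at hb1
    obtain ⟨h1, h2⟩ := hu.of_energy_add (admissible_polar h0 hs hV hW ht hmem) hb1
      (energy_polar_add h0 hs ht)
    exact ⟨(hmax _ h1).trans hae.le, (hmax _ h2).trans hae.le⟩
  -- the inequality `u (refl s z) ≤ u z` on a piece of the cylinder above the height `s`
  have concl : ∀ {α β : ℝ}, -H ≤ α → β ≤ H → y ∈ slab n R α β →
      Set.MapsTo (refl s) (slab n R α β) (slab n R (-H) H) →
      (∀ᵐ z ∂(volume.restrict (slab n R (-H) H)), z ∈ slab n R α β → u (refl s z) ≤ u z) →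
      u x ≤ u y := fun {α β} h1 h2 hys hmaps hle => by
    have := le_of_ae_le_of_continuousOn (isOpen_slab (n := n) R α β)
      (hc.comp (refl s).continuous.continuousOn hmaps) (hc.mono (slab_mono h1 h2)) (by
        filter_upwards [ae_restrict_of_ae_restrict_of_subset (slab_mono h1 h2) hle,
          ae_restrict_mem (isOpen_slab R α β).measurableSet] with z hz hzs using hz hzs) y hys
    simpa [hxy] using this
  rcases le_or_gt 0 s with h0 | h0
  · have hs : s < H := by linarith
    refine concl (α := s) (β := H) (by linarith) le_rfl ⟨hy.1, by rw [hyl]; linarith, hy.2.2⟩ ?_ ?_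
    · intro z hz
      refine ⟨by simpa using hz.1, ?_, ?_⟩ <;> rw [refl_last] <;> linarith [hz.2.1, hz.2.2]
    · filter_upwards [(key h0 hs).1] with z hz hzs
      refine le_trans ?_ hz
      unfold polar
      rw [if_neg (not_lt.2 hzs.2.1.le), fold_of_lt (by linarith [hzs.2.1])]
      exact le_max_right _ _
  · have hs : -s < H := by linarith
    refine concl (α := s) (β := H + 2 * s) (by linarith) (by linarith)
      ⟨hy.1, by rw [hyl]; linarith, by rw [hyl]; linarith⟩ ?_ ?_
    · intro z hz
      refine ⟨by simpa using hz.1, ?_, ?_⟩ <;> rw [refl_last] <;> linarith [hz.2.1, hz.2.2]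
    · filter_upwards [(key (by linarith) hs).2] with z hz hzs
      refine le_trans ?_ hz
      rw [dual_polar_dual_of_gt (by linarith [hzs.2.1]) (by linarith [hzs.2.2]), neg_neg]
      exact le_max_right _ _

/-! ### Locally uniform limits of minimizers -/

/-- The Arzelà–Ascoli theorem for sequences that are eventually bounded and uniformly Lipschitz on
each ball. -/
lemma exists_subseq_tendstoLocallyUniformly {v : ℕ → E n → ℝ}
    (hlip : ∀ r : ℝ, ∃ Λ : NNReal, ∀ᶠ k in atTop, LipschitzOnWith Λ (v k) (ball 0 r))
    (hbd : ∀ x, ∀ᶠ k in atTop, |v k x| ≤ 1) :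
    ∃ (φ : ℕ → ℕ) (w : E n → ℝ), StrictMono φ ∧
      TendstoLocallyUniformly (fun k => v (φ k)) w atTop := by
  set d := TopologicalSpace.denseSeq (E n) with hd
  set c : ℕ → ℕ → ℝ := fun k i => max (-1) (min 1 (v k (d i))) with hc
  obtain ⟨a, -, φ, hφ, ha⟩ := (isCompact_univ_pi fun _ : ℕ =>
    isCompact_Icc (a := (-1 : ℝ)) (b := 1)).tendsto_subseq (x := c) fun k i _ =>
      ⟨le_max_left _ _, max_le (by norm_num) (min_le_left _ _)⟩
  rw [tendsto_pi_nhds] at ha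
  have hcau : ∀ i, CauchySeq fun k => v (φ k) (d i) := fun i => by
    refine Tendsto.cauchySeq (x := a i) ((ha i).congr' ?_)
    filter_upwards [hφ.tendsto_atTop.eventually (hbd (d i))] with k hk
    simp only [hc, Function.comp]
    rw [min_eq_right (abs_le.1 hk).2, max_eq_right (abs_le.1 hk).1]
  have hex : ∀ x, ∃ b, Tendsto (fun k => v (φ k) x) atTop (𝓝 b) := fun x => by
    refine cauchySeq_tendsto_of_complete (Metric.cauchySeq_iff'.2 fun ε hε => ?_)
    obtain ⟨Λ, hΛ⟩ := hlip (‖x‖ + 1)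
    set δ := min 1 (ε / (4 * (Λ + 1))) with hδ
    have hδ0 : 0 < δ := by positivity
    obtain ⟨i, hi⟩ := (TopologicalSpace.denseRange_denseSeq (E n)).exists_dist_lt x hδ0
    have hx : x ∈ ball (0 : E n) (‖x‖ + 1) := by simp
    have hdi : d i ∈ ball (0 : E n) (‖x‖ + 1) := by
      rw [mem_ball]
      calc dist (d i) 0 ≤ dist (d i) x + dist x 0 := dist_triangle _ _ _
        _ < 1 + ‖x‖ := by
          rw [dist_zero_right, dist_comm]
          linarith [min_le_left 1 (ε / (4 * ((Λ : ℝ) + 1)))]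
        _ = _ := add_comm _ _
    have hsmall : Λ * dist x (d i) ≤ ε / 4 := by
      calc Λ * dist x (d i) ≤ (Λ + 1) * (ε / (4 * (Λ + 1))) := by
            gcongr
            · linarith
            · exact hi.le.trans (min_le_right _ _)
        _ = ε / 4 := by field_simp
    obtain ⟨N₁, hN₁⟩ := Metric.cauchySeq_iff.1 (hcau i) (ε / 4) (by positivity)
    obtain ⟨N₂, hN₂⟩ := eventually_atTop.1 (hφ.tendsto_atTop.eventually hΛ)
    refine ⟨max N₁ N₂, fun k hk => ?_⟩
    have h1 := hN₁ k (le_trans (le_max_left _ _) hk) (max N₁ N₂) (le_max_left _ _)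
    have h2 := ((hN₂ k (le_trans (le_max_right _ _) hk)).dist_le_mul x hx _ hdi).trans hsmall
    have h3 := ((hN₂ (max N₁ N₂) (le_max_right _ _)).dist_le_mul x hx _ hdi).trans hsmall
    rw [dist_comm] at h3
    have h4 := dist_triangle4 (v (φ k) x) (v (φ k) (d i)) (v (φ (max N₁ N₂)) (d i))
      (v (φ (max N₁ N₂)) x)
    linarith
  choose w hw using hex
  refine ⟨φ, w, hφ, Metric.tendstoLocallyUniformly_iff.2 fun ε hε x => ?_⟩
  obtain ⟨Λ, hΛ⟩ := hlip (‖x‖ + 1)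
  have hΛ' := hφ.tendsto_atTop.eventually hΛ
  set δ := min 1 (ε / (4 * (Λ + 1))) with hδ
  have hδ0 : 0 < δ := by positivity
  have hx : x ∈ ball (0 : E n) (‖x‖ + 1) := by simp
  refine ⟨ball x δ, ball_mem_nhds x hδ0, ?_⟩
  have hwx := Metric.tendsto_nhds.1 (hw x) (ε / 4) (by positivity)
  filter_upwards [hΛ', hwx] with k hk hkx y hy
  have hy' : y ∈ ball (0 : E n) (‖x‖ + 1) := by
    rw [mem_ball] at hy ⊢
    have := dist_triangle y x 0
    rw [dist_zero_right x] at this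
    linarith [min_le_left 1 (ε / (4 * ((Λ : ℝ) + 1)))]
  have hsmall : Λ * dist x y ≤ ε / 4 := by
    rw [mem_ball, dist_comm] at hy
    calc Λ * dist x y ≤ (Λ + 1) * (ε / (4 * (Λ + 1))) := by
          gcongr
          · linarith
          · exact hy.le.trans (min_le_right _ _)
      _ = ε / 4 := by field_simp
  have h1 : dist (v (φ k) x) (v (φ k) y) ≤ ε / 4 := (hk.dist_le_mul x hx y hy').trans hsmall
  have h2 : dist (w x) (w y) ≤ ε / 4 := by
    refine le_of_tendsto ((hw x).dist (hw y)) ?_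
    filter_upwards [hΛ'] with j hj
    exact (hj.dist_le_mul x hx y hy').trans hsmall
  have h3 := dist_triangle4 (w y) (w x) (v (φ k) x) (v (φ k) y)
  rw [dist_comm (w y) (w x), dist_comm (w x) (v (φ k) x)] at h3
  linarith

/-- Comparison of a minimizer `u` in `Ω` with a function `v` that agrees with a Lipschitz function
`w` in the layer `Ω \ O`, when `w` is so close to `u` that a cutoff `ζ` may be used to pass from one
to the other within the layer. -/
lemma PerturbMin.setIntegral_dens_le (h : PerturbMin V W L Ω u g) {Λ : NNReal}
    (hu : LipschitzOnWith Λ u Ω) {w : E n → ℝ} (hw : LipschitzOnWith Λ w Ω) {O : Set (E n)}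
    (hO : IsOpen O) (hOΩ : O ⊆ Ω) {v : E n → ℝ} {k : E n → E n} (hv : W12 Ω v k)
    (hvm : ∀ᵐ x ∂(volume.restrict Ω), V x ≤ v x ∧ v x ≤ W x)
    (hvw : ∀ᵐ x ∂(volume.restrict Ω), x ∉ O → v x = w x)
    {ζ : E n → ℝ} (hζ : IsTestFunction Ω ζ) (hζ01 : ∀ x, ζ x ∈ Set.Icc (0 : ℝ) 1)
    (hζ1 : ∀ x ∈ O, ζ x = 1) (hζg : ∀ x ∈ Ω, |u x - w x| * ‖gradient ζ x‖ ≤ 1) :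
    ∫ x in O, dens u g x ≤
      (∫ x in O, dens v k x) + ((Λ + 1 : ℝ) ^ 2 + 1) * volume.real (Ω \ O) := by
  have hm := h.isOpen.measurableSet
  have : IsFiniteMeasure (volume.restrict Ω) := ⟨by simpa using h.measure_lt_top⟩
  have hgu : ∀ᵐ x ∂(volume.restrict Ω), ‖g x‖ ≤ Λ := by
    filter_upwards [h.w12.unique h.isOpen (W12.of_lipschitzOn hu h.isOpen h.isBounded),
      ae_restrict_mem hm] with x hx hxΩ
    rw [hx]
    exact norm_gradient_le_of_lipschitzOn hu h.isOpen hxΩ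
  have hkw : ∀ᵐ x ∂(volume.restrict Ω), x ∉ O → ‖k x‖ ≤ Λ := by
    filter_upwards [hv.grad_eq_of_eq (W12.of_lipschitzOn hw h.isOpen h.isBounded) h.isOpen, hvw,
      ae_restrict_mem hm] with x hx hxw hxΩ hxO
    rw [hx (hxw hxO)]
    exact norm_gradient_le_of_lipschitzOn hw h.isOpen hxΩ
  set z : E n → ℝ := fun x => u x + ζ x * (v x - u x) with hz
  set q : E n → E n := fun x => g x + (ζ x • (k x - g x) + (v x - u x) • gradient ζ x) with hq
  have hzw : W12 Ω z q := h.w12.add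
    (((hv.sub h.w12).mul_test hm hζ).mono (Set.subset_univ _) MeasurableSet.univ)
  have hmin := h.le z q (tsupport ζ) hzw (by
    filter_upwards [h.mem, hvm] with x h1 h2
    obtain ⟨h3, h4⟩ := hζ01 x
    simp only [hz]
    constructor <;> nlinarith) hζ.2.1 hζ.2.2 (ae_of_all _ fun x hx => by
      simp [hz, image_eq_zero_of_notMem_tsupport hx])
  have hiu : IntegrableOn (dens u g) Ω := integrable_dens h.w12.memLp.1 h.w12.memLp_grad
  have hiz : IntegrableOn (dens z q) Ω := integrable_dens hzw.memLp.1 hzw.memLp_grad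
  have h1 : ∫ x in O, dens u g x ≤ ∫ x in Ω, dens u g x :=
    setIntegral_mono_set hiu (ae_of_all _ fun x => dens_nonneg _ _ _) hOΩ.eventuallyLE
  have h2 : ∫ x in Ω, dens z q x = (∫ x in O, dens z q x) + ∫ x in Ω \ O, dens z q x := by
    rw [← setIntegral_union Set.disjoint_sdiff_right (hm.diff hO.measurableSet)
      (hiz.mono_set hOΩ) (hiz.mono_set Set.sdiff_subset), Set.union_sdiff_cancel hOΩ]
  have h3 : ∫ x in O, dens z q x = ∫ x in O, dens v k x := by
    refine setIntegral_congr_fun hO.measurableSet fun x hx => dens_congr ?_ ?_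
    · simp [hz, hζ1 x hx]
    · have : gradient ζ x = 0 := gradient_eq_zero_of_eventually_const (c := 1) (by
        filter_upwards [hO.mem_nhds hx] with y hy using hζ1 y hy)
      simp [hq, hζ1 x hx, this]
  have h4 : ∫ x in Ω \ O, dens z q x ≤ ∫ _ in Ω \ O, ((Λ + 1 : ℝ) ^ 2 + 1) := by
    refine setIntegral_mono_ae_restrict (hiz.mono_set Set.sdiff_subset)
      (integrableOn_const ((measure_mono Set.sdiff_subset).trans_lt h.measure_lt_top).ne) ?_
    filter_upwards [ae_restrict_of_ae_restrict_of_subset Set.sdiff_subset hgu,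
      ae_restrict_of_ae_restrict_of_subset Set.sdiff_subset hkw,
      ae_restrict_of_ae_restrict_of_subset Set.sdiff_subset hvw,
      ae_restrict_mem (hm.diff hO.measurableSet)] with x hx1 hx2 hx3 hx4
    refine add_le_add ?_ (indicator_interphase_le_one _ _)
    gcongr
    obtain ⟨h5, h6⟩ := hζ01 x
    have h7 : q x = (1 - ζ x) • g x + (ζ x • k x + (v x - u x) • gradient ζ x) := by
      simp only [hq]; module
    have h8 : ‖(v x - u x) • gradient ζ x‖ ≤ 1 := by
      rw [norm_smul, hx3 hx4.2, Real.norm_eq_abs, abs_sub_comm]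
      exact hζg x hx4.1
    rw [h7]
    calc _ ≤ ‖(1 - ζ x) • g x‖ + (‖ζ x • k x‖ + ‖(v x - u x) • gradient ζ x‖) :=
          (norm_add_le _ _).trans (by gcongr; exact norm_add_le _ _)
      _ ≤ (1 - ζ x) * Λ + (ζ x * Λ + 1) := by
          rw [norm_smul, norm_smul, Real.norm_eq_abs, Real.norm_eq_abs, abs_of_nonneg h5,
            abs_of_nonneg (sub_nonneg.2 h6)]
          have := sub_nonneg.2 h6
          gcongr
          exact hx2 hx4.2
      _ = Λ + 1 := by ring
  rw [setIntegral_const, smul_eq_mul, mul_comm] at h4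
  linarith

/-- A sequence whose members are eventually minimizers on each ball, with a uniform Lipschitz
constant there. -/
def MinSeq (V W : E n → ℝ) (v : ℕ → E n → ℝ) : Prop :=
  ∀ r : ℝ, ∃ L Λ : NNReal, ∀ᶠ k in atTop, LipschitzOnWith Λ (v k) (ball 0 r) ∧
    ∃ g, PerturbMin V W L (ball 0 r) (v k) g

lemma MinSeq.comp {v : ℕ → E n → ℝ} (h : MinSeq V W v) {φ : ℕ → ℕ} (hφ : StrictMono φ) :
    MinSeq V W fun k => v (φ k) := fun r => by
  obtain ⟨L, Λ, hk⟩ := h r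
  exact ⟨L, Λ, hφ.tendsto_atTop.eventually hk⟩

lemma TendstoLocallyUniformly.tendsto_apply {v : ℕ → E n → ℝ} {w : E n → ℝ}
    (h : TendstoLocallyUniformly v w atTop) (x : E n) :
    Tendsto (fun k => v k x) atTop (𝓝 (w x)) :=
  (tendstoLocallyUniformlyOn_univ.2 h).tendsto_at (Set.mem_univ x)

lemma MinSeq.exists_lipschitzOnWith {v : ℕ → E n → ℝ} {w : E n → ℝ} (h : MinSeq V W v)
    (hw : TendstoLocallyUniformly v w atTop) (r : ℝ) :
    ∃ Λ : NNReal, LipschitzOnWith Λ w (ball 0 r) := by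
  obtain ⟨_, Λ, hk⟩ := h r
  refine ⟨Λ, LipschitzOnWith.of_dist_le_mul fun x hx y hy => ?_⟩
  refine le_of_tendsto ((TendstoLocallyUniformly.tendsto_apply hw x).dist
    (TendstoLocallyUniformly.tendsto_apply hw y)) ?_
  filter_upwards [hk] with k hk
  exact hk.1.dist_le_mul x hx y hy

lemma MinSeq.mem {v : ℕ → E n → ℝ} {w : E n → ℝ} (h : MinSeq V W v)
    (hw : TendstoLocallyUniformly v w atTop) (x : E n) : V x ≤ w x ∧ w x ≤ W x := by
  obtain ⟨_, Λ, hk⟩ := h (‖x‖ + 1)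
  have h1 : ∀ᶠ k in atTop, V x ≤ v k x ∧ v k x ≤ W x := by
    filter_upwards [hk] with k ⟨hl, g, hp⟩
    exact hp.mem_of_continuousOn hl.continuousOn x (by simp)
  have h2 := TendstoLocallyUniformly.tendsto_apply hw x
  exact ⟨ge_of_tendsto h2 (h1.mono fun _ h => h.1), le_of_tendsto h2 (h1.mono fun _ h => h.2)⟩

/-- The boundary of a convex set is a null set, so thin layers around it have small volume. -/
lemma exists_thickening_volume_le {O B : Set (E n)} (hO : IsOpen O) (hOc : Convex ℝ O)
    (hOB : closure O ⊆ B) (hB : IsOpen B) (hBb : Bornology.IsBounded B) {ε : ℝ} (hε : 0 < ε) :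
    ∃ δ > 0, thickening δ O ⊆ B ∧ volume.real (thickening δ O \ O) ≤ ε := by
  have hOb : Bornology.IsBounded O := hBb.subset (subset_closure.trans hOB)
  have hc : IsCompact (closure O) := hOb.isCompact_closure
  obtain ⟨δ₀, hδ₀, hδB⟩ := hc.exists_thickening_subset_open hB hOB
  rw [thickening_closure] at hδB
  have hfin : ∀ δ, volume (thickening δ O) ≠ ⊤ := fun δ => hOb.thickening.measure_lt_top.ne
  have hcl : volume (closure O) = volume O := by
    refine le_antisymm ?_ (measure_mono subset_closure)
    calc volume (closure O) ≤ volume (O ∪ frontier O) := measure_mono (by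
          rw [← closure_eq_self_union_frontier])
      _ ≤ volume O + volume (frontier O) := measure_union_le _ _
      _ = volume O := by rw [hOc.addHaar_frontier volume, add_zero]
  have ht := tendsto_measure_thickening (μ := volume) (s := O) ⟨1, one_pos, hfin 1⟩
  rw [hcl] at ht
  have ht' := (ENNReal.tendsto_toReal hOb.measure_lt_top.ne).comp ht
  have h1 := ht'.eventually (gt_mem_nhds (show (volume O).toReal < (volume O).toReal + ε by linarith))
  have h2 : ∀ᶠ δ in 𝓝[>] (0 : ℝ), δ < δ₀ := (gt_mem_nhds hδ₀).filter_mono nhdsWithin_le_nhds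
  obtain ⟨δ, h3, h4, h5⟩ := (h1.and (h2.and self_mem_nhdsWithin)).exists
  refine ⟨δ, h5, (thickening_mono h4.le O).trans hδB, ?_⟩
  rw [measureReal_sdiff (self_subset_thickening h5 O) hO.measurableSet (hfin δ)]
  · have h6 : (volume (thickening δ O)).toReal < (volume O).toReal + ε := h3
    simp only [measureReal_def]
    linarith

/-- A locally uniform limit of minimizers minimizes in every bounded convex open set `O`, among all
Sobolev functions that agree with it outside of `O`. -/
lemma MinSeq.setIntegral_dens_le {v : ℕ → E n → ℝ} {w : E n → ℝ} (h : MinSeq V W v)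
    (hw : TendstoLocallyUniformly v w atTop)
    {O : Set (E n)} (hO : IsOpen O)
    (hOc : Convex ℝ O) {r : ℝ} (hOr : closure O ⊆ ball 0 r) {z : E n → ℝ} {k : E n → E n}
    (hz : W12 (ball 0 r) z k) (hzm : ∀ᵐ x ∂(volume.restrict (ball 0 r)), V x ≤ z x ∧ z x ≤ W x)
    (hzw : ∀ᵐ x ∂(volume.restrict (ball 0 r)), x ∉ O → z x = w x) :
    ∫ x in O, dens w (gradient w) x ≤ ∫ x in O, dens z k x := by
  obtain ⟨L, Λ, hk⟩ := h r
  obtain ⟨Λ', hΛ'⟩ := h.exists_lipschitzOnWith hw r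
  set Λ₁ := max Λ Λ' with hΛ₁
  have hOb : Bornology.IsBounded O := isBounded_ball.subset (subset_closure.trans hOr)
  have hOr' : O ⊆ ball 0 r := subset_closure.trans hOr
  refine le_of_forall_pos_le_add fun ε hε => ?_
  obtain ⟨δ, hδ, hδr, hδv⟩ := exists_thickening_volume_le hO hOc hOr isOpen_ball isBounded_ball
    (show 0 < ε / ((Λ₁ + 1 : ℝ) ^ 2 + 1) by positivity)
  set B := thickening δ O with hB
  have hBo : IsOpen B := isOpen_thickening
  have hOB : O ⊆ B := self_subset_thickening hδ O
  obtain ⟨ζ, hζ, hζ01, hζ1⟩ := exists_cutoff hOb.isCompact_closure hBo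
    ((closure_subset_thickening hδ O))
  rw [eventually_nhdsSet_iff_forall] at hζ1
  obtain ⟨D, hD⟩ := (HasCompactSupport.gradient hζ.2.1).exists_bound_of_continuous
    (ContDiff.continuous_gradient hζ.1)
  have hD0 : 0 ≤ D := (norm_nonneg _).trans (hD 0)
  have hunif := Metric.tendstoUniformlyOn_iff.1 (tendstoLocallyUniformly_iff_forall_isCompact.1 hw
    (closedBall 0 r) (isCompact_closedBall 0 r)) (1 / (D + 1)) (by positivity)
  have hev : ∀ᶠ j in atTop, ∃ g, W12 O (v j) g ∧ (∀ᵐ x ∂(volume.restrict O), |v j x| ≤ 1) ∧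
      ∫ x in O, dens (v j) g x ≤ (∫ x in O, dens z k x) + ε := by
    filter_upwards [hk, hunif] with j ⟨hl, g, hp⟩ hj
    refine ⟨g, hp.w12.mono hOr' measurableSet_ball,
      ae_restrict_of_ae_restrict_of_subset hOr' hp.abs_le_one, ?_⟩
    have h1 := (hp.mono hBo hδr (hp.lipV.mono hδr) (hp.lipW.mono hδr)).setIntegral_dens_le
      (Λ := Λ₁) ((hl.mono hδr).weaken (le_max_left _ _)) ((hΛ'.mono hδr).weaken (le_max_right _ _))
      hO hOB (hz.mono hδr measurableSet_ball) (ae_restrict_of_ae_restrict_of_subset hδr hzm)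
      (ae_restrict_of_ae_restrict_of_subset hδr hzw) hζ hζ01
      (fun x hx => (hζ1 x (subset_closure hx)).self_of_nhds) fun x hx => by
        have h2 := (hj x (ball_subset_closedBall (hδr hx))).le
        rw [dist_comm, Real.dist_eq] at h2
        calc _ ≤ 1 / (D + 1) * (D + 1) := by
              gcongr
              linarith [hD x]
          _ = 1 := by field_simp
    refine h1.trans ?_
    gcongr
    calc _ ≤ ((Λ₁ + 1 : ℝ) ^ 2 + 1) * (ε / ((Λ₁ + 1 : ℝ) ^ 2 + 1)) := by gcongr
      _ = ε := by field_simp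
  obtain ⟨N, hN⟩ := eventually_atTop.1 hev
  choose g hg hg1 hgε using fun j => hN (N + j) (by omega)
  obtain ⟨q, hq, hqc⟩ := W12.exists_of_tendsto_of_energy_le hOb.measure_lt_top hg hg1
    (ae_of_all _ fun x => (tendsto_add_atTop_iff_nat N).2
      (TendstoLocallyUniformly.tendsto_apply hw x) |>.congr fun j => by rw [add_comm])
    hgε tendsto_const_nhds
  rwa [integral_congr_ae (dens_congr_ae (ae_eq_refl w)
    ((W12.of_lipschitzOn (hΛ'.mono hOr') hO hOb).unique hO hq))]

/-- Extension by zero of functions in `H¹₀(Ω)`. -/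
lemma MemH10.extend_zero {v : E n → ℝ} (hv : MemH10 Ω v) (hΩ : MeasurableSet Ω) :
    W12 Set.univ (Ω.indicator v) (Ω.indicator (weakGradient Ω v)) := by
  obtain ⟨hv1, φ, hφ, h1, h2⟩ := hv
  have hw := MemH1.w12 hv1
  refine ⟨?_, ?_, fun ψ hψ => ?_⟩
  · rw [Measure.restrict_univ]; exact (memLp_indicator_iff_restrict hΩ).2 hw.memLp
  · rw [Measure.restrict_univ]; exact (memLp_indicator_iff_restrict hΩ).2 hw.memLp_grad
  have e1 : ∀ x, Ω.indicator v x • gradient ψ x = Ω.indicator (fun x => v x • gradient ψ x) x :=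
    fun x => by by_cases hx : x ∈ Ω <;> simp [hx]
  have e2 : ∀ x, ψ x • Ω.indicator (weakGradient Ω v) x =
      Ω.indicator (fun x => ψ x • weakGradient Ω v x) x :=
    fun x => by by_cases hx : x ∈ Ω <;> simp [hx]
  simp_rw [e1, e2]
  rw [Measure.restrict_univ, integral_indicator hΩ, integral_indicator hΩ]
  have mψ : MemLp ψ 2 (volume.restrict Ω) := hψ.memLp
  have mψ' : MemLp (gradient ψ) 2 (volume.restrict Ω) := hψ.memLp_gradient
  have mφ : ∀ k, MemLp (φ k) 2 (volume.restrict Ω) := fun k => (hφ k).memLp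
  have mφ' : ∀ k, MemLp (gradient (φ k)) 2 (volume.restrict Ω) := fun k => (hφ k).memLp_gradient
  have t1 : Tendsto (fun k => ∫ x in Ω, φ k x • gradient ψ x) atTop
      (𝓝 (∫ x in Ω, v x • gradient ψ x)) := by
    refine tendsto_integral_of_L1' _ (MemLp.integrable_smul_two hw.memLp mψ').1
      (Eventually.of_forall fun k => MemLp.integrable_smul_two (mφ k) mψ') ?_
    refine tendsto_of_tendsto_of_tendsto_of_le_of_le tendsto_const_nhds
      (h := fun k => eLpNorm (fun x => φ k x - v x) 2 (volume.restrict Ω) *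
        eLpNorm (gradient ψ) 2 (volume.restrict Ω)) ?_ (fun _ => zero_le) fun k => ?_
    · simpa using ENNReal.Tendsto.mul_const h1 (Or.inr mψ'.eLpNorm_ne_top)
    · have := eLpNorm_smul_le_mul_eLpNorm (p := 2) (q := 2) (r := 1) mψ'.1
        (φ := fun x => φ k x - v x) ((mφ k).1.sub hw.memLp.1)
      refine le_trans (le_of_eq ?_) this
      congr 1
      funext x
      simp [sub_smul]
  have t2 : Tendsto (fun k => ∫ x in Ω, ψ x • gradient (φ k) x) atTop
      (𝓝 (∫ x in Ω, ψ x • weakGradient Ω v x)) := by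
    refine tendsto_integral_of_L1' _ (MemLp.integrable_smul_two mψ hw.memLp_grad).1
      (Eventually.of_forall fun k => MemLp.integrable_smul_two mψ (mφ' k)) ?_
    refine tendsto_of_tendsto_of_tendsto_of_le_of_le tendsto_const_nhds
      (h := fun k => eLpNorm ψ 2 (volume.restrict Ω) *
        eLpNorm (fun x => gradient (φ k) x - weakGradient Ω v x) 2 (volume.restrict Ω)) ?_
      (fun _ => zero_le) fun k => ?_
    · simpa using ENNReal.Tendsto.const_mul h2 (Or.inr mψ.eLpNorm_ne_top)
    · have := eLpNorm_smul_le_mul_eLpNorm (p := 2) (q := 2) (r := 1)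
        (f := fun x => gradient (φ k) x - weakGradient Ω v x) ((mφ' k).1.sub hw.memLp_grad.1) mψ.1
      refine le_trans (le_of_eq ?_) this
      congr 1
      funext x
      simp [smul_sub]
  refine tendsto_nhds_unique t1 (t2.neg.congr fun k => ?_)
  have h0 : W12 Set.univ (φ k) (gradient (φ k)) := (hφ k).w12
  have h3 := h0.2.2 ψ hψ
  rw [Measure.restrict_univ] at h3
  rw [setIntegral_eq_integral_of_forall_compl_eq_zero fun x hx => by
      rw [gradient_eq_zero_of_notMem_tsupport fun h => hx ((hφ k).2.2 h), smul_zero],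
    setIntegral_eq_integral_of_forall_compl_eq_zero fun x hx => by
      rw [image_eq_zero_of_notMem_tsupport fun h => hx ((hφ k).2.2 h), zero_smul], h3]

/-! ### Properties of the limit -/

lemma convex_cylinderAt (c : E n) (R h : ℝ) : Convex ℝ (cylinderAt c R h) := by
  intro x hx y hy a b ha hb hab
  have h1 := convex_ball (horiz c) R (mem_ball_iff_norm.2 hx.1) (mem_ball_iff_norm.2 hy.1) ha hb hab
  have h2 := convex_ball (c (Fin.last n)) h (mem_ball_iff_norm.2 hx.2) (mem_ball_iff_norm.2 hy.2)
    ha hb hab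
  rw [mem_ball_iff_norm] at h1 h2
  refine ⟨?_, ?_⟩
  · have : horiz (a • x + b • y) = a • horiz x + b • horiz y := by ext i; simp [horiz]
    rwa [this]
  · simpa using h2

/-- The limit is a minimizer of the free boundary problem. -/
lemma MinSeq.isGlobalMinimizer {v : ℕ → E n → ℝ} {w : E n → ℝ} (h : MinSeq V W v)
    (hw : TendstoLocallyUniformly v w atTop) : IsGlobalMinimizer V W w := by
  intro c R H _ _
  set O := cylinderAt c R H with hOdef
  have hO : IsOpen O := isOpen_cylinderAt c R H
  have hOb : Bornology.IsBounded O := isBounded_cylinderAt c R H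
  obtain ⟨r, hr⟩ := hOb.isCompact_closure.isBounded.subset_ball 0
  have hOr : O ⊆ ball 0 r := subset_closure.trans hr
  obtain ⟨Λ, hΛ⟩ := h.exists_lipschitzOnWith hw r
  have hwr : W12 (ball 0 r) w (gradient w) := W12.of_lipschitzOn hΛ isOpen_ball isBounded_ball
  have hwO := hwr.mono hOr measurableSet_ball
  refine ⟨⟨hwO.memH1, ae_of_all _ fun x => h.mem hw x⟩, fun v hv hvw => ?_⟩
  have hz := hwr.add ((MemH10.extend_zero hvw hO.measurableSet).mono (Set.subset_univ (ball 0 r))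
    MeasurableSet.univ)
  have hle := h.setIntegral_dens_le hw hO (convex_cylinderAt c R H) hr hz ?_
    (ae_of_all _ fun x hx => by simp [Set.indicator_of_notMem hx])
  · have hzO := hz.mono hOr measurableSet_ball
    rw [← hwO.energy_eq hO, ← hzO.energy_eq hO] at hle
    rwa [energy_congr hO hv.1 (w := fun x => w x + O.indicator (fun x => v x - w x) x)]
    filter_upwards [ae_restrict_mem hO.measurableSet] with x hx
    simp [Set.indicator_of_mem hx]
  · have hv2 := (ae_restrict_iff' hO.measurableSet).1 hv.2
    filter_upwards [ae_restrict_of_ae hv2] with x hx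
    by_cases hxO : x ∈ O
    · simpa [Set.indicator_of_mem hxO] using hx hxO
    · simpa [Set.indicator_of_notMem hxO] using h.mem hw x

/-- The limit inherits the minimality under compactly supported perturbations on every ball. -/
lemma MinSeq.perturbMin {v : ℕ → E n → ℝ} {w : E n → ℝ} (h : MinSeq V W v)
    (hw : TendstoLocallyUniformly v w atTop) (r : ℝ) :
    ∃ L, PerturbMin V W L (ball 0 r) w (gradient w) := by
  obtain ⟨L, Λ, hk⟩ := h r
  obtain ⟨Λ', hΛ⟩ := h.exists_lipschitzOnWith hw (r + 1)
  have hsub : ball (0 : E n) r ⊆ ball 0 (r + 1) := ball_subset_ball (by linarith)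
  have hwr : W12 (ball 0 (r + 1)) w (gradient w) :=
    W12.of_lipschitzOn hΛ isOpen_ball isBounded_ball
  obtain ⟨k, -, g, hp⟩ := hk.exists
  refine ⟨L, isOpen_ball, isBounded_ball, hp.lipV, hp.lipW, hp.abs_V, hp.abs_W,
    hwr.mono hsub measurableSet_ball, ae_of_all _ fun x => h.mem hw x, ?_⟩
  intro z k K hz hzm hK hKr hzw
  have hext := (hz.sub (hwr.mono hsub measurableSet_ball)).extend_zero isOpen_ball hK hKr (by
    filter_upwards [hzw] with x hx hxK
    rw [hx hxK, sub_self])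
  have hz' := hwr.add (hext.mono (Set.subset_univ (ball 0 (r + 1))) MeasurableSet.univ)
  have hae : (fun x => w x + K.indicator (fun x => z x - w x) x)
      =ᵐ[volume.restrict (ball 0 r)] z := by
    filter_upwards [hzw] with x hx
    by_cases hxK : x ∈ K
    · simp [hxK]
    · simp [hxK, hx hxK]
  have hle := h.setIntegral_dens_le hw isOpen_ball (convex_ball 0 r)
    (closure_ball_subset_closedBall.trans (closedBall_subset_ball (by linarith))) hz' ?_
    (ae_of_all _ fun x hx => by simp [Set.indicator_of_notMem fun h => hx (hKr h)])
  · refine hle.trans_eq (integral_congr_ae (dens_congr_ae hae ?_))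
    exact ((hz'.mono hsub measurableSet_ball).congr hae (ae_eq_refl _)).unique isOpen_ball hz
  · have hzm' := (ae_restrict_iff' measurableSet_ball).1 hzm
    filter_upwards [ae_restrict_of_ae hzm'] with x hx
    by_cases hxK : x ∈ K
    · simpa [hxK] using hx (hKr hxK)
    · simpa [hxK] using h.mem hw x

lemma integral_inner_gradient_eq_neg {m φ : E n → ℝ} (hm : ContDiff ℝ ∞ m)
    (hφ : IsTestFunction Ω φ) :
    ∫ x, inner ℝ (gradient m x) (gradient φ x) = - ∫ x, φ x * (Δ m) x := by
  set b := EuclideanSpace.basisFun (Fin (n + 1)) ℝ with hb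
  have hm1 : ∀ i, ContDiff ℝ ∞ fun y => fderiv ℝ m y (b i) := fun i =>
    (hm.fderiv_right (m := ∞) (by simp)).clm_apply contDiff_const
  have hφ1 : ∀ i, Continuous fun y => fderiv ℝ φ y (b i) := fun i =>
    (hφ.1.continuous_fderiv (by simp)).clm_apply continuous_const
  have hφs : ∀ i, HasCompactSupport fun y => fderiv ℝ φ y (b i) := fun i =>
    (hφ.2.1.fderiv ℝ).comp_left (g := fun l : E n →L[ℝ] ℝ => l (b i)) (by simp)
  have hm2 : ∀ i, Continuous fun y => fderiv ℝ (fun y => fderiv ℝ m y (b i)) y (b i) := fun i =>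
    ((hm1 i).continuous_fderiv (by simp)).clm_apply continuous_const
  have i1 : ∀ i, Integrable fun x => fderiv ℝ m x (b i) * fderiv ℝ φ x (b i) := fun i =>
    ((hm1 i).continuous.mul (hφ1 i)).integrable_of_hasCompactSupport (hφs i).mul_left
  have i2 : ∀ i, Integrable fun x => fderiv ℝ (fun y => fderiv ℝ m y (b i)) x (b i) * φ x :=
    fun i => ((hm2 i).mul hφ.1.continuous).integrable_of_hasCompactSupport hφ.2.1.mul_left
  have i3 : ∀ i, Integrable fun x => fderiv ℝ m x (b i) * φ x := fun i =>
    ((hm1 i).continuous.mul hφ.1.continuous).integrable_of_hasCompactSupport hφ.2.1.mul_left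
  have e1 : ∀ x, inner ℝ (gradient m x) (gradient φ x) =
      ∑ i, fderiv ℝ m x (b i) * fderiv ℝ φ x (b i) := fun x => by
    rw [← b.sum_inner_mul_inner]
    refine Finset.sum_congr rfl fun i _ => ?_
    rw [fderiv_eq_inner_gradient, fderiv_eq_inner_gradient, real_inner_comm (gradient φ x)]
  have e2 : ∀ x, φ x * (Δ m) x = ∑ i, fderiv ℝ (fun y => fderiv ℝ m y (b i)) x (b i) * φ x :=
    fun x => by
      rw [laplacian_eq_sum_fderiv (contDiff_infty.1 hm 2).contDiffAt, mul_comm, Finset.sum_mul]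
  simp_rw [e1, e2]
  rw [integral_finsetSum _ fun i _ => i1 i, integral_finsetSum _ fun i _ => i2 i,
    ← Finset.sum_neg_distrib]
  exact Finset.sum_congr rfl fun i _ => integral_mul_fderiv_eq_neg_fderiv_mul_of_integrable (i2 i)
    (i1 i) (i3 i) (fun x _ => (hm1 i).differentiable (by simp) x)
    fun x _ => hφ.1.differentiable (by simp) x

/-- In the interphase, a continuous minimizer agrees locally with its mollification, hence is
smooth and satisfies the Laplace equation in the classical sense. -/
lemma PerturbMin.harmonicAt (h : PerturbMin V W L Ω u g) (hu : ContinuousOn u Ω)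
    (hVs : WeakSubharm V) (hWs : WeakSubharm fun x => -W x) {x₀ : E n} (hx₀ : x₀ ∈ Ω)
    (hux₀ : |u x₀| < 1) : InnerProductSpace.HarmonicAt u x₀ := by
  have hopen : {x | x ∈ Ω ∧ |u x| < 1} ∈ 𝓝 x₀ := by
    filter_upwards [h.isOpen.mem_nhds hx₀,
      (hu.continuousAt (h.isOpen.mem_nhds hx₀)).abs.eventually (gt_mem_nhds hux₀)] with x h1 h2
    exact ⟨h1, h2⟩
  obtain ⟨d, hd, hdsub⟩ := Metric.mem_nhds_iff.1 hopen
  set s := d / 2 with hs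
  have hs0 : 0 < s := by positivity
  have hsub : ∀ x ∈ ball x₀ s, closedBall x s ⊆ ball x₀ d := fun x hx y hy => by
    rw [mem_ball] at hx ⊢
    rw [mem_closedBall] at hy
    linarith [dist_triangle y x x₀]
  have hball : ball x₀ s ⊆ Ω := fun x hx => (hdsub (ball_subset_ball (by linarith) hx)).1
  set m := mol s (Ω.indicator u) with hm
  have hmc : ContDiff ℝ ∞ m := mol_contDiff hs0 h.locallyIntegrable
  have hum : ∀ x ∈ ball x₀ s, u x = m x := fun x hx => by
    rw [hm, mol_indicator h.measurableSet]
    exact (h.mol_eq hu hVs hWs hs0 (fun y hy => (hdsub (hsub x hx hy)).1)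
      fun y hy => (hdsub (hsub x hx hy)).2).symm
  have hev : ∀ x ∈ ball x₀ s, u =ᶠ[𝓝 x] m := fun x hx => by
    filter_upwards [isOpen_ball.mem_nhds hx] with y hy using hum y hy
  have hgm : g =ᵐ[volume.restrict (ball x₀ s)] gradient m :=
    (h.w12.mono hball h.measurableSet).unique isOpen_ball
      ((W12.of_contDiff_of_isBounded isBounded_ball hmc).congr (by
        filter_upwards [ae_restrict_mem measurableSet_ball] with x hx using (hum x hx).symm)
        (ae_eq_refl _))
  have hΔc : Continuous (Δ m) := by
    have : (Δ m) = fun x => ∑ i, fderiv ℝ (fun y => fderiv ℝ m y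
        (EuclideanSpace.basisFun (Fin (n + 1)) ℝ i)) x
          (EuclideanSpace.basisFun (Fin (n + 1)) ℝ i) :=
      funext fun x => laplacian_eq_sum_fderiv (contDiff_infty.1 hmc 2).contDiffAt
    rw [this]
    refine continuous_finsetSum _ fun i _ => ?_
    exact (((hmc.fderiv_right (m := ∞) (by simp)).clm_apply contDiff_const).continuous_fderiv
      (by simp)).clm_apply continuous_const
  -- the equation in its weak form
  have hweak : ∀ φ, IsTestFunction (ball x₀ s) φ → (∀ x, 0 ≤ φ x) → ∫ x, φ x * (Δ m) x = 0 := by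
    intro φ hφ hφ0
    have h1 := h.integral_inner_eq_zero hu hVs hWs (hφ.mono hball) hφ0 fun x hx =>
      (hdsub (ball_subset_ball (by linarith) (hφ.2.2 hx))).2
    have hz : ∀ x ∉ ball x₀ s, gradient φ x = 0 := fun x hx =>
      gradient_eq_zero_of_notMem_tsupport fun h => hx (hφ.2.2 h)
    have h2 : ∫ x, inner ℝ (gradient m x) (gradient φ x) = 0 := by
      rw [← h1, setIntegral_eq_of_subset_of_forall_sdiff_eq_zero h.measurableSet hball fun x hx => by
        rw [hz x hx.2, inner_zero_right],
        ← setIntegral_eq_integral_of_forall_compl_eq_zero (s := ball x₀ s) fun x hx => by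
          rw [hz x hx, inner_zero_right]]
      refine integral_congr_ae ?_
      filter_upwards [hgm] with x hx
      rw [hx]
    rw [integral_inner_gradient_eq_neg hmc hφ, neg_eq_zero] at h2
    exact h2
  -- a sign of the Laplacian near a point contradicts the weak form
  have hsign : ∀ x ∈ ball x₀ s, ∀ σ : ℝ, ¬ 0 < σ * (Δ m) x := by
    intro x hx σ hpos
    have hc : Continuous fun y => σ * (Δ m) y := continuous_const.mul hΔc
    obtain ⟨t, ht, htsub⟩ := Metric.mem_nhds_iff.1 (inter_mem (isOpen_ball.mem_nhds hx)
      (hc.continuousAt.eventually (lt_mem_nhds hpos)))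
    have ht2 : 0 < t / 2 := by positivity
    set φ : E n → ℝ := fun y => ker (t / 2) (y - x) with hφdef
    have hφc : ContDiff ℝ ∞ φ := (ker_contDiff n (t / 2)).comp (contDiff_id.sub contDiff_const)
    have hφz : ∀ y ∉ closedBall x (t / 2), φ y = 0 := fun y hy => by
      rw [mem_closedBall_iff_norm, not_le] at hy
      exact ker_eq_zero ht2 hy.le
    have hφs : tsupport φ ⊆ closedBall x (t / 2) :=
      closure_minimal (fun y hy => by_contra fun h => hy (hφz y h)) isClosed_closedBall
    have hφK : HasCompactSupport φ :=
      (isCompact_closedBall x (t / 2)).of_isClosed_subset (isClosed_tsupport _) hφs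
    have hcb : closedBall x (t / 2) ⊆ ball x t := closedBall_subset_ball (by linarith)
    have h1 := hweak φ ⟨hφc, hφK, (hφs.trans hcb).trans fun y hy => (htsub hy).1⟩
      fun y => ker_nonneg ht2 _
    have hcont : Continuous fun y => φ y * (σ * (Δ m) y) := hφc.continuous.mul hc
    have hnn : ∀ y, 0 ≤ φ y * (σ * (Δ m) y) := fun y => by
      by_cases hy : y ∈ closedBall x (t / 2)
      · exact mul_nonneg (ker_nonneg ht2 _) (htsub (hcb hy)).2.le
      · rw [hφz y hy, zero_mul]
    have h2 : ∫ y, φ y * (σ * (Δ m) y) = 0 := by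
      have : ∀ y, φ y * (σ * (Δ m) y) = σ * (φ y * (Δ m) y) := fun y => by ring
      simp_rw [this]
      rw [integral_const_mul, h1, mul_zero]
    have h3 := (hcont.integral_pos_of_hasCompactSupport_nonneg_nonzero (μ := volume)
      hφK.mul_right hnn (x := x) (by
        refine mul_ne_zero ?_ hpos.ne'
        have hk := le_ker (n := n) (θ := 0) ht2 (z := x - x) (by simp)
        refine (lt_of_lt_of_le ?_ hk).ne'
        have := kap_pos n
        have := expNegInvGlue.pos_of_pos (x := 1 - (0 : ℝ) ^ 2) (by norm_num)
        positivity))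
    exact h3.ne' h2
  refine ⟨((contDiff_infty.1 hmc 2).contDiffAt).congr_of_eventuallyEq
    (hev x₀ (mem_ball_self hs0)), ?_⟩
  filter_upwards [isOpen_ball.mem_nhds (mem_ball_self (x := x₀) hs0)] with x hx
  rw [InnerProductSpace.laplacian_congr_nhds (hev x hx) |>.self_of_nhds]
  refine le_antisymm (not_lt.1 fun hlt => hsign x hx 1 (by simpa using hlt)) (not_lt.1 fun hlt =>
    hsign x hx (-1) (by simpa using hlt))

/-- The interior Lipschitz estimate is uniform along an exhausting sequence of cylinders. -/
lemma Obstacles.minSeq (hVW : Obstacles V W) {R h : ℕ → ℝ} (hR : Tendsto R atTop atTop)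
    (hh : Tendsto h atTop atTop) {v : ℕ → E n → ℝ}
    (hv : ∀ k, IsLocalMinimizer V W (cylinder n (R k) (h k)) (v k))
    (hc : ∀ k, ContinuousOn (v k) (cylinder n (R k) (h k))) : MinSeq V W v := by
  intro r
  set s := max r 1 with hs
  have hs0 : 0 < s := by positivity
  obtain ⟨L, hLV, hLW⟩ := hVW.lip (3 * s)
  obtain ⟨Λ, hΛ⟩ := PerturbMin.exists_lipschitzOnWith n L hs0
  refine ⟨L, Λ, ?_⟩
  filter_upwards [hR.eventually_ge_atTop (3 * s), hh.eventually_ge_atTop (3 * s)] with k hRk hhk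
  have hsub : ball (0 : E n) (3 * s) ⊆ cylinder n (R k) (h k) := ball_subset_cylinder hRk hhk
  obtain ⟨L', hV', hW'⟩ := hVW.lip_of_isBounded (isBounded_cylinder (n := n) (R k) (h k))
  have hp := ((hv k).perturbMin hVW (isOpen_cylinder _ _) (isBounded_cylinder _ _) hV' hW').mono
    isOpen_ball hsub hLV hLW
  have hr : ball (0 : E n) r ⊆ ball 0 (3 * s) :=
    ball_subset_ball (by linarith [le_max_left r 1])
  exact ⟨(hΛ hp ((hc k).mono hsub) hVW.subharm hVW.superharm 0 subset_rfl).mono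
      (ball_subset_ball (le_max_left _ _)),
    _, hp.mono isOpen_ball hr (hLV.mono hr) (hLW.mono hr)⟩

/-- Monotonicity passes to the continuous representative. -/
lemma MonotoneLastOn.of_ae_eq (hΩ : IsOpen Ω) {v : E n → ℝ} (hu : MonotoneLastOn u Ω)
    (h : u =ᵐ[volume.restrict Ω] v) (hv : ContinuousOn v Ω) : MonotoneLastOn v Ω := by
  intro x hx t ht hy
  have ho : IsOpen (Ω ∩ shift t ⁻¹' Ω) := hΩ.inter (hΩ.preimage (shift t).continuous)
  have h1 := (ae_restrict_iff' hΩ.measurableSet).1 h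
  have h2 := (measurePreserving_motion (LinearIsometryEquiv.refl ℝ (E n))
    (t • eLast n)).quasiMeasurePreserving.ae h1
  refine le_of_ae_le_of_continuousOn ho (hv.mono Set.inter_subset_left)
    (hv.comp (shift t).continuous.continuousOn fun y hy => hy.2) ?_ x ⟨hx, hy⟩
  rw [ae_restrict_iff' ho.measurableSet]
  filter_upwards [h1, h2] with y hy1 hy2 hyΩ
  have h3 := hy2 hyΩ.2
  rw [← hy1 hyΩ.1]
  refine le_trans ?_ h3.le
  exact hu y hyΩ.1 t ht hyΩ.2

lemma MinSeq.eventually_abs_le {v : ℕ → E n → ℝ} (h : MinSeq V W v) (x : E n) :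
    ∀ᶠ k in atTop, |v k x| ≤ 1 := by
  obtain ⟨_, Λ, hk⟩ := h (‖x‖ + 1)
  filter_upwards [hk] with k ⟨hl, g, hp⟩
  obtain ⟨h1, h2⟩ := hp.mem_of_continuousOn hl.continuousOn x (by simp)
  exact abs_le.2 ⟨(abs_le.1 (hp.abs_V x)).1.trans h1, h2.trans (abs_le.1 (hp.abs_W x)).2⟩

lemma MinSeq.locallyLipschitz {v : ℕ → E n → ℝ} {w : E n → ℝ} (h : MinSeq V W v)
    (hw : TendstoLocallyUniformly v w atTop) : LocallyLipschitz w := fun x => by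
  obtain ⟨Λ, hΛ⟩ := h.exists_lipschitzOnWith hw (‖x‖ + 1)
  exact ⟨Λ, ball 0 (‖x‖ + 1), isOpen_ball.mem_nhds (by simp), hΛ⟩

lemma MinSeq.harmonicOnNhd {v : ℕ → E n → ℝ} {w : E n → ℝ} (h : MinSeq V W v)
    (hw : TendstoLocallyUniformly v w atTop) (hVs : WeakSubharm V)
    (hWs : WeakSubharm fun x => -W x) : InnerProductSpace.HarmonicOnNhd w {x | |w x| < 1} := by
  intro x hx
  obtain ⟨L, hp⟩ := h.perturbMin hw (‖x‖ + 1)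
  exact hp.harmonicAt (h.locallyLipschitz hw).continuous.continuousOn hVs hWs (by simp) hx

lemma monotoneLastOn_of_tendsto {R h : ℕ → ℝ} (hR : Tendsto R atTop atTop)
    (hh : Tendsto h atTop atTop) {v : ℕ → E n → ℝ} {w : E n → ℝ}
    (hv : ∀ k, MonotoneLastOn (v k) (cylinder n (R k) (h k)))
    (hw : ∀ x, Tendsto (fun k => v k x) atTop (𝓝 (w x))) : MonotoneLastOn w Set.univ := by
  intro x _ t ht _
  have hev : ∀ y : E n, ∀ᶠ k in atTop, y ∈ cylinder n (R k) (h k) := fun y => by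
    filter_upwards [hR.eventually_ge_atTop (‖y‖ + 1), hh.eventually_ge_atTop (‖y‖ + 1)]
      with k h1 h2
    exact ball_subset_cylinder h1 h2 (by simp)
  refine le_of_tendsto_of_tendsto (hw x) (hw _) ?_
  filter_upwards [hev x, hev (x + t • eLast n)] with k h1 h2
  exact hv k x h1 t ht h2

end FreeBoundary

theorem mainTheorem8 (n : ℕ) (V W : FreeBoundary.E n → ℝ)
    (hV : FreeBoundary.IsSubsolution V) (hW : FreeBoundary.IsSupersolution W)
    (hVmono : FreeBoundary.MonotoneLastOn V Set.univ)
    (hWmono : FreeBoundary.MonotoneLastOn W Set.univ)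
    (hVW : ∀ x, V x ≤ W x)
    (hint : FreeBoundary.NicelyIntertwinedGlobally V W) :
    -- monotone constrained local minimizers exist in every cylinder
    (∀ R h : ℝ, 0 < R → 0 < h → ∃ u : FreeBoundary.E n → ℝ,
      FreeBoundary.IsLocalMinimizer V W (FreeBoundary.cylinder n R h) u ∧
      FreeBoundary.MonotoneLastOn u (FreeBoundary.cylinder n R h)) ∧
    -- for every exhausting sequence of cylinders and every choice of such minimizers
    (∀ R h : ℕ → ℝ, (∀ k, 0 < R k) → (∀ k, 0 < h k) → Monotone R → Monotone h →
      Tendsto R atTop atTop → Tendsto h atTop atTop →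
      ∀ u : ℕ → FreeBoundary.E n → ℝ,
      (∀ k, FreeBoundary.IsLocalMinimizer V W (FreeBoundary.cylinder n (R k) (h k)) (u k) ∧
        FreeBoundary.MonotoneLastOn (u k) (FreeBoundary.cylinder n (R k) (h k))) →
      -- the minimizers have continuous representatives
      ∃ u' : ℕ → FreeBoundary.E n → ℝ,
        (∀ k, ContinuousOn (u' k) (FreeBoundary.cylinder n (R k) (h k)) ∧
          u' k =ᵐ[volume.restrict (FreeBoundary.cylinder n (R k) (h k))] u k) ∧
        -- a subsequence of which converges locally uniformly
        (∃ (φ : ℕ → ℕ) (uLim : FreeBoundary.E n → ℝ), StrictMono φ ∧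
          TendstoLocallyUniformly (fun k => u' (φ k)) uLim atTop) ∧
        -- and every such limit has the asserted properties
        ∀ (φ : ℕ → ℕ) (uLim : FreeBoundary.E n → ℝ), StrictMono φ →
          TendstoLocallyUniformly (fun k => u' (φ k)) uLim atTop →
          LocallyLipschitz uLim ∧
          FreeBoundary.MonotoneLastOn uLim Set.univ ∧
          (∀ x, V x ≤ uLim x ∧ uLim x ≤ W x) ∧
          InnerProductSpace.HarmonicOnNhd uLim {x | |uLim x| < 1} ∧
          FreeBoundary.IsGlobalMinimizer V W uLim) := by
  have hO := FreeBoundary.obstacles_of_solutions hV hW hVW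
  refine ⟨fun R h _ _ => hO.exists_monotone_isLocalMinimizer hVmono hWmono R h, ?_⟩
  intro R h _ _ _ _ hR hh u hu
  have hex := fun k => (hu k).1.exists_tame hO (FreeBoundary.isOpen_cylinder _ _)
    (FreeBoundary.isBounded_cylinder _ _)
  choose u' hae hc _ _ using hex
  have hmin := fun k => (hu k).1.congr (FreeBoundary.isOpen_cylinder _ _) (hae k)
  have hmono := fun k => (hu k).2.of_ae_eq (FreeBoundary.isOpen_cylinder _ _) (hae k) (hc k)
  have hseq := hO.minSeq hR hh hmin hc
  refine ⟨u', fun k => ⟨hc k, (hae k).symm⟩, ?_, fun φ uLim hφ hlim => ?_⟩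
  · refine FreeBoundary.exists_subseq_tendstoLocallyUniformly (fun r => ?_) hseq.eventually_abs_le
    obtain ⟨_, Λ, hk⟩ := hseq r
    exact ⟨Λ, hk.mono fun _ h => h.1⟩
  · have hs := hseq.comp hφ
    exact ⟨hs.locallyLipschitz hlim,
      FreeBoundary.monotoneLastOn_of_tendsto (hR.comp hφ.tendsto_atTop) (hh.comp hφ.tendsto_atTop)
        (fun k => hmono (φ k)) (FreeBoundary.TendstoLocallyUniformly.tendsto_apply hlim),
      hs.mem hlim, hs.harmonicOnNhd hlim hO.subharm hO.superharm, hs.isGlobalMinimizer hlim⟩
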